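/- Let $M$ be a closed connected $3$-manifold with a triangulation $\mathcal T$: a homeomorphism from a finite simplicial complex to $M$ in which every simplex is a face of a tetrahedron, no simplex has dimension greater than $3$, every triangle lies in exactly two tetrahedra, and the link of every vertex is a $2$-sphere. Suppose that every edge of $\mathcal T$ is given an orientation such that (1) for each vertex $v$, the maximal subgraphs of the $1$-skeleton of $\mathrm{link}(v)$ whose vertices are, respectively, the endpoints of the edges outgoing from $v$ and the initial points of the edges incoming to $v$, are nonempty and connected, and (2) the orientations restrict to a total ordering of the vertices of each tetrahedron. (It is not assumed that the $1$-skeleton is recurrent as a directed graph.) Suppose moreover that every directed loop (of positive length) in the $1$-skeleton is homotopically essential in $M$. Let $p\colon\tilde M\to M$ be a universal cover, with the triangulation and the edge orientations pulled back from $M$. Then $\tilde M$ admits a (nonsingular) co-oriented, transversely measured codimension-one topological foliation, that is, an atlas of charts to $\mathbb R^2\times\mathbb R$ whose vertical coordinates differ locally by constants (the transverse measure being $|dt|$ for the vertical coordinate $t$), which * is transverse to the $1$-skeleton compatibly with its orientations: along every edge of $\tilde M$, traversed in its direction, the vertical coordinate of every chart is strictly increasing; and * is in normal form: every leaf is a normal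 surface away from the vertices, i.e. every component of the intersection of a leaf with a tetrahedron of $\tilde M$ is, up to a homeomorphism of the tetrahedron preserving each of its faces, a nonempty section of the tetrahedron by a level set of an affine function taking distinct values at the four vertices (a triangle or quadrilateral missing the vertices, a triangle with exactly one of its corners at a vertex, or a single vertex). -/

import Mathlib

open Set Topology unitInterval

noncomputable section

namespace TriFol

universe u v

/-- The (geometric) link of `a` in a simplicial complex: the union of all faces `s` that do not
contain `a` but span a face together with `a`. -/
def linkSpace {E : Type u} [AddCommGroup E] [Module ℝ E]
    (K : Geometry.SimplicialComplex ℝ E) (a : E) : Set E :=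
  open scoped Classical in
  ⋃ s ∈ {s : Finset E | s ∈ K.faces ∧ a ∉ s ∧ insert a s ∈ K.faces}, convexHull ℝ (s : Set E)

/-- The `1`-skeleton of the link of `a`: two distinct points `b`, `c`, both different from `a`, are
adjacent when `a, b, c` span a triangle of the complex. -/
def linkGraph {E : Type u} [AddCommGroup E] [Module ℝ E]
    (K : Geometry.SimplicialComplex ℝ E) (a : E) : SimpleGraph E where
  Adj b c := open scoped Classical in
    b ≠ c ∧ b ≠ a ∧ c ≠ a ∧ ({a, b, c} : Finset E) ∈ K.faces
  symm := ⟨fun b c h => ⟨h.1.symm, h.2.2.1, h.2.1, by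
    classical
    have e : ({a, c, b} : Finset E) = {a, b, c} := by
      ext x
      simp only [Finset.mem_insert, Finset.mem_singleton]
      tauto
    rw [e]
    exact h.2.2.2⟩⟩
  loopless := ⟨fun _ h => h.1 rfl⟩

/-- A triangulation of a closed `3`-manifold `M`: a homeomorphism from (the underlying space of) a
finite simplicial complex to `M`, where the complex is made of tetrahedra and their faces, each
triangle lies in exactly two tetrahedra, and the link of each vertex is a `2`-sphere. -/
structure Triangulation (M : Type v) [TopologicalSpace M]
    (E : Type u) [NormedAddCommGroup E] [NormedSpace ℝ E] where
  K : Geometry.SimplicialComplex ℝ E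
  finite : K.faces.Finite
  homeo : K.space ≃ₜ M
  card_le : ∀ s ∈ K.faces, s.card ≤ 4
  pure : ∀ s ∈ K.faces, ∃ t ∈ K.faces, s ⊆ t ∧ t.card = 4
  two_sided : ∀ s ∈ K.faces, s.card = 3 → {t ∈ K.faces | s ⊆ t ∧ t.card = 4}.ncard = 2
  link_sphere : ∀ a ∈ K.vertices,
    Nonempty (linkSpace K a ≃ₜ Metric.sphere (0 : EuclideanSpace ℝ (Fin 3)) 1)

/-- The edges of a complex, as pairs of distinct vertices. -/
def IsEdge {E : Type u} [AddCommGroup E] [Module ℝ E]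
    (K : Geometry.SimplicialComplex ℝ E) (a b : E) : Prop :=
  open scoped Classical in a ≠ b ∧ ({a, b} : Finset E) ∈ K.faces

/-- A direction: a choice of orientation of each edge. `D.out a b` says that `a` and `b` span an
edge and that this edge is oriented from `a` to `b`. -/
structure Direction {E : Type u} [AddCommGroup E] [Module ℝ E]
    (K : Geometry.SimplicialComplex ℝ E) where
  out : E → E → Prop
  isEdge_of_out : ∀ a b, out a b → IsEdge K a b
  out_xor : ∀ a b, IsEdge K a b → Xor (out a b) (out b a)

/-- A (not necessarily recurrent) local orientation. The first two conditions say that the maximal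
subgraphs of the link of a vertex whose vertices are, respectively, the outgoing and the incoming
vertices are nonempty and connected (`SimpleGraph.Connected` includes nonemptiness). -/
structure Direction.IsLocalOrientation {E : Type u} [AddCommGroup E] [Module ℝ E]
    {K : Geometry.SimplicialComplex ℝ E} (D : Direction K) : Prop where
  out_connected : ∀ a ∈ K.vertices, ((linkGraph K a).induce {b | D.out a b}).Connected
  in_connected : ∀ a ∈ K.vertices, ((linkGraph K a).induce {b | D.out b a}).Connected
  total : ∀ s ∈ K.faces, s.card = 4 →
    IsStrictTotalOrder {x : E // x ∈ s} (fun x y => D.out x.1 y.1)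

theorem IsEdge.lineMap_mem {E : Type u} [AddCommGroup E] [Module ℝ E]
    {K : Geometry.SimplicialComplex ℝ E} {a b : E} (h : IsEdge K a b) (t : I) :
    AffineMap.lineMap a b (t : ℝ) ∈ K.space := by
  classical
  refine K.convexHull_subset_space h.2 ?_
  have h2 : AffineMap.lineMap a b (t : ℝ) ∈ segment ℝ a b := by
    rw [segment_eq_image_lineMap]
    exact ⟨t, t.2, rfl⟩
  simpa [convexHull_pair] using h2

theorem IsEdge.left_mem {E : Type u} [AddCommGroup E] [Module ℝ E]
    {K : Geometry.SimplicialComplex ℝ E} {a b : E} (h : IsEdge K a b) : a ∈ K.space := by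
  simpa using h.lineMap_mem 0

theorem IsEdge.right_mem {E : Type u} [AddCommGroup E] [Module ℝ E]
    {K : Geometry.SimplicialComplex ℝ E} {a b : E} (h : IsEdge K a b) : b ∈ K.space := by
  simpa using h.lineMap_mem 1

/-- The point of `M` that corresponds to a point of the complex (in particular, to a vertex). -/
def Triangulation.pt {M : Type v} [TopologicalSpace M]
    {E : Type u} [NormedAddCommGroup E] [NormedSpace ℝ E] (T : Triangulation M E)
    (a : E) (ha : a ∈ T.K.space) : M :=
  T.homeo ⟨a, ha⟩

/-- The edge from `a` to `b`, as a path in `M` which is affine in the triangulation. -/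
def Triangulation.edgePath {M : Type v} [TopologicalSpace M]
    {E : Type u} [NormedAddCommGroup E] [NormedSpace ℝ E] (T : Triangulation M E) {a b : E}
    (h : IsEdge T.K a b) : Path (T.pt a h.left_mem) (T.pt b h.right_mem) where
  toFun t := T.pt (AffineMap.lineMap a b (t : ℝ)) (h.lineMap_mem t)
  continuous_toFun := by
    refine T.homeo.continuous.comp (Continuous.subtype_mk ?_ _)
    exact AffineMap.lineMap_continuous.comp continuous_subtype_val
  source' := by simp
  target' := by simp

/-- Directed paths in the `1`-skeleton (of positive length): concatenations of edges, each
traversed according to its orientation. -/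
inductive IsDirectedPath {M : Type v} [TopologicalSpace M]
    {E : Type u} [NormedAddCommGroup E] [NormedSpace ℝ E] (T : Triangulation M E)
    (D : Direction T.K) : ∀ {x y : M}, Path x y → Prop
  | edge {a b : E} (h : D.out a b) : IsDirectedPath T D (T.edgePath (D.isEdge_of_out a b h))
  | trans {x y z : M} {γ : Path x y} {δ : Path y z} :
      IsDirectedPath T D γ → IsDirectedPath T D δ → IsDirectedPath T D (γ.trans δ)

/-- Every directed loop in the `1`-skeleton is homotopically essential. -/
def DirectedLoopsEssential {M : Type v} [TopologicalSpace M]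
    {E : Type u} [NormedAddCommGroup E] [NormedSpace ℝ E] (T : Triangulation M E)
    (D : Direction T.K) : Prop :=
  ∀ (x : M) (γ : Path x x), IsDirectedPath T D γ → ¬ γ.Homotopic (Path.refl x)

/-- A co-oriented transversely measured foliation by surfaces of a topological `3`-manifold: an
atlas of charts to `ℝ² × ℝ` (plaques are horizontal) such that the vertical coordinates of any two
charts differ locally by a constant. The transverse measure is the one given in each chart by
Lebesgue measure `|dt|` of the vertical coordinate `t`; the co-orientation is the upward one. -/
structure MeasuredFoliation (X : Type v) [TopologicalSpace X] where
  atlas : Set (OpenPartialHomeomorph X (EuclideanSpace ℝ (Fin 2) × ℝ))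
  exists_chart : ∀ x : X, ∃ φ ∈ atlas, x ∈ φ.source
  translation : ∀ φ ∈ atlas, ∀ ψ ∈ atlas, ∀ x ∈ φ.source ∩ ψ.source,
    ∃ c : ℝ, ∀ᶠ y in 𝓝 x, (ψ y).2 = (φ y).2 + c

namespace MeasuredFoliation

variable {X : Type v} [TopologicalSpace X] (F : MeasuredFoliation X)

/-- Paths that stay in one leaf: the vertical coordinate is locally constant in each chart. -/
def IsTangent (γ : C(I, X)) : Prop :=
  ∀ φ ∈ F.atlas, ∀ t : I, γ t ∈ φ.source → ∀ᶠ r in 𝓝 t, (φ (γ r)).2 = (φ (γ t)).2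

/-- The leaf through `x`. -/
def leaf (x : X) : Set X :=
  {y | ∃ γ : C(I, X), F.IsTangent γ ∧ γ 0 = x ∧ γ 1 = y}

/-- Paths that are positively transverse to the foliation: near each time, the vertical coordinate
in each chart is strictly increasing along the path. -/
def IsPositivelyTransverse (γ : C(I, X)) : Prop :=
  ∀ φ ∈ F.atlas, ∀ t : I, γ t ∈ φ.source →
    ∃ N ∈ 𝓝 t, StrictMonoOn (fun r => (φ (γ r)).2) N

end MeasuredFoliation

/-- Normal pieces in a simplex with vertex set `s`: up to a homeomorphism of the simplex that
preserves each face, a nonempty section by a level set of an affine function that takes distinct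
values on the vertices. In a tetrahedron, a normal piece that contains no vertex is precisely a
normal disk (a triangle or a quadrilateral); the others are what a normal surface away from the
vertices looks like when it passes through a vertex: the vertex itself, or a triangle with exactly
one of its corners at a vertex. -/
def IsNormalPiece {E : Type u} [NormedAddCommGroup E] [NormedSpace ℝ E] (s : Finset E)
    (P : Set (convexHull ℝ (s : Set E))) : Prop :=
  P.Nonempty ∧
  ∃ Φ : convexHull ℝ (s : Set E) ≃ₜ convexHull ℝ (s : Set E),
    (∀ t ⊆ s, ∀ x, (Φ x : E) ∈ convexHull ℝ (t : Set E) ↔ (x : E) ∈ convexHull ℝ (t : Set E)) ∧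
    ∃ (l : E →ᵃ[ℝ] ℝ) (c : ℝ), InjOn l (s : Set E) ∧ P = {x | l (Φ x : E) = c}

/-- A lift to `X` of the simplex with vertex set `s`: a simplex of the pulled back triangulation
of `X`, for a covering `p : X → M`. -/
def Triangulation.IsLift {M X : Type*} [TopologicalSpace M] [TopologicalSpace X]
    {E : Type u} [NormedAddCommGroup E] [NormedSpace ℝ E] (T : Triangulation M E)
    (p : X → M) {s : Finset E} (hs : s ∈ T.K.faces) (τ : C(convexHull ℝ (s : Set E), X)) : Prop :=
  ∀ x, p (τ x) = T.pt x (T.K.convexHull_subset_space hs x.2)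

/-- The foliation is in normal form with respect to the pulled back triangulation: each component
of the intersection of a leaf with a tetrahedron is a normal piece. -/
def MeasuredFoliation.IsNormal {M X : Type*} [TopologicalSpace M] [TopologicalSpace X]
    {E : Type u} [NormedAddCommGroup E] [NormedSpace ℝ E] (F : MeasuredFoliation X)
    (T : Triangulation M E) (p : X → M) : Prop :=
  ∀ (s : Finset E) (hs : s ∈ T.K.faces), s.card = 4 →
    ∀ τ : C(convexHull ℝ (s : Set E), X), T.IsLift p hs τ →
      ∀ (x : X), ∀ z ∈ τ ⁻¹' F.leaf x, IsNormalPiece s (pathComponentIn (τ ⁻¹' F.leaf x) z)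

/-- The foliation is transverse to the `1`-skeleton of the pulled back triangulation, and its
co-orientation agrees with the pulled back orientations of the edges. -/
def MeasuredFoliation.IsTransverseTo {M X : Type*} [TopologicalSpace M] [TopologicalSpace X]
    {E : Type u} [NormedAddCommGroup E] [NormedSpace ℝ E] (F : MeasuredFoliation X)
    (T : Triangulation M E) (D : Direction T.K) (p : X → M) : Prop :=
  ∀ (a b : E) (h : D.out a b) (γ : C(I, X)),
    (∀ t, p (γ t) = T.edgePath (D.isEdge_of_out a b h) t) → F.IsPositivelyTransverse γ

end TriFol

end

open Set Topology unitInterval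

noncomputable section

open scoped Classical

namespace TriFol

/-! ### Cones over abstract complexes -/

/-- The cone over an abstract complex `F`: nonnegative weights supported on a face. -/
def cone {V : Type*} (F : Set (Finset V)) : Set (V → ℝ) :=
  {x | (∀ v, 0 ≤ x v) ∧ ∃ s ∈ F, ∀ v ∉ s, x v = 0}

/-- The link of `w` in an abstract complex. -/
def link {V : Type*} (F : Set (Finset V)) (w : V) : Set (Finset V) :=
  {s | w ∉ s ∧ insert w s ∈ F}

/-- The sign which is `1` on `P` and `-1` elsewhere. -/
def sgn {V : Type*} (P : Finset V) (v : V) : ℝ := if v ∈ P then 1 else -1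

/-- The linear function whose value at each basis vector in `A` is the sign. -/
def height {V : Type*} (A P : Finset V) (x : V → ℝ) : ℝ := ∑ v ∈ A, sgn P v * x v

/-- A homeomorphism from the cone over `F` to `Y × ℝ` whose last coordinate is `height A P`. -/
def IsModel {V : Type*} (Y : Type*) [TopologicalSpace Y] (F : Set (Finset V))
    (A P : Finset V) : Prop :=
  ∃ κ : cone F ≃ₜ Y × ℝ, ∀ x, (κ x).2 = height A P x

/-- The upper half of the cone is a half space. -/
def IsHalfModel {V : Type*} (Z : Type*) [TopologicalSpace Z] (F : Set (Finset V))
    (A P : Finset V) : Prop :=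
  ∃ κ : {x : cone F // 0 ≤ height A P x} ≃ₜ Z × Ici (0 : ℝ), ∀ x, ((κ x).2 : ℝ) = height A P x

section Cone

variable {V : Type*} {F : Set (Finset V)} {A P : Finset V} {w : V}

theorem continuous_height (A P : Finset V) : Continuous (height A P) := by
  unfold height
  fun_prop

theorem isClosed_cone (hF : ∀ s ∈ F, s ⊆ A) : IsClosed (cone F) := by
  have hfin : F.Finite := (Finset.finite_toSet A.powerset).subset fun s hs => by
    simpa using hF s hs
  have e : cone F = {x | ∀ v, 0 ≤ x v} ∩ ⋃ s ∈ F, {x | ∀ v ∉ s, x v = 0} := by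
    ext x
    simp [cone]
  rw [e]
  refine IsClosed.inter ?_ (hfin.isClosed_biUnion fun s _ => ?_)
  · simp only [ofPred_forall]
    exact isClosed_iInter fun v => isClosed_le continuous_const (continuous_apply v)
  · simp only [ofPred_forall]
    exact isClosed_iInter fun v => isClosed_iInter fun _ =>
      isClosed_eq (continuous_apply v) continuous_const

theorem apply_eq_zero_of_mem_cone_link {y : V → ℝ} (hy : y ∈ cone (link F w)) : y w = 0 := by
  obtain ⟨_, s, hs, h⟩ := hy
  exact h w hs.1

theorem update_mem_cone {y : V → ℝ} (hy : y ∈ cone (link F w)) {r : ℝ} (hr : 0 ≤ r) :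
    Function.update y w r ∈ cone F := by
  obtain ⟨h0, s, hs, h⟩ := hy
  refine ⟨fun v => ?_, insert w s, hs.2, fun v hv => ?_⟩
  · by_cases hv : v = w
    · subst hv; simpa
    · simpa [hv] using h0 v
  · rw [Finset.mem_insert, not_or] at hv
    simpa [hv.1] using h v hv.2

theorem update_mem_cone_link {x : V → ℝ} (hx : x ∈ cone F)
    (hw : x w ≠ 0) : Function.update x w 0 ∈ cone (link F w) := by
  obtain ⟨h0, s, hs, h⟩ := hx
  have hws : w ∈ s := by
    by_contra hc
    exact hw (h w hc)
  refine ⟨fun v => ?_, s.erase w, ⟨by simp, by rwa [Finset.insert_erase hws]⟩, fun v hv => ?_⟩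
  · by_cases hv : v = w
    · subst hv; simp
    · simpa [hv] using h0 v
  · by_cases hvw : v = w
    · subst hvw; simp
    · simpa [hvw] using h v fun hc => hv (Finset.mem_erase.2 ⟨hvw, hc⟩)

theorem height_eq_add (hw : w ∈ A) (x : V → ℝ) :
    height A P x = sgn P w * x w + height A P (Function.update x w 0) := by
  unfold height
  rw [← Finset.add_sum_erase A _ hw, ← Finset.add_sum_erase A (fun v => sgn P v *
    Function.update x w 0 v) hw]
  simp only [Function.update_self, mul_zero, zero_add, add_right_inj]
  refine Finset.sum_congr rfl fun v hv => ?_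
  rw [Function.update_of_ne (Finset.ne_of_mem_erase hv)]

theorem height_congr {P' : Finset V} {x : V → ℝ} (h : ∀ v ∈ A, x v ≠ 0 → (v ∈ P ↔ v ∈ P')) :
    height A P x = height A P' x := by
  refine Finset.sum_congr rfl fun v hv => ?_
  by_cases hx : x v = 0
  · simp [hx]
  · simp [sgn, h v hv hx]

theorem height_neg {N : Finset V} {x : V → ℝ} (h : ∀ v ∈ A, x v ≠ 0 → (v ∈ P ↔ v ∉ N)) :
    height A N x = - height A P x := by
  unfold height
  rw [← Finset.sum_neg_distrib]
  refine Finset.sum_congr rfl fun v hv => ?_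
  by_cases hx : x v = 0
  · simp [hx]
  · by_cases hN : v ∈ N <;> simp [sgn, h v hv hx, hN]

/-! ### Changing the sign of one vertex -/

/-- The shear of the star of `w`, for a model of its link: the height of the link component is
changed by `c` times the weight of `w`. -/
def shear {Y : Type*} [TopologicalSpace Y] (κ : cone (link F w) ≃ₜ Y × ℝ) (c : ℝ)
    (x : V → ℝ) : V → ℝ :=
  if h : Function.update x w 0 ∈ cone (link F w) then
    Function.update (κ.symm ((κ ⟨_, h⟩).1, (κ ⟨_, h⟩).2 + c * x w) : V → ℝ) w (x w)
  else x

variable {Y : Type*} [TopologicalSpace Y] (κ : cone (link F w) ≃ₜ Y × ℝ) (c : ℝ)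

theorem shear_mem {x : V → ℝ} (hx : x ∈ cone F) : shear κ c x ∈ cone F := by
  unfold shear
  split_ifs with h
  · exact update_mem_cone (Subtype.coe_prop _) (hx.1 w)
  · exact hx

theorem update_shear {x : V → ℝ} (h : Function.update x w 0 ∈ cone (link F w)) :
    Function.update (shear κ c x) w 0 =
      (κ.symm ((κ ⟨_, h⟩).1, (κ ⟨_, h⟩).2 + c * x w) : V → ℝ) := by
  rw [shear, dif_pos h, Function.update_idem]
  refine Function.update_eq_self_iff.2 ?_
  exact (apply_eq_zero_of_mem_cone_link (Subtype.coe_prop _)).symm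

theorem shear_apply_self (x : V → ℝ) : shear κ c x w = x w := by
  unfold shear
  split_ifs <;> simp

theorem shear_shear {x : V → ℝ} : shear κ (-c) (shear κ c x) = x := by
  by_cases h : Function.update x w 0 ∈ cone (link F w)
  · have h2 := update_shear κ c h
    have h3 : Function.update (shear κ c x) w 0 ∈ cone (link F w) := h2 ▸ Subtype.coe_prop _
    have h4 : (⟨_, h3⟩ : cone (link F w)) =
        κ.symm ((κ ⟨_, h⟩).1, (κ ⟨_, h⟩).2 + c * x w) := Subtype.ext h2
    rw [shear, dif_pos h3, h4, shear_apply_self]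
    simp
  · have : shear κ c x = x := by rw [shear, dif_neg h]
    rw [this, shear, dif_neg h]

theorem shear_of_apply_eq_zero {x : V → ℝ} (hx : x w = 0) : shear κ c x = x := by
  unfold shear
  split_ifs with h
  · simp [hx]
  · rfl

theorem continuous_shear (hF : ∀ s ∈ F, s ⊆ A) :
    Continuous fun x : cone F => shear κ c x := by
  have hup : Continuous fun x : cone F => Function.update (x : V → ℝ) w 0 :=
    continuous_subtype_val.update w continuous_const
  have hlA : ∀ s ∈ link F w, s ⊆ A := fun s hs => (Finset.subset_insert w s).trans (hF _ hs.2)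
  have h1 : ContinuousOn (fun x : cone F => shear κ c x)
      {x | Function.update (x : V → ℝ) w 0 ∈ cone (link F w)} := by
    rw [continuousOn_iff_continuous_domRestrict]
    have e : Set.domRestrict {x : cone F | Function.update (x : V → ℝ) w 0 ∈ cone (link F w)}
        (fun x : cone F => shear κ c x) = fun x => Function.update
          (κ.symm ((κ ⟨_, x.2⟩).1, (κ ⟨_, x.2⟩).2 + c * x.1.1 w) : V → ℝ) w (x.1.1 w) := by
      funext x
      exact dif_pos x.2
    rw [e]
    have h3 : Continuous fun x : {x : cone F | Function.update (x : V → ℝ) w 0 ∈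
        cone (link F w)} => κ ⟨_, x.2⟩ :=
      κ.continuous.comp (Continuous.subtype_mk (hup.comp continuous_subtype_val) _)
    have h4 : Continuous fun x : {x : cone F | Function.update (x : V → ℝ) w 0 ∈
        cone (link F w)} => x.1.1 w :=
      (continuous_apply w).comp (continuous_subtype_val.comp continuous_subtype_val)
    refine Continuous.update ?_ w h4
    exact continuous_subtype_val.comp (κ.symm.continuous.comp
      (h3.fst.prodMk (h3.snd.add (continuous_const.mul h4))))
  have h2 : ContinuousOn (fun x : cone F => shear κ c x) {x | (x : V → ℝ) w = 0} := by
    refine continuous_subtype_val.continuousOn.congr fun x hx => ?_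
    exact shear_of_apply_eq_zero κ c hx
  have h3 := h1.union_of_isClosed h2 ((isClosed_cone hlA).preimage hup)
    (isClosed_eq ((continuous_apply w).comp continuous_subtype_val) continuous_const)
  rw [← continuousOn_univ]
  refine h3.mono fun x _ => ?_
  by_cases hx : (x : V → ℝ) w = 0
  · exact Or.inr hx
  · exact Or.inl (update_mem_cone_link x.2 hx)

/-- The shear as a homeomorphism of the cone. -/
def shearHomeo (hF : ∀ s ∈ F, s ⊆ A) : cone F ≃ₜ cone F where
  toFun x := ⟨shear κ c x, shear_mem κ c x.2⟩
  invFun x := ⟨shear κ (-c) x, shear_mem κ (-c) x.2⟩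
  left_inv x := Subtype.ext (shear_shear κ c)
  right_inv x := Subtype.ext (by simpa using shear_shear κ (-c) (x := x))
  continuous_toFun := (continuous_shear κ c hF).subtype_mk _
  continuous_invFun := (continuous_shear κ (-c) hF).subtype_mk _

theorem exists_homeo_flip (hF : ∀ s ∈ F, s ⊆ A) (hwA : w ∈ A)
    (hw : w ∉ P) (hm : IsModel Y (link F w) A P) :
    ∃ θ : cone F ≃ₜ cone F, ∀ x, height A (insert w P) (θ x) = height A P x := by
  obtain ⟨κ, hκ⟩ := hm
  refine ⟨shearHomeo κ (-2) hF, fun x => ?_⟩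
  have key : ∀ y : V → ℝ, height A (insert w P) (Function.update y w 0) =
      height A P (Function.update y w 0) := fun y => height_congr fun v _ hv => by
    have : v ≠ w := by
      rintro rfl
      simp at hv
    simp [this]
  change height A (insert w P) (shear κ (-2) x) = _
  rw [height_eq_add hwA, key, height_eq_add (P := P) hwA (x : V → ℝ), shear_apply_self]
  by_cases h : Function.update (x : V → ℝ) w 0 ∈ cone (link F w)
  · rw [update_shear κ _ h, ← hκ]
    have := hκ ⟨_, h⟩
    simp only [Homeomorph.apply_symm_apply, this, sgn, hw, Finset.mem_insert, true_or, if_true,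
      if_false]
    ring
  · have hx : (x : V → ℝ) w = 0 := by
      by_contra hc
      exact h (update_mem_cone_link x.2 hc)
    rw [shear_of_apply_eq_zero κ _ hx, hx]
    simp

/-! ### Half models -/

theorem IsHalfModel.of_homeo {Z : Type*} [TopologicalSpace Z] {P' : Finset V}
    (h : IsHalfModel Z F A P') (θ : cone F ≃ₜ cone F)
    (hθ : ∀ x, height A P' (θ x) = height A P x) : IsHalfModel Z F A P := by
  obtain ⟨κ, hκ⟩ := h
  refine ⟨(θ.subtype (p := fun x : cone F => 0 ≤ height A P x)
    (q := fun x : cone F => 0 ≤ height A P' x)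
    fun x => by rw [hθ]).trans κ, fun x => ?_⟩
  rw [← hθ]
  exact hκ _

theorem isHalfModel_singleton {Z : Type*} [TopologicalSpace Z]
    (hF : ∀ s ∈ F, s ⊆ A) (hw : {w} ∈ F)
    (κ : cone (link F w) ≃ₜ Z) : IsHalfModel Z F A {w} := by
  have hwA : w ∈ A := hF _ hw (by simp)
  have hcoef : ∀ y ∈ cone (link F w), height A {w} y = - ∑ v ∈ A, y v := by
    intro y hy
    unfold height
    rw [← Finset.sum_neg_distrib]
    refine Finset.sum_congr rfl fun v _ => ?_
    by_cases hv : v = w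
    · subst hv; simp [apply_eq_zero_of_mem_cone_link hy]
    · simp [sgn, hv]
  have hmem : ∀ x : {x : cone F // 0 ≤ height A {w} x},
      Function.update (x.1 : V → ℝ) w 0 ∈ cone (link F w) := by
    rintro ⟨⟨x, hx⟩, h0⟩
    by_cases hxw : x w = 0
    · have h1 : height A {w} x = - ∑ v ∈ A, x v := by
        unfold height
        rw [← Finset.sum_neg_distrib]
        refine Finset.sum_congr rfl fun v _ => ?_
        by_cases hv : v = w
        · subst hv; simp [hxw]
        · simp [sgn, hv]
      have h2 : ∑ v ∈ A, x v = 0 := by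
        refine le_antisymm ?_ (Finset.sum_nonneg fun v _ => hx.1 v)
        have : 0 ≤ height A {w} x := h0
        linarith
      have h3 : ∀ v, x v = 0 := by
        intro v
        by_cases hv : v ∈ A
        · exact (Finset.sum_eq_zero_iff_of_nonneg fun v _ => hx.1 v).1 h2 v hv
        · obtain ⟨_, s, hs, h⟩ := hx
          exact h v fun hc => hv (hF s hs hc)
      refine ⟨fun v => ?_, ∅, ⟨by simp, by simpa using hw⟩, fun v _ => ?_⟩ <;>
      · by_cases hv : v = w
        · subst hv; simp
        · simp [hv, h3 v]
    · exact update_mem_cone_link hx hxw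
  have hht : ∀ x : {x : cone F // 0 ≤ height A {w} x}, height A {w} x.1 =
      (x.1 : V → ℝ) w - ∑ v ∈ A, Function.update (x.1 : V → ℝ) w 0 v := by
    intro x
    rw [height_eq_add hwA, hcoef _ (hmem x)]
    simp [sgn, sub_eq_add_neg]
  have hinv : ∀ y ∈ cone (link F w), ∀ r : ℝ, height A {w} (Function.update y w r) =
      r - ∑ v ∈ A, y v := by
    intro y hy r
    have : Function.update y w 0 = y := by
      rw [← apply_eq_zero_of_mem_cone_link hy, Function.update_eq_self]
    rw [height_eq_add hwA, Function.update_idem, this, hcoef _ hy]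
    simp [sgn, sub_eq_add_neg]
  have hcont : Continuous fun x : {x : cone F // 0 ≤ height A {w} x} =>
      Function.update (x.1 : V → ℝ) w 0 :=
    (continuous_subtype_val.comp continuous_subtype_val).update w continuous_const
  let inv0 : Z × Ici (0 : ℝ) → V → ℝ := fun z =>
    Function.update (κ.symm z.1 : V → ℝ) w (z.2 + ∑ v ∈ A, (κ.symm z.1 : V → ℝ) v)
  have hinv0 : ∀ z, height A {w} (inv0 z) = z.2 := fun z => by
    rw [hinv _ (Subtype.coe_prop _)]
    ring
  have hinvc : Continuous inv0 := by
    have h1 : Continuous fun z : Z × Ici (0 : ℝ) => (κ.symm z.1 : V → ℝ) :=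
      continuous_subtype_val.comp (κ.symm.continuous.comp continuous_fst)
    refine h1.update w ((continuous_subtype_val.comp continuous_snd).add ?_)
    exact continuous_finsetSum _ fun v _ => (continuous_apply v).comp h1
  have hinvm : ∀ z, inv0 z ∈ cone F := fun z =>
    update_mem_cone (Subtype.coe_prop _) (add_nonneg z.2.2
      (Finset.sum_nonneg fun v _ => (κ.symm z.1).2.1 v))
  have hinvp : ∀ z, 0 ≤ height A {w} (inv0 z) := fun z => by
    rw [hinv0]
    exact z.2.2
  refine ⟨{ toFun := fun x => (κ ⟨_, hmem x⟩, ⟨height A {w} x.1, x.2⟩)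
            invFun := fun z => ⟨⟨inv0 z, hinvm z⟩, hinvp z⟩
            left_inv := fun x => ?_
            right_inv := fun z => ?_
            continuous_toFun := ?_
            continuous_invFun := (hinvc.subtype_mk hinvm).subtype_mk hinvp }, fun x => rfl⟩
  · refine Subtype.ext (Subtype.ext ?_)
    change inv0 (κ ⟨_, hmem x⟩, ⟨height A {w} x.1, x.2⟩) = x.1
    simp only [inv0, Homeomorph.symm_apply_apply, hht x]
    simp
  · refine Prod.ext ?_ (Subtype.ext (hinv0 z))
    have : (⟨_, hmem ⟨⟨inv0 z, hinvm z⟩, hinvp z⟩⟩ : cone (link F w)) =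
        κ.symm z.1 := by
      refine Subtype.ext ?_
      change Function.update (inv0 z) w 0 = _
      simp only [inv0, Function.update_idem]
      exact Function.update_eq_self_iff.2 (apply_eq_zero_of_mem_cone_link (κ.symm z.1).2).symm
    change κ _ = z.1
    rw [this]
    simp
  · refine (κ.continuous.comp (hcont.subtype_mk _)).prodMk (Continuous.subtype_mk ?_ _)
    exact (continuous_height A {w}).comp (continuous_subtype_val.comp continuous_subtype_val)

end Cone

/-- Two half models of a space with a height function fit together. -/
theorem exists_homeo_of_halves {S Z : Type*} [TopologicalSpace S] [TopologicalSpace Z]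
    {h : S → ℝ} (hc : Continuous h)
    (κ : {x // 0 ≤ h x} ≃ₜ Z × Ici (0 : ℝ)) (hκ : ∀ x, ((κ x).2 : ℝ) = h x)
    (μ : {x // 0 ≤ - h x} ≃ₜ Z × Ici (0 : ℝ)) (hμ : ∀ x, ((μ x).2 : ℝ) = - h x) :
    ∃ ψ : S ≃ₜ Z × ℝ, ∀ x, (ψ x).2 = h x := by
  have hκs : ∀ z, h (κ.symm z) = z.2 := fun z => by rw [← hκ]; simp
  have hμs : ∀ z, h (μ.symm z) = - z.2 := fun z => by
    have := hμ (μ.symm z)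
    simp only [Homeomorph.apply_symm_apply] at this
    linarith
  have hκ0 : ∀ z, h (κ.symm (z, ⟨0, self_mem_Ici⟩)) = 0 := fun z => hκs _
  have hμ0 : ∀ z, h (μ.symm (z, ⟨0, self_mem_Ici⟩)) = 0 := fun z => by simp [hμs]
  let η : Z → Z := fun z => (κ ⟨μ.symm (z, ⟨0, self_mem_Ici⟩), (hμ0 z).ge⟩).1
  let ξ : Z → Z := fun z => (μ ⟨κ.symm (z, ⟨0, self_mem_Ici⟩), by simp [hκ0 z]⟩).1
  have hηc : Continuous η := continuous_fst.comp (κ.continuous.comp (Continuous.subtype_mk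
    (continuous_subtype_val.comp (μ.symm.continuous.comp (by fun_prop))) _))
  have hξc : Continuous ξ := continuous_fst.comp (μ.continuous.comp (Continuous.subtype_mk
    (continuous_subtype_val.comp (κ.symm.continuous.comp (by fun_prop))) _))
  have hη : ∀ x (hx : h x = 0), η (μ ⟨x, by simp [hx]⟩).1 = (κ ⟨x, hx.ge⟩).1 := by
    intro x hx
    have e : ((μ ⟨x, by simp [hx]⟩).1, ⟨0, self_mem_Ici⟩) = μ ⟨x, by simp [hx]⟩ :=
      Prod.ext rfl (Subtype.ext (by simp [hμ, hx]))
    simp only [η, e, Homeomorph.symm_apply_apply]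
  have hξ : ∀ x (hx : h x = 0), ξ (κ ⟨x, hx.ge⟩).1 = (μ ⟨x, by simp [hx]⟩).1 := by
    intro x hx
    have e : ((κ ⟨x, hx.ge⟩).1, ⟨0, self_mem_Ici⟩) = κ ⟨x, hx.ge⟩ :=
      Prod.ext rfl (Subtype.ext (by simp [hκ, hx]))
    simp only [ξ, e, Homeomorph.symm_apply_apply]
  have hηξ : ∀ z, η (ξ z) = z := fun z => by
    have := hη _ (hκ0 z)
    simp only [Subtype.coe_eta, Homeomorph.apply_symm_apply] at this
    exact this
  have hξη : ∀ z, ξ (η z) = z := fun z => by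
    have := hξ _ (hμ0 z)
    simp only [Subtype.coe_eta, Homeomorph.apply_symm_apply] at this
    exact this
  let f : S → Z := fun x => if hx : 0 ≤ h x then (κ ⟨x, hx⟩).1 else
    η (μ ⟨x, by linarith [not_le.1 hx]⟩).1
  have hf1 : ∀ x (hx : 0 ≤ h x), f x = (κ ⟨x, hx⟩).1 := fun x hx => dif_pos hx
  have hf2 : ∀ x (hx : 0 ≤ - h x), f x = η (μ ⟨x, hx⟩).1 := by
    intro x hx
    by_cases h0 : 0 ≤ h x
    · rw [hf1 x h0, hη x (by linarith)]
    · exact dif_neg h0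
  have hfc : Continuous f := by
    have h1 : ContinuousOn f {x | 0 ≤ h x} := by
      rw [continuousOn_iff_continuous_domRestrict]
      exact (continuous_fst.comp κ.continuous).congr fun x => (hf1 x.1 x.2).symm
    have h2 : ContinuousOn f {x | 0 ≤ - h x} := by
      rw [continuousOn_iff_continuous_domRestrict]
      exact (hηc.comp (continuous_fst.comp μ.continuous)).congr fun x => (hf2 x.1 x.2).symm
    rw [← continuousOn_univ]
    refine (h1.union_of_isClosed h2 (isClosed_le continuous_const hc)
      (isClosed_le continuous_const hc.neg)).mono fun x _ => ?_
    rcases le_total 0 (h x) with h0 | h0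
    · exact Or.inl h0
    · exact Or.inr (by simpa using h0)
  let g : Z × ℝ → S := fun z => if hz : 0 ≤ z.2 then κ.symm (z.1, ⟨z.2, hz⟩) else
    μ.symm (ξ z.1, ⟨- z.2, by simp; linarith [not_le.1 hz]⟩)
  have hg1 : ∀ z (hz : 0 ≤ z.2), g z = κ.symm (z.1, ⟨z.2, hz⟩) := fun z hz => dif_pos hz
  have hg2 : ∀ z (hz : 0 ≤ - z.2), g z = μ.symm (ξ z.1, ⟨- z.2, hz⟩) := by
    intro z hz
    by_cases h0 : 0 ≤ z.2
    · rw [hg1 z h0]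
      have hz0 : z.2 = 0 := by linarith
      have e1 : (z.1, (⟨z.2, h0⟩ : Ici (0 : ℝ))) = (z.1, ⟨0, self_mem_Ici⟩) :=
        Prod.ext rfl (Subtype.ext hz0)
      have e2 : (ξ z.1, (⟨- z.2, hz⟩ : Ici (0 : ℝ))) =
          μ ⟨κ.symm (z.1, ⟨0, self_mem_Ici⟩), by simp [hκ0]⟩ :=
        Prod.ext rfl (Subtype.ext (by simp [hμ, hz0, hκ0]))
      rw [e1, e2]
      simp
    · exact dif_neg h0
  have hgc : Continuous g := by
    have h1 : ContinuousOn g {z | 0 ≤ z.2} := by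
      rw [continuousOn_iff_continuous_domRestrict]
      refine Continuous.congr ?_ fun z => (hg1 z.1 z.2).symm
      exact continuous_subtype_val.comp (κ.symm.continuous.comp
        ((continuous_fst.comp continuous_subtype_val).prodMk (Continuous.subtype_mk
          (continuous_snd.comp continuous_subtype_val) _)))
    have h2 : ContinuousOn g {z | 0 ≤ - z.2} := by
      rw [continuousOn_iff_continuous_domRestrict]
      refine Continuous.congr ?_ fun z => (hg2 z.1 z.2).symm
      exact continuous_subtype_val.comp (μ.symm.continuous.comp
        ((hξc.comp (continuous_fst.comp continuous_subtype_val)).prodMk (Continuous.subtype_mk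
          (continuous_snd.comp continuous_subtype_val).neg _)))
    rw [← continuousOn_univ]
    refine (h1.union_of_isClosed h2 (isClosed_le continuous_const continuous_snd)
      (isClosed_le continuous_const continuous_snd.neg)).mono fun z _ => ?_
    rcases le_total 0 z.2 with h0 | h0
    · exact Or.inl h0
    · exact Or.inr (by simpa using h0)
  refine ⟨{ toFun := fun x => (f x, h x)
            invFun := g
            left_inv := fun x => ?_
            right_inv := fun z => ?_
            continuous_toFun := hfc.prodMk hc
            continuous_invFun := hgc }, fun x => rfl⟩
  · rcases le_total 0 (h x) with h0 | h0
    · have e : ((κ ⟨x, h0⟩).1, (⟨h x, h0⟩ : Ici (0 : ℝ))) = κ ⟨x, h0⟩ :=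
        Prod.ext rfl (Subtype.ext (hκ ⟨x, h0⟩).symm)
      change g (f x, h x) = x
      rw [hg1 (f x, h x) h0]
      simp only [hf1 x h0, e, Homeomorph.symm_apply_apply]
    · have h0' : 0 ≤ - h x := by linarith
      have e : ((μ ⟨x, h0'⟩).1, (⟨- h x, h0'⟩ : Ici (0 : ℝ))) = μ ⟨x, h0'⟩ :=
        Prod.ext rfl (Subtype.ext (hμ ⟨x, h0'⟩).symm)
      change g (f x, h x) = x
      rw [hg2 (f x, h x) h0']
      simp only [hf2 x h0', hξη, e, Homeomorph.symm_apply_apply]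
  · rcases le_total 0 z.2 with h0 | h0
    · have h1 : h (g z) = z.2 := by rw [hg1 z h0, hκs]
      refine Prod.ext ?_ h1
      change f (g z) = z.1
      rw [hf1 _ (h1 ▸ h0)]
      simp [hg1 z h0]
    · have h0' : 0 ≤ - z.2 := by linarith
      have h1 : h (g z) = z.2 := by rw [hg2 z h0', hμs]; simp
      refine Prod.ext ?_ h1
      change f (g z) = z.1
      rw [hf2 _ (by rw [h1]; exact h0')]
      simp [hg2 z h0', hηξ]

/-! ### Connected sets of vertices -/

/-- Two distinct vertices are adjacent if they span an edge of the complex. -/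
def adj {V : Type*} (F : Set (Finset V)) (a b : V) : Prop := a ≠ b ∧ {a, b} ∈ F

/-- A finite set is connected for a relation if each proper nonempty part of it is related to
the remaining part. -/
def Conn {V : Type*} (r : V → V → Prop) (S : Finset V) : Prop :=
  ∀ T ⊆ S, T.Nonempty → (S \ T).Nonempty → ∃ a ∈ T, ∃ b ∈ S \ T, r a b

section Connected

variable {V : Type*} {F : Set (Finset V)} {r : V → V → Prop}

theorem adj_symm {a b : V} (h : adj F a b) : adj F b a :=
  ⟨h.1.symm, by rw [Finset.pair_comm]; exact h.2⟩

theorem Conn.insert {N : Finset V} (hr : ∀ a b, r a b → r b a) (hN : Conn r N) {w n : V}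
    (hn : n ∈ N) (h : r w n) : Conn r (insert w N) := by
  intro T hT h1 h2
  by_cases hw : w ∈ T
  · by_cases hnT : n ∈ T
    · by_cases h3 : (N \ T).Nonempty
      · obtain ⟨a, ha, b, hb, hab⟩ := hN (T ∩ N) Finset.inter_subset_right
          ⟨n, Finset.mem_inter.2 ⟨hnT, hn⟩⟩ (by
            obtain ⟨x, hx⟩ := h3
            exact ⟨x, by simp_all⟩)
        exact ⟨a, (Finset.mem_inter.1 ha).1, b, by simp_all, hab⟩
      · obtain ⟨x, hx⟩ := h2
        refine absurd ⟨x, ?_⟩ h3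
        rw [Finset.mem_sdiff, Finset.mem_insert] at hx
        rw [Finset.mem_sdiff]
        refine ⟨hx.1.resolve_left ?_, hx.2⟩
        rintro rfl
        exact hx.2 hw
    · exact ⟨w, hw, n, by simp [hn, hnT], h⟩
  · by_cases hnT : n ∈ T
    · exact ⟨n, hnT, w, by simp [hw], hr _ _ h⟩
    · have hTN : T ⊆ N := fun x hx => (Finset.mem_insert.1 (hT hx)).resolve_left (by
        rintro rfl
        exact hw hx)
      obtain ⟨a, ha, b, hb, hab⟩ := hN T hTN h1 ⟨n, by simp [hn, hnT]⟩
      exact ⟨a, ha, b, by simp_all, hab⟩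

theorem Conn.exists_rel {S : Finset V} (hS : Conn r S) {w v : V} (hw : w ∈ S) (hv : v ∈ S)
    (hvw : v ≠ w) : ∃ b ∈ S.erase w, r w b := by
  obtain ⟨a, ha, b, hb, hab⟩ := hS {w} (by simpa) (by simp) ⟨v, by simp [hv, hvw]⟩
  rw [Finset.mem_singleton] at ha
  subst ha
  exact ⟨b, by simp_all, hab⟩

theorem Conn.singleton (w : V) : Conn r {w} := by
  intro T hT h1 h2
  obtain ⟨a, ha⟩ := h1
  obtain ⟨b, hb⟩ := h2
  have h1 := Finset.mem_singleton.1 (hT ha)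
  have h2 := Finset.mem_sdiff.1 hb
  rw [Finset.mem_singleton] at h2
  exact absurd (h2.1 ▸ h1 ▸ ha) h2.2

theorem exists_not_cut_aux (hr : ∀ a b, r a b → r b a) {U P N : Finset V} (hPN : Disjoint P N)
    (hU : P ∪ N = U) (hdel : ∀ w ∈ U, Conn r (U.erase w)) (hP : Conn r P) (hN : N.Nonempty)
    (k : ℕ) : ∀ w ∈ P, ∀ Q ⊆ P.erase w, Q.card = k → Q.Nonempty →
      (∀ a ∈ Q, ∀ b ∈ P.erase w \ Q, ¬ r a b) →
      ∃ w ∈ P, (∃ n ∈ N, r w n) ∧ Conn r (P.erase w) := by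
  induction k using Nat.strong_induction_on with
  | _ k ih =>
  intro w hw Q hQ hk hQ0 hno
  have hQP : ∀ x ∈ Q, x ≠ w ∧ x ∈ P := fun x hx => Finset.mem_erase.1 (hQ hx)
  have hdisj : ∀ x ∈ P, x ∉ N := fun x hx hx' => Finset.disjoint_left.1 hPN hx hx'
  obtain ⟨w', hw', n, hn, hr'⟩ := hdel w (hU ▸ Finset.mem_union_left _ hw) Q
    (fun x hx => Finset.mem_erase.2 ⟨(hQP x hx).1, hU ▸ Finset.mem_union_left _ (hQP x hx).2⟩)
    hQ0 (by
      obtain ⟨n, hn⟩ := hN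
      refine ⟨n, Finset.mem_sdiff.2 ⟨Finset.mem_erase.2 ⟨?_, hU ▸ Finset.mem_union_right _ hn⟩,
        fun hc => hdisj _ (hQP n hc).2 hn⟩⟩
      rintro rfl
      exact hdisj _ hw hn)
  have hnN : n ∈ N := by
    rw [Finset.mem_sdiff, Finset.mem_erase, ← hU, Finset.mem_union] at hn
    refine hn.1.2.resolve_left fun hc => hno w' hw' n ?_ hr'
    simp [hn.1.1, hn.2, hc]
  by_cases hc : Conn r (P.erase w')
  · exact ⟨w', (hQP w' hw').2, ⟨n, hnN, hr'⟩, hc⟩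
  have hww' : w' ≠ w := (hQP w' hw').1
  obtain ⟨R, hR, hR0, hwR, hnoR⟩ : ∃ R ⊆ P.erase w', R.Nonempty ∧ w ∉ R ∧
      ∀ a ∈ R, ∀ b ∈ P.erase w' \ R, ¬ r a b := by
    unfold Conn at hc
    push Not at hc
    obtain ⟨R, hR, h1, h2, h3⟩ := hc
    by_cases hwR : w ∈ R
    · refine ⟨P.erase w' \ R, Finset.sdiff_subset, h2, by simp [hwR], fun a ha b hb hab => ?_⟩
      refine h3 b ?_ a ha (hr _ _ hab)
      simp only [Finset.mem_sdiff, not_and, not_not] at hb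
      exact hb.2 hb.1
    · exact ⟨R, hR, h1, hwR, h3⟩
  have hRQ : R ⊆ Q := by
    by_contra hc
    obtain ⟨x, hx⟩ := Finset.sdiff_nonempty.2 hc
    obtain ⟨a, ha, b, hb, hab⟩ := hP (R \ Q)
      (fun y hy => Finset.mem_of_mem_erase (hR (Finset.mem_sdiff.1 hy).1)) ⟨x, hx⟩
      ⟨w, by simp [hw, hwR]⟩
    rw [Finset.mem_sdiff] at ha
    have haP := Finset.mem_erase.1 (hR ha.1)
    have haw : a ∈ P.erase w \ Q := by
      simp only [Finset.mem_sdiff, Finset.mem_erase]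
      refine ⟨⟨?_, haP.2⟩, ha.2⟩
      rintro rfl
      exact hwR ha.1
    simp only [Finset.mem_sdiff, not_and, not_not] at hb
    by_cases hbw : b = w'
    · subst hbw
      exact hno b hw' a haw (hr _ _ hab)
    by_cases hbR : b ∈ R
    · exact hno b (hb.2 hbR) a haw (hr _ _ hab)
    · exact hnoR a ha.1 b (by simp [hbw, hb.1, hbR]) hab
  refine ih R.card ?_ w' (hQP w' hw').2 R hR rfl hR0 hnoR
  rw [← hk]
  refine Finset.card_lt_card ⟨hRQ, fun hc => ?_⟩
  exact (Finset.mem_erase.1 (hR (hc hw'))).1 rfl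

/-- A connected part of the vertices of a graph without cut vertices has a vertex which is not a
cut vertex of this part, and which is adjacent to the remaining vertices. -/
theorem exists_not_cut (hr : ∀ a b, r a b → r b a) {U P N : Finset V} (hPN : Disjoint P N)
    (hU : P ∪ N = U) (hUc : Conn r U) (hdel : ∀ w ∈ U, Conn r (U.erase w)) (hP : Conn r P)
    (hP0 : P.Nonempty) (hN : N.Nonempty) :
    ∃ w ∈ P, (∃ n ∈ N, r w n) ∧ Conn r (P.erase w) := by
  obtain ⟨w, hw, n, hn, hwn⟩ := hUc P (hU ▸ Finset.subset_union_left) hP0 (by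
    obtain ⟨n, hn⟩ := hN
    exact ⟨n, Finset.mem_sdiff.2 ⟨hU ▸ Finset.mem_union_right _ hn,
      fun hc => Finset.disjoint_left.1 hPN hc hn⟩⟩)
  have hnN : n ∈ N := by
    rw [Finset.mem_sdiff, ← hU, Finset.mem_union] at hn
    exact hn.1.resolve_left hn.2
  by_cases hc : Conn r (P.erase w)
  · exact ⟨w, hw, ⟨n, hnN, hwn⟩, hc⟩
  unfold Conn at hc
  push Not at hc
  obtain ⟨Q, hQ, h1, -, h3⟩ := hc
  exact exists_not_cut_aux hr hPN hU hdel hP hN _ w hw Q hQ rfl h1 h3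

end Connected

/-! ### Models of cones from models of links -/

section Models

variable {V : Type*} {F : Set (Finset V)} {A U : Finset V} {Y : Type*} [TopologicalSpace Y]

/-- If a vertex moves between connected parts `P` and `N` of the vertices, then the signs define
a model of its link. -/
def HasLinkModels (Y : Type*) [TopologicalSpace Y] (F : Set (Finset V)) (A U : Finset V) : Prop :=
  ∀ w ∈ U, ∀ P N : Finset V, Disjoint P N → w ∉ P → w ∉ N → insert w (P ∪ N) = U →
    Conn (adj F) P → Conn (adj F) N → (∃ p ∈ P, adj F w p) → (∃ n ∈ N, adj F w n) →
    IsModel Y (link F w) A P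

theorem isHalfModel_of_links (hF : ∀ s ∈ F, s ⊆ A) (hv : ∀ v ∈ U, {v} ∈ F)
    (hU : Conn (adj F) U) (hdel : ∀ w ∈ U, Conn (adj F) (U.erase w))
    (hpl : ∀ w ∈ U, Nonempty (cone (link F w) ≃ₜ Y × ℝ)) (hm : HasLinkModels Y F A U) (k : ℕ) :
    ∀ P N : Finset V, P.card = k → Disjoint P N → P ∪ N = U → P.Nonempty → N.Nonempty →
      Conn (adj F) P → Conn (adj F) N → IsHalfModel (Y × ℝ) F A P := by
  induction k with
  | zero =>
    intro P N hk _ _ hP0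
    rw [Finset.card_eq_zero] at hk
    simp [hk] at hP0
  | succ k ih =>
  intro P N hk hPN hPU hP0 hN0 hP hN
  obtain ⟨w, hw, ⟨n, hn, hwn⟩, hc⟩ :=
    exists_not_cut (fun _ _ => adj_symm) hPN hPU hU hdel hP hP0 hN0
  have hwU : w ∈ U := hPU ▸ Finset.mem_union_left _ hw
  have hwN : w ∉ N := Finset.disjoint_left.1 hPN hw
  rcases (P.erase w).eq_empty_or_nonempty with h0 | h0
  · have : P = {w} := by rw [← Finset.insert_erase hw, h0, insert_empty_eq]
    rw [this]
    obtain ⟨κ⟩ := hpl w hwU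
    exact isHalfModel_singleton hF (hv w hwU) κ
  · obtain ⟨v, hv'⟩ := h0
    have hunion : insert w (P.erase w ∪ N) = U := by
      rw [← Finset.insert_union, Finset.insert_erase hw, hPU]
    have hdis : Disjoint (P.erase w) N := hPN.mono_left (Finset.erase_subset _ _)
    obtain ⟨θ, hθ⟩ := exists_homeo_flip hF (hF _ (hv w hwU) (by simp)) (by simp)
      (hm w hwU (P.erase w) N hdis (by simp) hwN hunion hc hN
        (hP.exists_rel hw (Finset.mem_of_mem_erase hv') (Finset.ne_of_mem_erase hv'))
        ⟨n, hn, hwn⟩)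
    rw [Finset.insert_erase hw] at hθ
    refine (ih (P.erase w) (insert w N) ?_ ?_ ?_ ⟨v, hv'⟩ (by simp) hc
      (hN.insert (fun _ _ => adj_symm) hn hwn)).of_homeo θ.symm fun x => ?_
    · rw [Finset.card_erase_of_mem hw, hk]
      rfl
    · rw [Finset.disjoint_insert_right]
      exact ⟨by simp, hdis⟩
    · rw [Finset.union_insert, hunion]
    · rw [← hθ]
      simp

theorem isModel_of_links (hF : ∀ s ∈ F, s ⊆ A) (hFU : ∀ s ∈ F, s ⊆ U) (hv : ∀ v ∈ U, {v} ∈ F)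
    (hU : Conn (adj F) U) (hdel : ∀ w ∈ U, Conn (adj F) (U.erase w))
    (hpl : ∀ w ∈ U, Nonempty (cone (link F w) ≃ₜ Y × ℝ)) (hm : HasLinkModels Y F A U)
    {P N : Finset V} (hPN : Disjoint P N) (hPU : P ∪ N = U) (hP0 : P.Nonempty)
    (hN0 : N.Nonempty) (hP : Conn (adj F) P) (hN : Conn (adj F) N) :
    IsModel (Y × ℝ) F A P := by
  obtain ⟨κ, hκ⟩ := isHalfModel_of_links hF hv hU hdel hpl hm _ P N rfl hPN hPU hP0 hN0 hP hN
  obtain ⟨μ, hμ⟩ := isHalfModel_of_links hF hv hU hdel hpl hm _ N P rfl hPN.symm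
    (by rw [Finset.union_comm, hPU]) hN0 hP0 hN hP
  have hneg : ∀ x : cone F, height A N x = - height A P x := by
    rintro ⟨x, -, s, hs, hx⟩
    refine height_neg fun v _ hxv => ?_
    have hvs : v ∈ U := hFU s hs (by
      by_contra hc
      exact hxv (hx v hc))
    rw [← hPU, Finset.mem_union] at hvs
    exact ⟨fun h => Finset.disjoint_left.1 hPN h, fun h => hvs.resolve_right h⟩
  refine exists_homeo_of_halves (h := fun x : cone F => height A P x)
    ((continuous_height A P).comp continuous_subtype_val) κ hκ
    (((Homeomorph.refl (cone F)).subtype (p := fun x : cone F => 0 ≤ - height A P x)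
      (q := fun x : cone F => 0 ≤ height A N x) fun x => by rw [← hneg]; rfl).trans μ)
    fun x => ?_
  rw [← hneg]
  exact hμ _

/-- The cone over two points of opposite signs. -/
theorem isModel_pair {P : Finset V} {a b : V} (hab : a ≠ b) (haA : a ∈ A) (hbA : b ∈ A)
    (ha : a ∈ P) (hb : b ∉ P) (haF : {a} ∈ F) (hbF : {b} ∈ F)
    (hF : ∀ s ∈ F, s ⊆ {a} ∨ s ⊆ {b}) : IsModel PUnit F A P := by
  have hx : ∀ x ∈ cone F, (∀ v, v ≠ a → v ≠ b → x v = 0) ∧ (x a = 0 ∨ x b = 0) := by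
    rintro x ⟨-, s, hs, h⟩
    rcases hF s hs with h1 | h1
    · refine ⟨fun v hva _ => h v fun hc => hva (by simpa using h1 hc), Or.inr (h b fun hc => ?_)⟩
      exact hab.symm (by simpa using h1 hc)
    · refine ⟨fun v _ hvb => h v fun hc => hvb (by simpa using h1 hc), Or.inl (h a fun hc => ?_)⟩
      exact hab (by simpa using h1 hc)
  have hh : ∀ x ∈ cone F, height A P x = x a - x b := by
    intro x hxF
    have : height A P x = ∑ v ∈ {a, b}, sgn P v * x v := by
      refine (Finset.sum_subset ?_ fun v _ hv => ?_).symm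
      · simp [Finset.insert_subset_iff, haA, hbA]
      · simp only [Finset.mem_insert, Finset.mem_singleton, not_or] at hv
        rw [(hx x hxF).1 v hv.1 hv.2, mul_zero]
    rw [this, Finset.sum_pair hab]
    simp [sgn, ha, hb, sub_eq_add_neg]
  let inv0 : ℝ → V → ℝ := fun t v => if v = a then max t 0 else if v = b then max (-t) 0 else 0
  have hinv : ∀ t, inv0 t ∈ cone F := by
    intro t
    refine ⟨fun v => ?_, ?_⟩
    · simp only [inv0]
      split_ifs <;> simp
    · rcases le_total 0 t with ht | ht
      · refine ⟨{a}, haF, fun v hv => ?_⟩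
        simp only [Finset.mem_singleton] at hv
        simp [inv0, hv, ht]
      · refine ⟨{b}, hbF, fun v hv => ?_⟩
        simp only [Finset.mem_singleton] at hv
        simp [inv0, hv, ht]
  have hinvc : Continuous inv0 := by
    refine continuous_pi fun v => ?_
    simp only [inv0]
    split_ifs <;> fun_prop
  refine ⟨{ toFun := fun x => (PUnit.unit, height A P x)
            invFun := fun z => ⟨inv0 z.2, hinv z.2⟩
            left_inv := fun x => ?_
            right_inv := fun z => ?_
            continuous_toFun := continuous_const.prodMk
              ((continuous_height A P).comp continuous_subtype_val)
            continuous_invFun := (hinvc.comp continuous_snd).subtype_mk fun z => hinv z.2 },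
    fun x => rfl⟩
  · refine Subtype.ext (funext fun v => ?_)
    have h1 := x.2.1 a
    have h2 := x.2.1 b
    change inv0 (height A P x) v = (x : V → ℝ) v
    rw [hh _ x.2]
    simp only [inv0]
    split_ifs with h3 h4
    · subst h3
      rcases (hx _ x.2).2 with h | h <;> simp [h, h1, h2]
    · subst h4
      rcases (hx _ x.2).2 with h | h <;> simp [h, h1, h2]
    · exact ((hx _ x.2).1 v h3 h4).symm
  · refine Prod.ext rfl ?_
    change height A P (inv0 z.2) = z.2
    rw [hh _ (hinv z.2)]
    simp only [inv0, if_true, hab.symm, if_false]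
    rcases le_total 0 z.2 with h | h <;> simp [h]

end Models

/-! ### Circles -/

/-- An abstract complex which is a triangulated circle with vertex set `U`. -/
structure IsCircle {V : Type*} (F : Set (Finset V)) (U : Finset V) : Prop where
  subset : ∀ s ∈ F, s ⊆ U
  down : ∀ s ∈ F, ∀ t ⊆ s, t ∈ F
  vertex : ∀ v ∈ U, {v} ∈ F
  card_le : ∀ s ∈ F, s.card ≤ 2
  two : ∀ v ∈ U, ∃ a b, a ≠ b ∧ ∀ c, adj F v c ↔ c = a ∨ c = b
  conn : Conn (adj F) U

theorem sum_sum_symm_eq_zero {V : Type*} (T : Finset V) (f : V → V → ZMod 2)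
    (hf : ∀ a b, f a b = f b a) (h0 : ∀ a, f a a = 0) : ∑ a ∈ T, ∑ b ∈ T, f a b = 0 := by
  rw [← Finset.sum_product']
  refine Finset.sum_involution (fun x _ => x.swap) (fun x _ => ?_) (fun x _ hx he => hx ?_)
    (fun x hx => ?_) (fun x _ => x.swap_swap)
  · simp only [Prod.fst_swap, Prod.snd_swap, hf x.2 x.1]
    exact CharTwo.add_self_eq_zero _
  · have : x.2 = x.1 := congrArg Prod.fst he
    rw [this, h0]
  · simp only [Finset.mem_product, Prod.fst_swap, Prod.snd_swap] at hx ⊢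
    exact hx.symm

namespace IsCircle

variable {V : Type*} {F : Set (Finset V)} {A U : Finset V}

theorem mem_of_adj (h : IsCircle F U) {a b : V} (hab : adj F a b) : b ∈ U :=
  h.subset _ hab.2 (by simp)

/-- The number of edges that leave a set of vertices is even. -/
theorem sum_boundary (h : IsCircle F U) {T : Finset V} (hT : T ⊆ U) :
    ∑ a ∈ T, ∑ b ∈ U \ T, (if adj F a b then 1 else 0 : ZMod 2) = 0 := by
  have h1 : ∑ a ∈ T, ∑ b ∈ U, (if adj F a b then 1 else 0 : ZMod 2) = 0 := by
    refine Finset.sum_eq_zero fun a ha => ?_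
    obtain ⟨c, d, hcd, hc⟩ := h.two a (hT ha)
    have : U.filter (adj F a) = {c, d} := by
      ext x
      simp only [Finset.mem_filter, Finset.mem_insert, Finset.mem_singleton, hc]
      refine ⟨fun h => h.2, fun hx => ⟨?_, hx⟩⟩
      exact h.mem_of_adj ((hc x).2 hx)
    rw [← Finset.sum_filter, this, Finset.sum_pair hcd]
    exact CharTwo.add_self_eq_zero _
  have h2 : ∑ a ∈ T, ∑ b ∈ T, (if adj F a b then 1 else 0 : ZMod 2) = 0 :=
    sum_sum_symm_eq_zero T _ (fun a b => by
      have : adj F a b ↔ adj F b a := ⟨adj_symm, adj_symm⟩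
      simp [this]) (fun a => by simp [adj])
  have h3 : ∀ a, (∑ b ∈ U, if adj F a b then 1 else 0 : ZMod 2) =
      (∑ b ∈ U \ T, if adj F a b then 1 else 0) + ∑ b ∈ T, if adj F a b then 1 else 0 :=
    fun a => (Finset.sum_sdiff hT).symm
  simp only [h3, Finset.sum_add_distrib, h2, add_zero] at h1
  exact h1

theorem conn_erase (h : IsCircle F U) {b : V} (hb : b ∈ U) : Conn (adj F) (U.erase b) := by
  obtain ⟨c, d, hcd, hc⟩ := h.two b hb
  by_contra hcon
  unfold Conn at hcon
  push Not at hcon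
  have key : ∀ T ⊆ U.erase b, T.Nonempty → (∀ x ∈ T, ∀ y ∈ U.erase b \ T, ¬ adj F x y) →
      c ∈ T ∧ d ∈ T := by
    intro T hT hT0 hno
    have hTU : T ⊆ U := hT.trans (Finset.erase_subset _ _)
    have hbT : b ∉ T := fun hx => (Finset.mem_erase.1 (hT hx)).1 rfl
    have h1 := h.sum_boundary hTU
    have h2 : ∑ a ∈ T, ∑ y ∈ U \ T, (if adj F a y then 1 else 0 : ZMod 2) =
        ∑ a ∈ T, ((if c = a then 1 else 0) + (if d = a then 1 else 0)) := by
      refine Finset.sum_congr rfl fun a ha => ?_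
      rw [Finset.sum_eq_single b]
      · have : adj F a b ↔ a = c ∨ a = d := by
          rw [← hc]
          exact ⟨adj_symm, adj_symm⟩
        by_cases hac : c = a
        · subst hac
          have : adj F c b := this.2 (Or.inl rfl)
          simp [this, hcd.symm]
        · by_cases had : d = a
          · subst had
            have : adj F d b := this.2 (Or.inr rfl)
            simp [this, hac]
          · have : ¬ adj F a b := by
              rw [this]
              rintro (h | h)
              · exact hac h.symm
              · exact had h.symm
            simp [this, hac, had]
      · intro y hy hyb
        rw [if_neg]
        refine hno a ha y ?_
        simp_all
      · intro hn
        simp [hb, hbT] at hn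
    rw [h2, Finset.sum_add_distrib, Finset.sum_ite_eq, Finset.sum_ite_eq] at h1
    by_cases hcT : c ∈ T
    · by_cases hdT : d ∈ T
      · exact ⟨hcT, hdT⟩
      · simp [hcT, hdT] at h1
    · by_cases hdT : d ∈ T
      · simp [hcT, hdT] at h1
      · obtain ⟨x, hx, y, hy, hxy⟩ := h.conn T hTU hT0 ⟨b, by simp [hb, hbT]⟩
        exfalso
        by_cases hyb : y = b
        · subst hyb
          rcases (hc x).1 (adj_symm hxy) with rfl | rfl
          · exact hcT hx
          · exact hdT hx
        · exact hno x hx y (by simp_all) hxy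
  obtain ⟨T, hT, hT0, hT1, hno⟩ := hcon
  have h1 := key T hT hT0 hno
  have h2 := key (U.erase b \ T) Finset.sdiff_subset hT1 fun x hx y hy hxy => by
    refine hno y ?_ x hx (adj_symm hxy)
    simp only [Finset.mem_sdiff, not_and, not_not] at hy
    exact hy.2 hy.1
  exact (Finset.mem_sdiff.1 h2.1).2 h1.1

theorem isModel_link (h : IsCircle F U) (hUA : U ⊆ A) {P : Finset V} {w a b : V} (hw : w ∈ U)
    (hwa : adj F w a) (hwb : adj F w b) (ha : a ∈ P) (hb : b ∉ P) :
    IsModel PUnit (link F w) A P := by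
  have hab : a ≠ b := by
    rintro rfl
    exact hb ha
  have hnb : ∀ c, adj F w c → c = a ∨ c = b := by
    obtain ⟨c, d, hcd, hc⟩ := h.two w hw
    intro e he
    have h1 := (hc a).1 hwa
    have h2 := (hc b).1 hwb
    have h3 := (hc e).1 he
    grind
  refine isModel_pair hab (hUA (h.mem_of_adj hwa)) (hUA (h.mem_of_adj hwb)) ha hb
    ⟨by simpa using hwa.1, hwa.2⟩ ⟨by simpa using hwb.1, hwb.2⟩ ?_
  rintro s ⟨hws, hs⟩
  have hcard := h.card_le _ hs
  rw [Finset.card_insert_of_notMem hws] at hcard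
  rcases s.eq_empty_or_nonempty with rfl | ⟨x, hx⟩
  · simp
  · have hsx : s = {x} := (Finset.eq_of_subset_of_card_le (by simpa) (by simp; omega)).symm
    subst hsx
    have hwx : adj F w x := ⟨fun hc => hws (by simp [hc]), hs⟩
    rcases hnb x hwx with rfl | rfl <;> simp

theorem isModel (h : IsCircle F U) (hUA : U ⊆ A) {P N : Finset V} (hPN : Disjoint P N)
    (hPU : P ∪ N = U) (hP0 : P.Nonempty) (hN0 : N.Nonempty) (hP : Conn (adj F) P)
    (hN : Conn (adj F) N) : IsModel (PUnit × ℝ) F A P := by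
  refine isModel_of_links (fun s hs => (h.subset s hs).trans hUA) h.subset h.vertex h.conn
    (fun w hw => h.conn_erase hw) (fun w hw => ?_) ?_ hPN hPU hP0 hN0 hP hN
  · obtain ⟨a, b, hab, hc⟩ := h.two w hw
    obtain ⟨κ, -⟩ := h.isModel_link hUA hw ((hc a).2 (Or.inl rfl)) ((hc b).2 (Or.inr rfl))
      (P := {a}) (by simp) (by simpa using hab.symm)
    exact ⟨κ⟩
  · rintro w hw P N hPN - - - - - ⟨p, hp, hwp⟩ ⟨n, hn, hwn⟩
    exact h.isModel_link hUA hw hwp hwn hp fun hc => Finset.disjoint_left.1 hPN hc hn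

/-- The cone over a circle is a plane. -/
theorem nonempty_homeo (h : IsCircle F U) (hU : U.Nonempty) :
    Nonempty (cone F ≃ₜ (PUnit × ℝ) × ℝ) := by
  obtain ⟨b, hb⟩ := hU
  obtain ⟨c, d, -, hc⟩ := h.two b hb
  have hbc : adj F b c := (hc c).2 (Or.inl rfl)
  obtain ⟨κ, -⟩ := h.isModel Subset.rfl (P := {b}) (N := U.erase b) (by simp)
    (by rw [← Finset.insert_eq, Finset.insert_erase hb]) (by simp)
    ⟨c, Finset.mem_erase.2 ⟨hbc.1.symm, h.mem_of_adj hbc⟩⟩ (Conn.singleton b) (h.conn_erase hb)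
  exact ⟨κ⟩

end IsCircle

theorem Conn.eq_of_rel {V W : Type*} {r : V → V → Prop} {S : Finset V} (hS : Conn r S)
    {f : V → W} (hf : ∀ a ∈ S, ∀ b ∈ S, r a b → f a = f b) {a b : V} (ha : a ∈ S) (hb : b ∈ S) :
    f a = f b := by
  by_contra hc
  obtain ⟨x, hx, y, hy, hxy⟩ := hS (S.filter fun v => f a = f v) (Finset.filter_subset _ _)
    ⟨a, by simp [ha]⟩ ⟨b, by simp [hb, hc]⟩
  simp only [Finset.mem_filter, Finset.mem_sdiff, not_and] at hx hy
  exact hy.2 hy.1 (hx.2.trans (hf x hx.1 y hy.1 hxy))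

/-! ### Spheres -/

section Links

variable {V : Type*} {F : Set (Finset V)}

theorem adj_link_iff {a b c : V} :
    adj (link F a) b c ↔ b ≠ c ∧ a ≠ b ∧ a ≠ c ∧ {a, b, c} ∈ F := by
  simp [adj, link, and_assoc]

theorem adj_link_rotate {a b c : V} (h : adj (link F a) b c) : adj (link F b) c a := by
  rw [adj_link_iff] at h ⊢
  refine ⟨h.2.2.1.symm, h.1, h.2.1.symm, ?_⟩
  convert h.2.2.2 using 1
  ext
  simp
  tauto

theorem adj_link_swap {a b c : V} (h : adj (link F a) b c) : adj (link F b) a c :=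
  adj_symm (adj_link_rotate h)

end Links

/-- An abstract complex with the combinatorial properties of a triangulated sphere with vertex
set `U`: each edge is in two triangles, there are no cut vertices, and the first cohomology with
coefficients in the field with two elements vanishes. -/
structure IsSphere {V : Type*} (F : Set (Finset V)) (U : Finset V) : Prop where
  subset : ∀ s ∈ F, s ⊆ U
  down : ∀ s ∈ F, ∀ t ⊆ s, t ∈ F
  vertex : ∀ v ∈ U, {v} ∈ F
  card_le : ∀ s ∈ F, s.card ≤ 3
  two : ∀ a b, adj F a b → ∃ c d, c ≠ d ∧ ∀ e, adj (link F a) b e ↔ e = c ∨ e = d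
  conn : Conn (adj F) U
  conn_erase : ∀ w ∈ U, Conn (adj F) (U.erase w)
  cohomology : ∀ c : V → V → ZMod 2, (∀ a b, c a b = c b a) →
    (∀ a b d, adj (link F a) b d → c a b + c b d + c a d = 0) →
    ∃ s : V → ZMod 2, ∀ a b, adj F a b → c a b = s a + s b

/-- The coboundary from edges to triangles. -/
def coboundary {V : Type*} (F : Set (Finset V)) :
    (Finset V → ZMod 2) →ₗ[ZMod 2] (Finset V → ZMod 2) where
  toFun c t := if t ∈ F ∧ t.card = 3 then ∑ e ∈ t.powersetCard 2, c e else 0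
  map_add' c d := by
    funext t
    by_cases h : t ∈ F ∧ t.card = 3 <;> simp [h, Finset.sum_add_distrib]
  map_smul' r c := by
    funext t
    by_cases h : t ∈ F ∧ t.card = 3 <;> simp [h, Finset.mul_sum]

theorem sum_powersetCard_two {V : Type*} {a b c : V} (hab : a ≠ b) (hac : a ≠ c) (hbc : b ≠ c)
    (f : Finset V → ZMod 2) :
    ∑ e ∈ ({a, b, c} : Finset V).powersetCard 2, f e = f {a, b} + f {b, c} + f {a, c} := by
  have : ({a, b, c} : Finset V).powersetCard 2 = {{a, b}, {b, c}, {a, c}} := by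
    ext e
    simp only [Finset.mem_powersetCard, Finset.mem_insert, Finset.mem_singleton]
    constructor
    · rintro ⟨he, hc⟩
      obtain ⟨x, y, hxy, rfl⟩ := Finset.card_eq_two.1 hc
      have hx := he (show x ∈ ({x, y} : Finset V) by simp)
      have hy := he (show y ∈ ({x, y} : Finset V) by simp)
      simp only [Finset.mem_insert, Finset.mem_singleton] at hx hy
      have h := Finset.pair_comm x y
      grind
    · rintro (rfl | rfl | rfl)
      · exact ⟨by intro x; simp; tauto, Finset.card_pair hab⟩
      · exact ⟨by intro x; simp; tauto, Finset.card_pair hbc⟩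
      · exact ⟨by intro x; simp; tauto, Finset.card_pair hac⟩
  have hne : ∀ {x y z : V}, x ≠ z → y ≠ z → ({x, y} : Finset V) ≠ {y, z} := by
    intro x y z hxz hyz h
    have : z ∈ ({x, y} : Finset V) := by rw [h]; simp
    simp [hxz.symm, hyz.symm] at this
  have h1 := hne hac hbc
  have h2 : ({a, b} : Finset V) ≠ {a, c} := by
    rw [Finset.pair_comm a b]
    exact hne hbc hac
  have h3 : ({b, c} : Finset V) ≠ {a, c} := by
    rw [Finset.pair_comm a c]
    exact hne hab.symm hac.symm
  rw [this, Finset.sum_insert (by simp [h1, h2]), Finset.sum_pair h3, add_assoc]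

/-- A path of edges inside a connected set of vertices, as a functional on cochains. -/
theorem exists_path_functional {V : Type*} {F : Set (Finset V)} {S : Finset V}
    (hS : Conn (adj F) S) {a b : V} (ha : a ∈ S) (hb : b ∈ S) :
    ∃ z : Module.Dual (ZMod 2) (Finset V → ZMod 2),
      (∀ e, ¬ e ⊆ S → z (Pi.single e 1) = 0) ∧
      ∀ (c : Finset V → ZMod 2) (s : V → ZMod 2),
        (∀ x y, adj F x y → c {x, y} = s x + s y) → z c = s a + s b := by
  by_contra hcon
  let p : V → Prop := fun b => ∃ z : Module.Dual (ZMod 2) (Finset V → ZMod 2),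
      (∀ e, ¬ e ⊆ S → z (Pi.single e 1) = 0) ∧
      ∀ (c : Finset V → ZMod 2) (s : V → ZMod 2),
        (∀ x y, adj F x y → c {x, y} = s x + s y) → z c = s a + s b
  obtain ⟨x, hx, y, hy, hxy⟩ := hS (S.filter p) (Finset.filter_subset _ _)
    ⟨a, Finset.mem_filter.2 ⟨ha, 0, by simp, fun c s _ => by
      simp [CharTwo.add_self_eq_zero]⟩⟩ ⟨b, by
      rw [Finset.mem_sdiff, Finset.mem_filter, not_and]
      exact ⟨hb, fun _ => hcon⟩⟩
  rw [Finset.mem_filter] at hx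
  rw [Finset.mem_sdiff, Finset.mem_filter, not_and] at hy
  obtain ⟨hxS, z, hz1, hz2⟩ := hx
  refine hy.2 hy.1 ⟨z + LinearMap.proj {x, y}, fun e he => ?_, fun c s hc => ?_⟩
  · have : ({x, y} : Finset V) ≠ e := by
      rintro rfl
      exact he (by simp [Finset.insert_subset_iff, hxS, hy.1])
    simp [hz1 e he, this]
  · simp only [LinearMap.add_apply, LinearMap.proj_apply, hz2 c s hc, hc x y hxy]
    linear_combination CharTwo.add_self_eq_zero (s x)

namespace IsSphere

variable {V : Type*} {F : Set (Finset V)} {A U : Finset V}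

theorem mem_of_adj (h : IsSphere F U) {a b : V} (hab : adj F a b) : b ∈ U :=
  h.subset _ hab.2 (by simp)

theorem adj_of_adj_link (h : IsSphere F U) {a b c : V} (habc : adj (link F a) b c) :
    adj F a b := by
  rw [adj_link_iff] at habc
  exact ⟨habc.2.1, h.down _ habc.2.2.2 _ (by intro x; simp; tauto)⟩

theorem isCircle_link (h : IsSphere F U) {w : V} (hw : w ∈ U) :
    IsCircle (link F w) (U.filter (adj F w)) where
  subset s hs x hx := by
    have hxw : {w, x} ∈ F := h.down _ hs.2 _ (by
      intro y hy
      simp only [Finset.mem_insert, Finset.mem_singleton] at hy ⊢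
      rcases hy with rfl | rfl
      · exact Or.inl rfl
      · exact Or.inr hx)
    have hadj : adj F w x := ⟨by rintro rfl; exact hs.1 hx, hxw⟩
    exact Finset.mem_filter.2 ⟨h.mem_of_adj hadj, hadj⟩
  down s hs t ht := ⟨fun hc => hs.1 (ht hc), h.down _ hs.2 _ (Finset.insert_subset_insert w ht)⟩
  vertex v hv := by
    have := (Finset.mem_filter.1 hv).2
    exact ⟨by simpa using this.1, this.2⟩
  card_le s hs := by
    have := h.card_le _ hs.2
    rw [Finset.card_insert_of_notMem hs.1] at this
    omega
  two v hv := h.two w v (Finset.mem_filter.1 hv).2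
  conn := by
    by_contra hcon
    unfold Conn at hcon
    push Not at hcon
    obtain ⟨T, hT, ⟨a, ha⟩, ⟨b, hb⟩, hno⟩ := hcon
    have hwT : w ∉ T := fun hc => (Finset.mem_filter.1 (hT hc)).2.1 rfl
    have hTe : ∀ x y, adj (link F w) x y → (x ∈ T ↔ y ∈ T) := by
      have : ∀ x y, adj (link F w) x y → x ∈ T → y ∈ T := by
        intro x y hxy hx
        by_contra hy
        have hwy := h.adj_of_adj_link (adj_symm hxy)
        exact hno x hx y (Finset.mem_sdiff.2
          ⟨Finset.mem_filter.2 ⟨h.mem_of_adj hwy, hwy⟩, hy⟩) hxy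
      exact fun x y hxy => ⟨this x y hxy, this y x (adj_symm hxy)⟩
    let c : V → V → ZMod 2 := fun x y =>
      (if x = w ∧ y ∈ T then 1 else 0) + (if y = w ∧ x ∈ T then 1 else 0)
    obtain ⟨s, hs⟩ := h.cohomology c (fun x y => add_comm _ _) (by
      intro x y z hxyz
      obtain ⟨hyz, hxy, hxz, -⟩ := adj_link_iff.1 hxyz
      by_cases hx : x = w
      · subst hx
        simp [c, hxy.symm, hxz.symm, hTe _ _ hxyz, CharTwo.add_self_eq_zero]
      by_cases hy : y = w
      · subst hy
        have := hTe _ _ (adj_link_swap hxyz)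
        simp [c, hx, hyz.symm, this, CharTwo.add_self_eq_zero]
      by_cases hz : z = w
      · subst hz
        have := hTe _ _ (adj_link_rotate (adj_link_rotate hxyz))
        simp [c, hx, hy, this, CharTwo.add_self_eq_zero]
      · simp [c, hx, hy, hz])
    have hconst : ∀ x ∈ U.erase w, ∀ y ∈ U.erase w, s x = s y := by
      intro x hx y hy
      refine (h.conn_erase w hw).eq_of_rel (fun x hx y hy hxy => ?_) hx hy
      have := hs x y hxy
      rw [Finset.mem_erase] at hx hy
      simp only [c, hx.1, hy.1, false_and, if_false, add_zero] at this
      exact CharTwo.add_eq_zero.1 this.symm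
    have haU := Finset.mem_filter.1 (hT ha)
    have hbT := Finset.mem_sdiff.1 hb
    have hbU := Finset.mem_filter.1 hbT.1
    have h1 := hs w a haU.2
    have h2 := hs w b hbU.2
    have h3 := hconst a (Finset.mem_erase.2 ⟨haU.2.1.symm, haU.1⟩) b
      (Finset.mem_erase.2 ⟨hbU.2.1.symm, hbU.1⟩)
    simp [c, ha, hwT] at h1
    simp [c, hbT.2, hwT] at h2
    rw [h3, ← h2] at h1
    exact one_ne_zero h1

theorem coboundary_single {a b c d : V} (hab : adj F a b) (hcd : c ≠ d)
    (hc : ∀ e, adj (link F a) b e ↔ e = c ∨ e = d) :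
    coboundary F (Pi.single {a, b} 1) = Pi.single {a, b, c} 1 + Pi.single {a, b, d} 1 := by
  have h1 := adj_link_iff.1 ((hc c).2 (Or.inl rfl))
  have h2 := adj_link_iff.1 ((hc d).2 (Or.inr rfl))
  have hne : ({a, b, c} : Finset V) ≠ {a, b, d} := by
    intro he
    have : c ∈ ({a, b, d} : Finset V) := by rw [← he]; simp
    simp [hcd, h1.1.symm, h1.2.2.1.symm] at this
  funext t
  have hval : coboundary F (Pi.single {a, b} 1) t =
      if t ∈ F ∧ t.card = 3 ∧ {a, b} ⊆ t then 1 else 0 := by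
    change (if t ∈ F ∧ t.card = 3 then _ else _) = _
    by_cases h3 : t ∈ F ∧ t.card = 3
    · simp [h3, Pi.single_apply, Finset.card_pair hab.1]
    · rw [if_neg h3, if_neg fun h => h3 ⟨h.1, h.2.1⟩]
  rw [hval]
  have htri : ∀ t, (t ∈ F ∧ t.card = 3 ∧ {a, b} ⊆ t) ↔ t = {a, b, c} ∨ t = {a, b, d} := by
    intro t
    constructor
    · rintro ⟨htF, ht3, hsub⟩
      obtain ⟨e, he⟩ : ∃ e, t \ {a, b} = {e} := by
        rw [← Finset.card_eq_one, Finset.card_sdiff_of_subset hsub, ht3,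
          Finset.card_pair hab.1]
      have hte : t = {a, b, e} := by
        rw [← Finset.sdiff_union_of_subset hsub, he]
        ext
        simp
        tauto
      have hemem : e ∈ t \ {a, b} := by simp [he]
      simp only [Finset.mem_sdiff, Finset.mem_insert, Finset.mem_singleton, not_or] at hemem
      have : adj (link F a) b e :=
        adj_link_iff.2 ⟨fun h => hemem.2.2 h.symm, hab.1, fun h => hemem.2.1 h.symm, hte ▸ htF⟩
      rcases (hc e).1 this with rfl | rfl
      · exact Or.inl hte
      · exact Or.inr hte
    · rintro (rfl | rfl)
      · refine ⟨h1.2.2.2, ?_, by intro x; simp; tauto⟩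
        rw [Finset.card_eq_three]
        exact ⟨a, b, c, hab.1, h1.2.2.1, h1.1, rfl⟩
      · refine ⟨h2.2.2.2, ?_, by intro x; simp; tauto⟩
        rw [Finset.card_eq_three]
        exact ⟨a, b, d, hab.1, h2.2.2.1, h2.1, rfl⟩
  rw [Pi.add_apply, Pi.single_apply, Pi.single_apply]
  simp only [htri]
  by_cases ht1 : t = {a, b, c}
  · have : t ≠ {a, b, d} := ht1 ▸ hne
    simp [ht1, hne]
  · simp [ht1]

/-- If the vertices other than `w` are divided into two connected parts, then both of them meet the
link of `w` in a connected set. -/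
theorem conn_link_inter (h : IsSphere F U) {w : V} {S R : Finset V} (hSR : Disjoint S R)
    (hwS : w ∉ S) (hwR : w ∉ R) (hU : insert w (S ∪ R) = U) (hS : Conn (adj F) S)
    (hR : Conn (adj F) R) : Conn (adj (link F w)) (U.filter (adj F w) ∩ S) := by
  by_contra hcon
  unfold Conn at hcon
  push Not at hcon
  obtain ⟨T, hT, ⟨a, ha⟩, ⟨a', ha'⟩, hno⟩ := hcon
  have hwU : w ∈ U := hU ▸ Finset.mem_insert_self _ _
  have hTm : ∀ x ∈ T, adj F w x ∧ x ∈ S := fun x hx => by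
    have := hT hx
    rw [Finset.mem_inter, Finset.mem_filter] at this
    exact ⟨this.1.2, this.2⟩
  rw [Finset.mem_sdiff, Finset.mem_inter, Finset.mem_filter] at ha'
  obtain ⟨⟨⟨-, hwa'⟩, ha'S⟩, ha'T⟩ := ha'
  obtain ⟨hwa, haS⟩ := hTm a ha
  obtain ⟨z, hz1, hz2⟩ := exists_path_functional hS haS ha'S
  let Z : Module.Dual (ZMod 2) (Finset V → ZMod 2) :=
    z + LinearMap.proj {w, a} + LinearMap.proj {w, a'}
  have hZ : Z ∈ LinearMap.range (coboundary F).dualMap := by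
    rw [LinearMap.range_dualMap_eq_dualAnnihilator_ker, Submodule.mem_dualAnnihilator]
    intro c hc
    rw [LinearMap.mem_ker] at hc
    obtain ⟨s, hs⟩ := h.cohomology (fun x y => c {x, y})
      (fun x y => by rw [Finset.pair_comm]) (fun x y v hxyv => by
        obtain ⟨h1, h2, h3, h4⟩ := adj_link_iff.1 hxyv
        have h5 : ({x, y, v} : Finset V).card = 3 :=
          Finset.card_eq_three.2 ⟨x, y, v, h2, h3, h1, rfl⟩
        have h6 : coboundary F c {x, y, v} = 0 := by rw [hc]; rfl
        change (if _ then _ else _) = _ at h6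
        rw [if_pos ⟨h4, h5⟩, sum_powersetCard_two h2 h3 h1] at h6
        exact h6)
    simp only [Z, LinearMap.add_apply, LinearMap.proj_apply, hz2 c s hs, hs w a hwa, hs w a' hwa']
    linear_combination CharTwo.add_self_eq_zero (s a) + CharTwo.add_self_eq_zero (s a') +
      CharTwo.add_self_eq_zero (s w)
  obtain ⟨Y, hY⟩ := hZ
  let y : Finset V → ZMod 2 := fun t => Y (Pi.single t 1)
  have hYZ : ∀ b c d e, adj F b c → d ≠ e → (∀ x, adj (link F b) c x ↔ x = d ∨ x = e) →
      Z (Pi.single {b, c} 1) = y {b, c, d} + y {b, c, e} := by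
    intro b c d e hbc hde hx
    rw [← hY, LinearMap.dualMap_apply, coboundary_single hbc hde hx, map_add]
  have hZapp : ∀ e, Z (Pi.single e 1) = z (Pi.single e 1) + (if {w, a} = e then 1 else 0) +
      (if {w, a'} = e then 1 else 0) := by
    intro e
    simp [Z, Pi.single_apply]
  have hyR : ∀ n ∈ R, ∀ b c c', adj (link F n) b c → adj (link F n) b c' →
      y {n, b, c} = y {n, b, c'} := by
    intro n hn b c c' hc hc'
    have hnb := h.adj_of_adj_link hc
    obtain ⟨d, e, hde, hx⟩ := h.two n b hnb
    have hnS : n ∉ S := fun hc => Finset.disjoint_left.1 hSR hc hn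
    have hnw : n ≠ w := by
      rintro rfl
      exact hwR hn
    have hne : ∀ u ∈ S, ({w, u} : Finset V) ≠ {n, b} := by
      intro u hu he
      have : n ∈ ({w, u} : Finset V) := by rw [he]; simp
      simp only [Finset.mem_insert, Finset.mem_singleton, hnw, false_or] at this
      exact hnS (this ▸ hu)
    have h1 := hYZ n b d e hnb hde hx
    rw [hZapp, hz1 _ (fun hsub => hnS (hsub (by simp))), if_neg (hne a haS),
      if_neg (hne a' ha'S)] at h1
    have h2 : y {n, b, d} = y {n, b, e} := by
      refine (CharTwo.add_eq_zero).1 ?_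
      simpa using h1.symm
    rcases (hx c).1 hc with rfl | rfl <;> rcases (hx c').1 hc' with rfl | rfl <;> simp [h2]
  have hyn : ∀ n ∈ R, ∃ g, ∀ b c, adj (link F n) b c → y {n, b, c} = g := by
    intro n hn
    have hcirc := h.isCircle_link (w := n) (hU ▸ Finset.mem_insert_of_mem
      (Finset.mem_union_right _ hn))
    rcases (U.filter (adj F n)).eq_empty_or_nonempty with h0 | ⟨b₀, hb₀⟩
    · refine ⟨0, fun b c hbc => ?_⟩
      have h1 := h.adj_of_adj_link hbc
      have : b ∈ U.filter (adj F n) := Finset.mem_filter.2 ⟨h.mem_of_adj h1, h1⟩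
      rw [h0] at this
      simp at this
    · have hex : ∀ b ∈ U.filter (adj F n), ∃ c, adj (link F n) b c := fun b hb => by
        obtain ⟨c, d, -, hc⟩ := hcirc.two b hb
        exact ⟨c, (hc c).2 (Or.inl rfl)⟩
      choose! k hk using hex
      refine ⟨y {n, b₀, k b₀}, fun b c hbc => ?_⟩
      have hb : b ∈ U.filter (adj F n) := by
        have h1 := h.adj_of_adj_link hbc
        exact Finset.mem_filter.2 ⟨h.mem_of_adj h1, h1⟩
      rw [hyR n hn b c (k b) hbc (hk b hb)]
      refine hcirc.conn.eq_of_rel (f := fun b => y {n, b, k b}) (fun b hb c hc hbc => ?_) hb hb₀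
      rw [hyR n hn b (k b) c (hk b hb) hbc, hyR n hn c (k c) b (hk c hc) (adj_symm hbc)]
      congr 2
      exact Finset.pair_comm b c
  have hy0 : ∃ y₀, ∀ n ∈ R, ∀ b c, adj (link F n) b c → y {n, b, c} = y₀ := by
    choose! g hg using hyn
    rcases R.eq_empty_or_nonempty with h0 | ⟨n₀, hn₀⟩
    · exact ⟨0, by simp [h0]⟩
    · refine ⟨g n₀, fun n hn b c hbc => ?_⟩
      rw [hg n hn b c hbc]
      refine hR.eq_of_rel (fun n hn n' hn' hnn' => ?_) hn hn₀
      obtain ⟨d, e, -, hd⟩ := h.two n n' hnn'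
      have h1 := (hd d).2 (Or.inl rfl)
      rw [← hg n hn _ _ h1, ← hg n' hn' _ _ (adj_link_swap h1), Finset.insert_comm]
  obtain ⟨y₀, hy₀⟩ := hy0
  have hcirc := h.isCircle_link hwU
  have hTL : T ⊆ U.filter (adj F w) := hT.trans Finset.inter_subset_left
  let f : V → V → ZMod 2 := fun b x => if adj (link F w) b x then y {w, b, x} + y₀ else 0
  have h1 : ∑ b ∈ T, ∑ x ∈ U.filter (adj F w), f b x = 1 := by
    have hb : ∀ b ∈ T, ∑ x ∈ U.filter (adj F w), f b x = if b = a then 1 else 0 := by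
      intro b hb
      obtain ⟨hwb, hbS⟩ := hTm b hb
      obtain ⟨d, e, hde, hx⟩ := h.two w b hwb
      have hfil : (U.filter (adj F w)).filter (adj (link F w) b) = {d, e} := by
        ext x
        simp only [Finset.mem_filter (s := U.filter (adj F w)), Finset.mem_insert,
          Finset.mem_singleton, hx]
        refine ⟨fun h => h.2, fun hx' => ⟨hcirc.mem_of_adj ((hx x).2 hx'), hx'⟩⟩
      have hpair : ∀ {u v : V}, ({w, u} : Finset V) = {w, v} → w ≠ u → u = v := by
        intro u v he hwu
        have : u ∈ ({w, v} : Finset V) := by rw [← he]; simp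
        simpa [hwu.symm] using this
      have hba' : ({w, a'} : Finset V) ≠ {w, b} := fun he =>
        ha'T (hpair he hwa'.1 ▸ hb)
      have hba : ({w, a} : Finset V) = {w, b} ↔ b = a :=
        ⟨fun he => (hpair he hwa.1).symm, fun he => by rw [he]⟩
      have h2 := hYZ w b d e hwb hde hx
      rw [hZapp, hz1 _ (fun hsub => hwS (hsub (by simp))), if_neg hba'] at h2
      simp only [hba, zero_add, add_zero] at h2
      rw [h2, ← Finset.sum_filter, hfil, Finset.sum_pair hde]
      linear_combination CharTwo.add_self_eq_zero y₀
    rw [Finset.sum_congr rfl hb, Finset.sum_ite_eq', if_pos ha]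
  have h2 : ∑ b ∈ T, ∑ x ∈ T, f b x = 0 := by
    refine sum_sum_symm_eq_zero T f (fun b x => ?_) fun b => by simp [f, adj]
    have h3 : adj (link F w) b x ↔ adj (link F w) x b := ⟨adj_symm, adj_symm⟩
    simp [f, h3, Finset.pair_comm b x]
  have h3 : ∀ b ∈ T, ∑ x ∈ U.filter (adj F w), f b x = ∑ x ∈ T, f b x := by
    intro b hb
    refine (Finset.sum_subset hTL fun x hx hxT => ?_).symm
    by_cases hbx : adj (link F w) b x
    · have hxw := (Finset.mem_filter.1 hx).2
      have hxU := (Finset.mem_filter.1 hx).1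
      have hxR : x ∈ R := by
        rw [← hU, Finset.mem_insert, Finset.mem_union] at hxU
        rcases hxU with hxw' | hxS | hxR
        · exact absurd hxw'.symm hxw.1
        · exact absurd hbx (hno b hb x (Finset.mem_sdiff.2
            ⟨Finset.mem_inter.2 ⟨hx, hxS⟩, hxT⟩))
        · exact hxR
      have h4 := hy₀ x hxR w b (adj_link_rotate (adj_link_rotate hbx))
      have h5 : ({x, w, b} : Finset V) = {w, b, x} := by
        ext
        simp
        tauto
      rw [h5] at h4
      simp [f, h4, CharTwo.add_self_eq_zero]
    · simp [f, hbx]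
  rw [Finset.sum_congr rfl h3, h2] at h1
  exact zero_ne_one h1

/-- The cone over a triangulated sphere whose vertices are divided into two connected parts. -/
theorem isModel (h : IsSphere F U) (hUA : U ⊆ A) {P N : Finset V} (hPN : Disjoint P N)
    (hPU : P ∪ N = U) (hP0 : P.Nonempty) (hN0 : N.Nonempty) (hP : Conn (adj F) P)
    (hN : Conn (adj F) N) : IsModel ((PUnit × ℝ) × ℝ) F A P := by
  refine isModel_of_links (fun s hs => (h.subset s hs).trans hUA) h.subset h.vertex h.conn
    h.conn_erase (fun w hw => ?_) ?_ hPN hPU hP0 hN0 hP hN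
  · refine (h.isCircle_link hw).nonempty_homeo ?_
    obtain ⟨v, hv, hvw⟩ : ∃ v ∈ U, v ≠ w := by
      obtain ⟨p, hp⟩ := hP0
      obtain ⟨n, hn⟩ := hN0
      by_cases hpw : p = w
      · refine ⟨n, hPU ▸ Finset.mem_union_right _ hn, ?_⟩
        rintro rfl
        exact Finset.disjoint_left.1 hPN hp (hpw ▸ hn)
      · exact ⟨p, hPU ▸ Finset.mem_union_left _ hp, hpw⟩
    obtain ⟨b, -, hb⟩ := h.conn.exists_rel hw hv hvw
    exact ⟨b, Finset.mem_filter.2 ⟨h.mem_of_adj hb, hb⟩⟩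
  · rintro w hw P N hPN hwP hwN hU hP hN ⟨p, hp, hwp⟩ ⟨n, hn, hwn⟩
    have hcirc := h.isCircle_link hw
    obtain ⟨κ, hκ⟩ := hcirc.isModel (A := A) ((Finset.filter_subset _ _).trans hUA)
      (P := U.filter (adj F w) ∩ P) (N := U.filter (adj F w) ∩ N)
      (hPN.mono Finset.inter_subset_right Finset.inter_subset_right)
      (by
        rw [← Finset.inter_union_distrib_left, Finset.inter_eq_left]
        intro x hx
        rw [Finset.mem_filter, ← hU, Finset.mem_insert] at hx
        exact hx.1.resolve_left hx.2.1.symm)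
      ⟨p, by simp [hp, hwp, h.mem_of_adj hwp]⟩ ⟨n, by simp [hn, hwn, h.mem_of_adj hwn]⟩
      (h.conn_link_inter hPN hwP hwN hU hP hN)
      (h.conn_link_inter hPN.symm hwN hwP (by rw [Finset.union_comm, hU]) hN hP)
    refine ⟨κ, fun x => ?_⟩
    rw [hκ]
    obtain ⟨x, -, s, hs, hx⟩ := x
    refine height_congr fun v _ hv => ?_
    have : v ∈ U.filter (adj F w) := hcirc.subset s hs (by
      by_contra hc
      exact hv (hx v hc))
    simp [Finset.mem_filter.1 this]

end IsSphere

/-! ### Barycentric coordinates -/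

section Bary

variable {E : Type*} [NormedAddCommGroup E] [NormedSpace ℝ E]
  {K : Geometry.SimplicialComplex ℝ E} (hK : K.faces.Finite)

/-- The vertices of a finite complex, as a finite set. -/
def verts (hK : K.faces.Finite) : Finset E := hK.toFinset.biUnion id

theorem subset_verts {s : Finset E} (hs : s ∈ K.faces) : s ⊆ verts hK :=
  Finset.subset_biUnion_of_mem id (hK.mem_toFinset.2 hs)

theorem singleton_mem_faces {s : Finset E} (hs : s ∈ K.faces) {v : E} (hv : v ∈ s) :
    {v} ∈ K.faces :=
  K.down_closed hs (by simpa) (by simp)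

theorem mem_verts {v : E} : v ∈ verts hK ↔ {v} ∈ K.faces := by
  refine ⟨fun h => ?_, fun h => subset_verts hK h (by simp)⟩
  obtain ⟨s, hs, hv⟩ := Finset.mem_biUnion.1 h
  exact singleton_mem_faces (hK.mem_toFinset.1 hs) hv

/-- The barycentric weights on a complex. -/
def weights (hK : K.faces.Finite) : Set (E → ℝ) :=
  {x | x ∈ cone K.faces ∧ ∑ v ∈ verts hK, x v = 1}

variable {hK}

theorem sum_verts_eq {W : Type*} [AddCommMonoid W] {s : Finset E} (hs : s ∈ K.faces) {f : E → W}
    (hf : ∀ v ∉ s, f v = 0) : ∑ v ∈ verts hK, f v = ∑ v ∈ s, f v :=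
  (Finset.sum_subset (subset_verts hK hs) fun v _ hv => hf v hv).symm

theorem sum_smul_mem_convexHull {x : E → ℝ} (hx : x ∈ weights hK) {s : Finset E}
    (hs : s ∈ K.faces) (h : ∀ v ∉ s, x v = 0) :
    ∑ v ∈ verts hK, x v • v ∈ convexHull ℝ (s : Set E) := by
  rw [Finset.mem_convexHull']
  refine ⟨x, fun v _ => hx.1.1 v, ?_, ?_⟩
  · rw [← sum_verts_eq (hK := hK) hs h, hx.2]
  · exact (sum_verts_eq hs fun v hv => by rw [h v hv, zero_smul]).symm

theorem exists_weights {s : Finset E} (hs : s ∈ K.faces) {y : E}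
    (hy : y ∈ convexHull ℝ (s : Set E)) :
    ∃ x ∈ weights hK, (∀ v ∉ s, x v = 0) ∧ ∑ v ∈ verts hK, x v • v = y := by
  obtain ⟨w, hw0, hw1, hwy⟩ := Finset.mem_convexHull'.1 hy
  refine ⟨fun v => if v ∈ s then w v else 0, ⟨⟨fun v => ?_, s, hs, fun v hv => if_neg hv⟩, ?_⟩,
    fun v hv => if_neg hv, ?_⟩
  · by_cases hv : v ∈ s
    · simpa [hv] using hw0 v hv
    · simp [hv]
  · rw [sum_verts_eq hs fun v hv => if_neg hv, ← hw1]
    exact Finset.sum_congr rfl fun v hv => if_pos hv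
  · rw [sum_verts_eq hs fun v hv => by simp [hv], ← hwy]
    exact Finset.sum_congr rfl fun v hv => by simp [hv]

theorem weights_eq_of_subset {x x' : E → ℝ} (hx : x ∈ weights hK) (hx' : x' ∈ weights hK)
    {s : Finset E} (hs : s ∈ K.faces) (h : ∀ v ∉ s, x v = 0) (h' : ∀ v ∉ s, x' v = 0)
    (he : ∑ v ∈ verts hK, x v • v = ∑ v ∈ verts hK, x' v • v) : x = x' := by
  rw [sum_verts_eq hs fun v hv => by rw [h v hv, zero_smul],
    sum_verts_eq hs fun v hv => by rw [h' v hv, zero_smul]] at he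
  have h1 := hx.2
  have h2 := hx'.2
  rw [sum_verts_eq hs h] at h1
  rw [sum_verts_eq hs h'] at h2
  funext v
  by_cases hv : v ∈ s
  · exact (K.indep hs).eq_of_sum_eq_sum_subtype (h1.trans h2.symm) he v hv
  · rw [h v hv, h' v hv]

theorem weights_ext {x x' : E → ℝ} (hx : x ∈ weights hK) (hx' : x' ∈ weights hK)
    (he : ∑ v ∈ verts hK, x v • v = ∑ v ∈ verts hK, x' v • v) : x = x' := by
  obtain ⟨s, hs, h⟩ := hx.1.2
  obtain ⟨s', hs', h'⟩ := hx'.1.2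
  have hy := K.inter_subset_convexHull hs hs'
    ⟨sum_smul_mem_convexHull hx hs h, he ▸ sum_smul_mem_convexHull hx' hs' h'⟩
  rw [← Finset.coe_inter] at hy
  have hne : (s ∩ s').Nonempty := by
    have := convexHull_nonempty_iff.1 ⟨_, hy⟩
    exact_mod_cast this
  obtain ⟨u, hu, hu0, hue⟩ := exists_weights (hK := hK)
    (K.down_closed hs Finset.inter_subset_left hne) hy
  rw [weights_eq_of_subset hx hu hs h (fun v hv => hu0 v fun hc => hv (Finset.mem_inter.1 hc).1)
    hue.symm]
  exact weights_eq_of_subset hu hx' hs'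
    (fun v hv => hu0 v fun hc => hv (Finset.mem_inter.1 hc).2) h' (hue.trans he)

theorem isCompact_weights : IsCompact (weights hK) := by
  have hsub : weights hK ⊆ Set.pi univ fun _ => Icc (0 : ℝ) 1 := by
    intro x hx v _
    refine ⟨hx.1.1 v, ?_⟩
    by_cases hv : v ∈ verts hK
    · rw [← hx.2]
      exact Finset.single_le_sum (fun v _ => hx.1.1 v) hv
    · obtain ⟨s, hs, h⟩ := hx.1.2
      rw [h v fun hc => hv (subset_verts hK hs hc)]
      exact zero_le_one
  refine (isCompact_univ_pi fun _ => isCompact_Icc).of_isClosed_subset ?_ hsub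
  refine (isClosed_cone fun s hs => subset_verts hK hs).inter (isClosed_eq ?_ continuous_const)
  fun_prop

instance : CompactSpace (weights hK) := isCompact_iff_compactSpace.1 isCompact_weights

theorem sum_smul_mem_space {x : E → ℝ} (hx : x ∈ weights hK) :
    ∑ v ∈ verts hK, x v • v ∈ K.space := by
  obtain ⟨s, hs, h⟩ := hx.1.2
  exact K.convexHull_subset_space hs (sum_smul_mem_convexHull hx hs h)

variable (hK)

/-- The underlying space of a finite complex is the space of barycentric weights. -/
def weightsHomeo : weights hK ≃ₜ K.space :=
  Continuous.homeoOfEquivCompactToT2 (f := Equiv.ofBijective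
    (fun x : weights hK => (⟨∑ v ∈ verts hK, x.1 v • v, sum_smul_mem_space x.2⟩ : K.space))
    ⟨fun x x' h => Subtype.ext (weights_ext x.2 x'.2 (congrArg Subtype.val h)), fun y => by
      obtain ⟨s, hs, hy⟩ := Geometry.SimplicialComplex.mem_space_iff.1 y.2
      obtain ⟨x, hx, -, he⟩ := exists_weights (hK := hK) hs hy
      exact ⟨⟨x, hx⟩, Subtype.ext he⟩⟩)
    (Continuous.subtype_mk (continuous_finsetSum _ fun v _ =>
      ((continuous_apply v).comp continuous_subtype_val).smul continuous_const) _)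

/-- The barycentric coordinates of a point of a finite complex. -/
def bary (y : K.space) : E → ℝ := ((weightsHomeo hK).symm y : E → ℝ)

variable {hK}

theorem continuous_bary : Continuous (bary hK) :=
  continuous_subtype_val.comp (weightsHomeo hK).symm.continuous

theorem bary_mem_weights (y : K.space) : bary hK y ∈ weights hK := Subtype.coe_prop _

theorem bary_nonneg (y : K.space) (v : E) : 0 ≤ bary hK y v := (bary_mem_weights y).1.1 v

theorem sum_bary (y : K.space) : ∑ v ∈ verts hK, bary hK y v = 1 := (bary_mem_weights y).2

theorem sum_bary_smul (y : K.space) : ∑ v ∈ verts hK, bary hK y v • v = y :=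
  congrArg Subtype.val ((weightsHomeo hK).apply_symm_apply y)

theorem bary_eq_of_sum {x : E → ℝ} (hx : x ∈ weights hK) {y : K.space}
    (h : ∑ v ∈ verts hK, x v • v = y) : bary hK y = x :=
  weights_ext (bary_mem_weights y) hx ((sum_bary_smul y).trans h.symm)

theorem bary_eq_zero {s : Finset E} (hs : s ∈ K.faces) {y : K.space}
    (hy : (y : E) ∈ convexHull ℝ (s : Set E)) {v : E} (hv : v ∉ s) : bary hK y v = 0 := by
  obtain ⟨x, hx, h0, he⟩ := exists_weights (hK := hK) hs hy
  rw [bary_eq_of_sum hx he, h0 v hv]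

theorem mem_convexHull_of_bary {s : Finset E} (hs : s ∈ K.faces) {y : K.space}
    (h : ∀ v ∉ s, bary hK y v = 0) : (y : E) ∈ convexHull ℝ (s : Set E) := by
  rw [← sum_bary_smul (hK := hK) y]
  exact sum_smul_mem_convexHull (bary_mem_weights y) hs h

theorem bary_vertex {a : E} (ha : a ∈ K.space) (haK : {a} ∈ K.faces) :
    bary hK ⟨a, ha⟩ = Pi.single a 1 := by
  have h0 : ∀ v, v ≠ a → bary hK ⟨a, ha⟩ v = 0 := fun v hv =>
    bary_eq_zero haK (by simp) (by simpa using hv)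
  have h1 := sum_bary (hK := hK) ⟨a, ha⟩
  rw [sum_verts_eq haK fun v hv => h0 v (by simpa using hv), Finset.sum_singleton] at h1
  funext v
  by_cases hv : v = a
  · subst hv; simp [h1]
  · simp [hv, h0 v hv]

theorem lineMap_mem_space {s : Finset E} (hs : s ∈ K.faces) {y y' : E}
    (hy : y ∈ convexHull ℝ (s : Set E)) (hy' : y' ∈ convexHull ℝ (s : Set E)) (t : I) :
    AffineMap.lineMap y y' (t : ℝ) ∈ K.space :=
  K.convexHull_subset_space hs ((convex_convexHull ℝ _).lineMap_mem hy hy' t.2)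

theorem bary_lineMap {s : Finset E} (hs : s ∈ K.faces) {y y' : K.space}
    (hy : (y : E) ∈ convexHull ℝ (s : Set E)) (hy' : (y' : E) ∈ convexHull ℝ (s : Set E)) (t : I)
    {z : K.space} (hz : (z : E) = AffineMap.lineMap (y : E) (y' : E) (t : ℝ)) (v : E) :
    bary hK z v = (1 - t) * bary hK y v + t * bary hK y' v := by
  have hw : (fun v => (1 - (t : ℝ)) * bary hK y v + t * bary hK y' v) ∈ weights hK := by
    refine ⟨⟨fun v => ?_, s, hs, fun v hv => ?_⟩, ?_⟩
    · have := bary_nonneg (hK := hK) y v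
      have := bary_nonneg (hK := hK) y' v
      have := t.2.1
      have : 0 ≤ 1 - (t : ℝ) := sub_nonneg.2 t.2.2
      positivity
    · simp [bary_eq_zero hs hy hv, bary_eq_zero hs hy' hv]
    · simp [Finset.sum_add_distrib, ← Finset.mul_sum, sum_bary]
  rw [bary_eq_of_sum hw]
  rw [hz, AffineMap.lineMap_apply_module, ← sum_bary_smul (hK := hK) y,
    ← sum_bary_smul (hK := hK) y']
  simp [add_smul, Finset.sum_add_distrib, Finset.smul_sum, mul_smul]

/-- A point is in the relative interior of a face. -/
theorem exists_carrier (y : K.space) : ∃ s ∈ K.faces, ∀ v, v ∈ s ↔ 0 < bary hK y v := by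
  obtain ⟨s, hs, h⟩ := (bary_mem_weights (hK := hK) y).1.2
  refine ⟨s.filter fun v => 0 < bary hK y v, K.down_closed hs (Finset.filter_subset _ _) ?_, ?_⟩
  · by_contra hc
    have h1 := sum_bary (hK := hK) y
    rw [sum_verts_eq hs h, Finset.sum_eq_zero] at h1
    · exact zero_ne_one h1
    · intro v hv
      by_contra h0
      exact hc ⟨v, Finset.mem_filter.2 ⟨hv, lt_of_le_of_ne (bary_nonneg y v) (Ne.symm h0)⟩⟩
  · intro v
    rw [Finset.mem_filter, and_iff_right_iff_imp]
    intro hv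
    by_contra hc
    exact hv.ne' (h v hc)

theorem mem_of_bary_pos {s : Finset E} (hs : s ∈ K.faces) {y : K.space}
    (hy : (y : E) ∈ convexHull ℝ (s : Set E)) {v : E} (hv : 0 < bary hK y v) : v ∈ s := by
  by_contra hc
  exact hv.ne' (bary_eq_zero hs hy hc)

end Bary

/-! ### Čech cocycles on the sphere -/

section Cech

variable {B ι : Type*} [TopologicalSpace B]

/-- A Čech cocycle `c` for a cover `U` is a coboundary on the set `W`. -/
def IsCechBoundaryOn (W : Set B) (U : ι → Set B) (c : ι → ι → ZMod 2) : Prop :=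
  ∃ s : ι → B → ZMod 2, (∀ i, ContinuousOn (s i) (U i ∩ W)) ∧
    ∀ i j, ∀ x ∈ U i ∩ U j, x ∈ W → s j x = s i x + c i j

theorem isCechBoundaryOn_univ [SimplyConnectedSpace B] [LocallyPathConnectedSpace B]
    {U : ι → Set B} (hU : ∀ i, IsOpen (U i)) (hcov : ∀ x, ∃ i, x ∈ U i) {c : ι → ι → ZMod 2}
    (h0 : ∀ i, c i i = 0)
    (hc : ∀ i j k, ∀ x ∈ U i ∩ U j ∩ U k, c i j + c j k = c i k) :
    IsCechBoundaryOn univ U c := by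
  choose idx hidx using hcov
  let Z : FiberBundleCore ι B (ZMod 2) :=
    { baseSet := U
      isOpen_baseSet := hU
      indexAt := idx
      mem_baseSet_at := hidx
      coordChange := fun i j _ v => v + c i j
      coordChange_self := fun i _ _ v => by simp [h0]
      continuousOn_coordChange := fun i j => by fun_prop
      coordChange_comp := fun i j k x hx v => by rw [add_assoc, hc i j k x hx] }
  have hcover : IsCoveringMap (Bundle.TotalSpace.proj : Z.TotalSpace → B) :=
    IsCoveringMap.mk _ (fun _ => ZMod 2) (fun x => Z.localTrivAt x)
      (fun x => Z.mem_localTrivAt_baseSet x)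
  obtain ⟨b⟩ : Nonempty B := inferInstance
  obtain ⟨sec, ⟨-, hsec⟩, -⟩ := hcover.existsUnique_continuousMap_lifts (ContinuousMap.id B) b
    ⟨b, (0 : ZMod 2)⟩ rfl
  have hsec' : ∀ x, (sec x).1 = x := fun x => congrFun hsec x
  refine ⟨fun i x => (Z.localTriv i (sec x)).2, fun i => ?_, fun i j x hx _ => ?_⟩
  · refine continuous_snd.comp_continuousOn
      ((Z.localTriv i).continuousOn_toFun.comp sec.continuous.continuousOn fun x hx => ?_)
    change sec x ∈ (Z.localTriv i).source
    rw [Z.mem_localTriv_source, hsec', ← Z.baseSet_at]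
    exact hx.1
  · simp only [Z.localTriv_apply]
    have h1 : (sec x).1 ∈ Z.baseSet (Z.indexAt (sec x).1) ∩ Z.baseSet i ∩ Z.baseSet j := by
      refine ⟨⟨Z.mem_baseSet_at _, ?_⟩, ?_⟩
      · rw [hsec']; exact hx.1
      · rw [hsec']; exact hx.2
    exact (Z.coordChange_comp _ i j _ h1 (sec x).2).symm

theorem IsCechBoundaryOn.union {W W' : Set B} (hW : IsOpen W) (hW' : IsOpen W')
    (hcon : IsPreconnected (W ∩ W')) {U : ι → Set B} (hU : ∀ i, IsOpen (U i))
    (hcov : ∀ x, ∃ i, x ∈ U i) {c : ι → ι → ZMod 2} (h : IsCechBoundaryOn W U c)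
    (h' : IsCechBoundaryOn W' U c) : IsCechBoundaryOn (W ∪ W') U c := by
  obtain ⟨s, hs, hsc⟩ := h
  obtain ⟨s', hs', hsc'⟩ := h'
  choose idx hidx using hcov
  have hd : ∀ i, ∀ x ∈ U i, x ∈ W → x ∈ W' → s i x - s' i x = s (idx x) x - s' (idx x) x := by
    intro i x hx hxW hxW'
    rw [hsc i (idx x) x ⟨hx, hidx x⟩ hxW, hsc' i (idx x) x ⟨hx, hidx x⟩ hxW']
    ring
  have hdc : ContinuousOn (fun x => s (idx x) x - s' (idx x) x) (W ∩ W') := by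
    intro x hx
    have h1 : ContinuousOn (fun y => s (idx x) y - s' (idx x) y) (U (idx x) ∩ (W ∩ W')) :=
      ((hs _).mono fun y hy => ⟨hy.1, hy.2.1⟩).sub ((hs' _).mono fun y hy => ⟨hy.1, hy.2.2⟩)
    have h2 := (h1.congr fun y hy => (hd (idx x) y hy.1 hy.2.1 hy.2.2).symm) x ⟨hidx x, hx⟩
    rwa [inter_comm, continuousWithinAt_inter ((hU _).mem_nhds (hidx x))] at h2
  obtain ⟨d, hd'⟩ : ∃ d, ∀ x ∈ W ∩ W', s (idx x) x - s' (idx x) x = d := by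
    rcases (W ∩ W').eq_empty_or_nonempty with h0 | ⟨x₀, hx₀⟩
    · exact ⟨0, by simp [h0]⟩
    · exact ⟨_, fun x hx => hcon.constant hdc hx hx₀⟩
  let S : ι → B → ZMod 2 := fun i x => if x ∈ W then s i x else s' i x + d
  have hS1 : ∀ i, ∀ x ∈ W, S i x = s i x := fun i x hx => if_pos hx
  have hS2 : ∀ i, ∀ x ∈ U i, x ∈ W' → S i x = s' i x + d := by
    intro i x hx hxW'
    by_cases hxW : x ∈ W
    · rw [hS1 i x hxW, ← hd' x ⟨hxW, hxW'⟩, ← hd i x hx hxW hxW']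
      ring
    · exact if_neg hxW
  refine ⟨S, fun i => ?_, fun i j x hx hxW => ?_⟩
  · rw [inter_union_distrib_left]
    refine ContinuousOn.union_of_isOpen ((hs i).congr fun x hx => hS1 i x hx.2) ?_
      ((hU i).inter hW) ((hU i).inter hW')
    exact ((hs' i).add continuousOn_const).congr fun x hx => hS2 i x hx.1 hx.2
  · rcases hxW with hxW | hxW
    · rw [hS1 i x hxW, hS1 j x hxW, hsc i j x hx hxW]
    · rw [hS2 i x hx.1 hxW, hS2 j x hx.2 hxW, hsc' i j x hx hxW]
      ring

theorem IsCechBoundaryOn.of_openPartialHomeomorph {B' : Type*} [TopologicalSpace B']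
    (φ : OpenPartialHomeomorph B B') {U : ι → Set B} {c : ι → ι → ZMod 2}
    (h : IsCechBoundaryOn univ (fun i => φ.symm ⁻¹' U i) c) : IsCechBoundaryOn φ.source U c := by
  obtain ⟨s, hs, hsc⟩ := h
  have hmem : ∀ i, ∀ x ∈ U i, x ∈ φ.source → φ x ∈ φ.symm ⁻¹' U i := fun i x hx hxs => by
    rwa [mem_preimage, φ.left_inv hxs]
  refine ⟨fun i x => s i (φ x), fun i => ?_, fun i j x hx hxs => ?_⟩
  · exact (hs i).comp (φ.continuousOn.mono inter_subset_right) fun x hx =>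
      ⟨hmem i x hx.1 hx.2, mem_univ _⟩
  · exact hsc i j (φ x) ⟨hmem i x hx.1 hxs, hmem j x hx.2 hxs⟩ (mem_univ _)

theorem isCechBoundaryOn_source {W : Type*} [NormedAddCommGroup W] [NormedSpace ℝ W]
    (φ : OpenPartialHomeomorph B W) (hφ : φ.target = univ)
    {U : ι → Set B} (hU : ∀ i, IsOpen (U i)) (hcov : ∀ x, ∃ i, x ∈ U i) {c : ι → ι → ZMod 2}
    (h0 : ∀ i, c i i = 0)
    (hc : ∀ i j k, ∀ x ∈ U i ∩ U j ∩ U k, c i j + c j k = c i k) :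
    IsCechBoundaryOn φ.source U c := by
  have hcont : Continuous φ.symm := by
    rw [← continuousOn_univ, ← hφ]
    exact φ.continuousOn_symm
  exact .of_openPartialHomeomorph φ (isCechBoundaryOn_univ (fun i => (hU i).preimage hcont)
    (fun x => hcov _) h0 fun i j k x hx => hc i j k _ hx)

end Cech

section Sphere

abbrev S2 := Metric.sphere (0 : EuclideanSpace ℝ (Fin 3)) 1

theorem isPreconnected_compl_point (v : S2) : IsPreconnected ({v}ᶜ : Set S2) := by
  have h := range_stereographic_symm (norm_eq_of_mem_sphere v) v.2
  rw [← h]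
  exact isPreconnected_range (isOpenEmbedding_stereographic_symm _).continuous

instance : Fact (Module.finrank ℝ (EuclideanSpace ℝ (Fin 3)) = 2 + 1) := ⟨by simp⟩

theorem isPreconnected_compl_pair (v : S2) : IsPreconnected ({v}ᶜ ∩ {-v}ᶜ : Set S2) := by
  let φ := stereographic' 2 v
  have hs : φ.source = {v}ᶜ := stereographic'_source v
  have ht : φ.target = univ := stereographic'_target v
  have hv : -v ∈ φ.source := by
    rw [hs]
    exact fun h => (ne_neg_of_mem_unit_sphere ℝ v) (mem_singleton_iff.1 h).symm
  have hcont : Continuous φ.symm := by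
    rw [← continuousOn_univ, ← ht]
    exact φ.continuousOn_symm
  have hcon : IsPreconnected ({φ (-v)}ᶜ : Set (EuclideanSpace ℝ (Fin 2))) := by
    refine (isConnected_compl_singleton_of_one_lt_rank ?_ _).isPreconnected
    rw [← Module.finrank_eq_rank]
    simp
  have himg : φ.symm '' {φ (-v)}ᶜ = ({v}ᶜ ∩ {-v}ᶜ : Set S2) := by
    ext x
    constructor
    · rintro ⟨y, hy, rfl⟩
      have hyt : y ∈ φ.target := by rw [ht]; trivial
      refine ⟨by rw [← hs]; exact φ.map_target hyt, fun hc => hy ?_⟩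
      rw [mem_singleton_iff] at hc ⊢
      rw [← hc, φ.right_inv hyt]
    · rintro ⟨h1, h2⟩
      rw [← hs] at h1
      refine ⟨φ x, fun hc => h2 ?_, φ.left_inv h1⟩
      exact φ.injOn h1 hv hc
  rw [← himg]
  exact hcon.image _ hcont.continuousOn

theorem isCechBoundaryOn_of_sphere {B ι : Type*} [TopologicalSpace B] (e : B ≃ₜ S2)
    {U : ι → Set B} (hU : ∀ i, IsOpen (U i)) (hcov : ∀ x, ∃ i, x ∈ U i) {c : ι → ι → ZMod 2}
    (h0 : ∀ i, c i i = 0) (hc : ∀ i j k, ∀ x ∈ U i ∩ U j ∩ U k, c i j + c j k = c i k) :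
    IsCechBoundaryOn univ U c := by
  have hex : (EuclideanSpace.single 0 1 : EuclideanSpace ℝ (Fin 3)) ∈
      Metric.sphere (0 : EuclideanSpace ℝ (Fin 3)) 1 := by simp
  let v : S2 := ⟨_, hex⟩
  refine .of_openPartialHomeomorph e.toOpenPartialHomeomorph ?_
  have hU' : ∀ i, IsOpen (e.symm ⁻¹' U i) := fun i => (hU i).preimage e.symm.continuous
  have h1 : ∀ v : S2, IsCechBoundaryOn {v}ᶜ (fun i => e.symm ⁻¹' U i) c := fun v => by
    rw [← stereographic'_source (n := 2) v]
    exact isCechBoundaryOn_source _ (stereographic'_target v) hU' (fun x => hcov _) h0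
      fun i j k x hx => hc i j k _ hx
  have huniv : ({v}ᶜ ∪ {-v}ᶜ : Set S2) = univ := by
    rw [← compl_inter, singleton_inter_eq_empty.2, compl_empty]
    exact fun h => (ne_neg_of_mem_unit_sphere ℝ v) (mem_singleton_iff.1 h)
  have h2 := (h1 v).union isOpen_compl_singleton isOpen_compl_singleton
    (isPreconnected_compl_pair v) hU' (fun x => hcov _) (h1 (-v))
  rw [huniv] at h2
  exact h2

end Sphere

/-! ### Links of vertices -/

section LinkSpace

variable {E : Type*} [NormedAddCommGroup E] [NormedSpace ℝ E]
  {K : Geometry.SimplicialComplex ℝ E} {hK : K.faces.Finite} {a : E}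

/-- The vertices of the link of `a`. -/
def linkVerts (hK : K.faces.Finite) (a : E) : Finset E :=
  (verts hK).filter fun v => {v} ∈ link K.faces a

theorem link_down {s : Finset E} (hs : s ∈ link K.faces a) {t : Finset E} (ht : t ⊆ s) :
    t ∈ link K.faces a :=
  ⟨fun h => hs.1 (ht h), K.down_closed hs.2 (Finset.insert_subset_insert _ ht)
    (Finset.insert_nonempty _ _)⟩

theorem mem_faces_of_mem_link {s : Finset E} (hs : s ∈ link K.faces a) (h0 : s.Nonempty) :
    s ∈ K.faces :=
  K.down_closed hs.2 (Finset.subset_insert _ _) h0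

theorem mem_linkVerts {v : E} : v ∈ linkVerts hK a ↔ {v} ∈ link K.faces a := by
  rw [linkVerts, Finset.mem_filter, and_iff_right_iff_imp]
  exact fun h => (mem_verts hK).2 (mem_faces_of_mem_link h (by simp))

theorem subset_linkVerts {s : Finset E} (hs : s ∈ link K.faces a) : s ⊆ linkVerts hK a :=
  fun _ hv => mem_linkVerts.2 (link_down hs (by simpa))

theorem mem_linkSpace {s : Finset E} (hs : s ∈ link K.faces a) {y : E}
    (hy : y ∈ convexHull ℝ (s : Set E)) : y ∈ linkSpace K a := by
  have h0 : s.Nonempty := by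
    have := convexHull_nonempty_iff.1 ⟨y, hy⟩
    exact_mod_cast this
  exact mem_biUnion (x := s) ⟨mem_faces_of_mem_link hs h0, hs.1, hs.2⟩ hy

theorem exists_of_mem_linkSpace {y : E} (hy : y ∈ linkSpace K a) :
    ∃ s ∈ link K.faces a, s ∈ K.faces ∧ y ∈ convexHull ℝ (s : Set E) := by
  rw [linkSpace, mem_iUnion₂] at hy
  obtain ⟨s, ⟨h1, h2, h3⟩, hy⟩ := hy
  exact ⟨s, ⟨h2, h3⟩, h1, hy⟩

theorem linkSpace_subset : linkSpace K a ⊆ K.space := by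
  intro y hy
  obtain ⟨s, -, hs, hy⟩ := exists_of_mem_linkSpace hy
  exact K.convexHull_subset_space hs hy

variable (hK) in
/-- The barycentric coordinates on the link. -/
def linkBary (y : linkSpace K a) : E → ℝ := bary hK ⟨y, linkSpace_subset y.2⟩

theorem continuous_linkBary : Continuous (linkBary hK : linkSpace K a → E → ℝ) :=
  continuous_bary.comp (continuous_subtype_val.subtype_mk _)

theorem isOpen_linkBary_pos (v : E) : IsOpen {y : linkSpace K a | 0 < linkBary hK y v} :=
  isOpen_lt continuous_const ((continuous_apply v).comp continuous_linkBary)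

theorem exists_link_carrier (y : linkSpace K a) :
    ∃ s ∈ link K.faces a, s ∈ K.faces ∧ ∀ v, v ∈ s ↔ 0 < linkBary hK y v := by
  obtain ⟨s, hs, hsK, hy⟩ := exists_of_mem_linkSpace y.2
  obtain ⟨t, htK, ht⟩ := exists_carrier (hK := hK) ⟨y, linkSpace_subset y.2⟩
  refine ⟨t, link_down hs fun v hv => ?_, htK, ht⟩
  exact mem_of_bary_pos hsK hy ((ht v).1 hv)

theorem exists_linkBary_pos (y : linkSpace K a) : ∃ v ∈ linkVerts hK a, 0 < linkBary hK y v := by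
  obtain ⟨s, hs, hsK, h⟩ := exists_link_carrier (hK := hK) y
  obtain ⟨v, hv⟩ := K.nonempty_of_mem_faces hsK
  exact ⟨v, subset_linkVerts hs hv, (h v).1 hv⟩

theorem linkVert_mem_linkSpace {v : E} (hv : v ∈ linkVerts hK a) : v ∈ linkSpace K a :=
  mem_linkSpace (mem_linkVerts.1 hv) (by simp)

theorem linkBary_vertex {v : E} (hv : v ∈ linkVerts hK a) :
    linkBary hK ⟨v, linkVert_mem_linkSpace hv⟩ = Pi.single v 1 :=
  bary_vertex _ (mem_faces_of_mem_link (mem_linkVerts.1 hv) (by simp))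

theorem conn_of_isPreconnected {S : Finset E} (hS : S ⊆ linkVerts hK a) {W : Set (linkSpace K a)}
    (hW : IsPreconnected W) (hcov : ∀ y ∈ W, ∃ v ∈ S, 0 < linkBary hK y v)
    (hSW : ∀ v (hv : v ∈ S), ⟨v, linkVert_mem_linkSpace (hS hv)⟩ ∈ W) :
    Conn (adj (link K.faces a)) S := by
  rintro T hT ⟨t, ht⟩ ⟨u, hu⟩
  have hopen : ∀ T : Finset E, IsOpen {y : linkSpace K a | ∃ v ∈ T, 0 < linkBary hK y v} := by
    intro T
    have : {y : linkSpace K a | ∃ v ∈ T, 0 < linkBary hK y v} =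
        ⋃ v ∈ T, {y | 0 < linkBary hK y v} := by
      ext
      simp
    rw [this]
    exact isOpen_biUnion fun v _ => isOpen_linkBary_pos v
  obtain ⟨y, hyW, ⟨v, hv, hyv⟩, ⟨v', hv', hyv'⟩⟩ := hW _ _ (hopen T) (hopen (S \ T))
    (fun y hy => by
      obtain ⟨v, hv, hyv⟩ := hcov y hy
      by_cases hvT : v ∈ T
      · exact Or.inl ⟨v, hvT, hyv⟩
      · exact Or.inr ⟨v, Finset.mem_sdiff.2 ⟨hv, hvT⟩, hyv⟩)
    ⟨_, hSW t (hT ht), t, ht, by simp [linkBary_vertex (hS (hT ht))]⟩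
    ⟨_, hSW u (Finset.mem_sdiff.1 hu).1, u, hu, by
      simp [linkBary_vertex (hS (Finset.mem_sdiff.1 hu).1)]⟩
  obtain ⟨s, hs, -, h⟩ := exists_link_carrier (hK := hK) y
  refine ⟨v, hv, v', hv', ?_, link_down hs ?_⟩
  · rintro rfl
    exact (Finset.mem_sdiff.1 hv').2 hv
  · rw [Finset.insert_subset_iff, Finset.singleton_subset_iff, h, h]
    exact ⟨hyv, hyv'⟩

theorem conn_linkVerts (e : linkSpace K a ≃ₜ S2) :
    Conn (adj (link K.faces a)) (linkVerts hK a) := by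
  refine conn_of_isPreconnected (W := univ) Subset.rfl ?_ (fun y _ => exists_linkBary_pos y)
    fun _ _ => trivial
  have : IsPreconnected (univ : Set S2) := by
    have : PreconnectedSpace S2 := Subtype.preconnectedSpace (isPreconnected_sphere (by
      rw [← Module.finrank_eq_rank]
      simp) _ _)
    exact isPreconnected_univ
  have h := this.image e.symm e.symm.continuous.continuousOn
  rwa [image_univ, e.symm.range_coe] at h

theorem conn_linkVerts_erase (e : linkSpace K a ≃ₜ S2) {w : E} (hw : w ∈ linkVerts hK a) :
    Conn (adj (link K.faces a)) ((linkVerts hK a).erase w) := by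
  let p : linkSpace K a := ⟨w, linkVert_mem_linkSpace hw⟩
  refine conn_of_isPreconnected (W := {p}ᶜ) (Finset.erase_subset _ _) ?_ (fun y hy => ?_)
    fun v hv hc => ?_
  · have h := (isPreconnected_compl_point (e p)).image e.symm e.symm.continuous.continuousOn
    rwa [e.symm.image_eq_preimage_symm, Homeomorph.symm_symm, preimage_compl,
      ← e.symm_symm, ← Homeomorph.image_eq_preimage_symm, image_singleton,
      Homeomorph.symm_symm, e.symm_apply_apply] at h
  · by_contra hcon
    push Not at hcon
    obtain ⟨s, hs, hsK, h⟩ := exists_link_carrier (hK := hK) y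
    have hsw : s ⊆ {w} := fun v hv => by
      by_contra hvw
      rw [Finset.mem_singleton] at hvw
      exact absurd ((h v).1 hv) (not_lt.2 (hcon v (Finset.mem_erase.2
        ⟨hvw, subset_linkVerts hs hv⟩)))
    have hpos : ∀ v, v ∉ s → linkBary hK y v = 0 := fun v hv =>
      le_antisymm (not_lt.1 fun hc => hv ((h v).2 hc)) (bary_nonneg _ v)
    have hy' : (y : E) ∈ convexHull ℝ (s : Set E) :=
      mem_convexHull_of_bary (y := ⟨y, linkSpace_subset y.2⟩) hsK hpos
    have := convexHull_mono (Finset.coe_subset.2 hsw) hy'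
    simp only [Finset.coe_singleton, convexHull_singleton, mem_singleton_iff] at this
    exact hy (Subtype.ext this)
  · exact (Finset.mem_erase.1 hv).1 (congrArg Subtype.val (mem_singleton_iff.1 hc))

theorem exists_path_to_midpoint {b c : E} (h : adj (link K.faces a) b c)
    (hb : b ∈ linkSpace K a) :
    ∃ γ : C(I, linkSpace K a), γ 0 = ⟨b, hb⟩ ∧ (γ 1 : E) = AffineMap.lineMap b c (1 / 2 : ℝ) ∧
      ∀ t, 0 < linkBary hK (γ t) b := by
  have hsK : {b, c} ∈ K.faces := mem_faces_of_mem_link h.2 (by simp)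
  have hbs : b ∈ convexHull ℝ (({b, c} : Finset E) : Set E) := subset_convexHull _ _ (by simp)
  have hcs : c ∈ convexHull ℝ (({b, c} : Finset E) : Set E) := subset_convexHull _ _ (by simp)
  let half : I → I := fun t => ⟨(t : ℝ) / 2, by
    have := t.2.1
    have := t.2.2
    constructor <;> linarith⟩
  refine ⟨⟨fun t => ⟨AffineMap.lineMap b c (half t : ℝ), mem_linkSpace h.2
    ((convex_convexHull ℝ _).lineMap_mem hbs hcs (half t).2)⟩, ?_⟩, ?_, ?_, fun t => ?_⟩
  · refine Continuous.subtype_mk ?_ _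
    refine AffineMap.lineMap_continuous.comp ?_
    change Continuous fun t : I => (t : ℝ) / 2
    fun_prop
  · simp [half]
  · simp [half]
  · have hbK : {b} ∈ K.faces := singleton_mem_faces hsK (by simp)
    have hcK : {c} ∈ K.faces := singleton_mem_faces hsK (by simp)
    have := bary_lineMap (hK := hK) hsK
      (y := ⟨b, K.convexHull_subset_space hsK hbs⟩) (y' := ⟨c, K.convexHull_subset_space hsK hcs⟩)
      hbs hcs (half t) (z := ⟨_, lineMap_mem_space hsK hbs hcs (half t)⟩) rfl b
    rw [bary_vertex _ hbK, bary_vertex _ hcK] at this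
    change 0 < bary hK ⟨_, lineMap_mem_space hsK hbs hcs (half t)⟩ b
    rw [this]
    have := t.2.2
    simp [half, h.1]
    linarith

theorem cohomology_link (e : linkSpace K a ≃ₜ S2) (hK : K.faces.Finite) (c : E → E → ZMod 2)
    (hsymm : ∀ b d, c b d = c d b)
    (hc : ∀ b d f, adj (link (link K.faces a) b) d f → c b d + c d f + c b f = 0) :
    ∃ s : E → ZMod 2, ∀ b d, adj (link K.faces a) b d → c b d = s b + s d := by
  obtain ⟨s, hs, hsc⟩ := isCechBoundaryOn_of_sphere e
    (U := fun v : E => {y : linkSpace K a | 0 < linkBary hK y v})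
    (c := fun b d => if b = d then 0 else c b d) (fun v => isOpen_linkBary_pos v)
    (fun y => by
      obtain ⟨v, -, hv⟩ := exists_linkBary_pos (hK := hK) y
      exact ⟨v, hv⟩) (fun v => if_pos rfl) (by
      rintro b d f y ⟨⟨hb, hd⟩, hf⟩
      by_cases hbd : b = d
      · subst hbd; simp
      by_cases hdf : d = f
      · subst hdf; simp
      by_cases hbf : b = f
      · subst hbf
        simp [hbd, hdf, hsymm d b, CharTwo.add_self_eq_zero]
      simp only [hbd, hdf, hbf, if_false]
      obtain ⟨t, ht, -, hty⟩ := exists_link_carrier (hK := hK) y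
      have := hc b d f (adj_link_iff.2 ⟨hdf, hbd, hbf, link_down ht (by
        simp only [Finset.insert_subset_iff, Finset.singleton_subset_iff, hty]
        exact ⟨hb, hd, hf⟩)⟩)
      exact CharTwo.add_eq_zero.1 this)
  have hval : ∀ b d, ∀ h : adj (link K.faces a) b d, ∀ hb : b ∈ linkSpace K a,
      ∃ m : linkSpace K a, (m : E) = AffineMap.lineMap b d (1 / 2 : ℝ) ∧
        0 < linkBary hK m b ∧ s b m = s b ⟨b, hb⟩ := by
    intro b d h hb
    obtain ⟨γ, h0, h1, hpos⟩ := exists_path_to_midpoint (hK := hK) h hb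
    refine ⟨γ 1, h1, hpos 1, ?_⟩
    have hcont : Continuous fun t => s b (γ t) := by
      rw [← continuousOn_univ]
      exact (hs b).comp γ.continuous.continuousOn fun t _ => ⟨hpos t, mem_univ _⟩
    rw [← h0]
    exact isPreconnected_univ.constant hcont.continuousOn (mem_univ _) (mem_univ _)
  refine ⟨fun v => if hv : v ∈ linkSpace K a then s v ⟨v, hv⟩ else 0, fun b d h => ?_⟩
  have hb : b ∈ linkSpace K a := linkVert_mem_linkSpace (hK := hK) (subset_linkVerts h.2 (by simp))
  have hd : d ∈ linkSpace K a := linkVert_mem_linkSpace (hK := hK) (subset_linkVerts h.2 (by simp))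
  obtain ⟨m, hm, hmb, h1⟩ := hval b d h hb
  obtain ⟨m', hm', hmd, h2⟩ := hval d b (adj_symm h) hd
  have hmm' : m' = m := by
    refine Subtype.ext ?_
    rw [hm, hm', ← AffineMap.lineMap_apply_one_sub]
    norm_num
  subst hmm'
  have h3 := hsc b d m' ⟨hmb, hmd⟩ trivial
  simp only [if_neg h.1] at h3
  simp only [dif_pos hb, dif_pos hd]
  rw [← h1, ← h2, h3, ← add_assoc, CharTwo.add_self_eq_zero, zero_add]

end LinkSpace

theorem Triangulation.isSphere_link {M : Type*} [TopologicalSpace M] {E : Type*}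
    [NormedAddCommGroup E] [NormedSpace ℝ E] (T : Triangulation M E) {a : E}
    (ha : a ∈ T.K.vertices) : IsSphere (link T.K.faces a) (linkVerts T.finite a) := by
  obtain ⟨e⟩ := T.link_sphere a ha
  exact
  { subset := fun s hs => subset_linkVerts hs
    down := fun s hs t ht => link_down hs ht
    vertex := fun v hv => mem_linkVerts.1 hv
    card_le := fun s hs => by
      have := T.card_le _ hs.2
      rw [Finset.card_insert_of_notMem hs.1] at this
      omega
    conn := conn_linkVerts e
    conn_erase := fun w hw => conn_linkVerts_erase e hw
    cohomology := cohomology_link e T.finite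
    two := fun b c hbc => by
      have hab : a ≠ b := fun h => hbc.2.1 (by simp [h])
      have hac : a ≠ c := fun h => hbc.2.1 (by simp [h])
      have h3 : ({a, b, c} : Finset E).card = 3 :=
        Finset.card_eq_three.2 ⟨a, b, c, hab, hac, hbc.1, rfl⟩
      have hmem : ∀ t, (t ∈ T.K.faces ∧ {a, b, c} ⊆ t ∧ t.card = 4) ↔
          ∃ d, adj (link (link T.K.faces a) b) c d ∧ t = {a, b, c, d} := by
        intro t
        constructor
        · rintro ⟨htK, hsub, h4⟩
          obtain ⟨d, hd⟩ : ∃ d, t \ {a, b, c} = {d} := by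
            rw [← Finset.card_eq_one, Finset.card_sdiff_of_subset hsub, h3, h4]
          have hte : t = {a, b, c, d} := by
            rw [← Finset.sdiff_union_of_subset hsub, hd]
            ext
            simp
            tauto
          have hdm : d ∈ t \ {a, b, c} := by simp [hd]
          simp only [Finset.mem_sdiff, Finset.mem_insert, Finset.mem_singleton, not_or] at hdm
          refine ⟨d, adj_link_iff.2 ⟨fun h => hdm.2.2.2 h.symm, hbc.1,
            fun h => hdm.2.2.1 h.symm, ?_, hte ▸ htK⟩, hte⟩
          simpa [hab, hac] using fun h : a = d => hdm.2.1 h.symm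
        · rintro ⟨d, hd, rfl⟩
          obtain ⟨hcd, -, hbd, had, hF⟩ := adj_link_iff.1 hd
          simp only [Finset.mem_insert, Finset.mem_singleton, not_or] at had
          refine ⟨hF, by intro x; simp; tauto, ?_⟩
          rw [Finset.card_insert_of_notMem (by simp [had]),
            Finset.card_eq_three.2 ⟨b, c, d, hbc.1, hbd, hcd, rfl⟩]
      have h2 := T.two_sided _ hbc.2.2 h3
      rw [Set.ncard_eq_two] at h2
      obtain ⟨t, t', htt', hset⟩ := h2
      have ht : t ∈ {t ∈ T.K.faces | {a, b, c} ⊆ t ∧ t.card = 4} := by rw [hset]; simp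
      have ht' : t' ∈ {t ∈ T.K.faces | {a, b, c} ⊆ t ∧ t.card = 4} := by rw [hset]; simp
      obtain ⟨d, hd, rfl⟩ := (hmem t).1 ht
      obtain ⟨d', hd', rfl⟩ := (hmem t').1 ht'
      refine ⟨d, d', fun h => htt' (by rw [h]), fun f => ⟨fun hf => ?_, ?_⟩⟩
      · have hft : ({a, b, c, f} : Finset E) ∈
            {t ∈ T.K.faces | {a, b, c} ⊆ t ∧ t.card = 4} := (hmem _).2 ⟨f, hf, rfl⟩
        obtain ⟨hcf, -, hbf, haf, -⟩ := adj_link_iff.1 hf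
        simp only [Finset.mem_insert, Finset.mem_singleton, not_or] at haf
        rw [hset] at hft
        have key : ∀ u, ({a, b, c, f} : Finset E) = {a, b, c, u} → f = u := by
          intro u hu
          have : f ∈ ({a, b, c, u} : Finset E) := by rw [← hu]; simp
          have hfa : f ≠ a := fun h => haf.2.2 h.symm
          simpa [hfa, hbf.symm, hcf.symm] using this
        rcases hft with h | h
        · exact Or.inl (key _ h)
        · exact Or.inr (key _ h)
      · rintro (rfl | rfl)
        · exact hd
        · exact hd' }

theorem conn_of_connected {V : Type*} {G : SimpleGraph V} {S : Set V} (h : (G.induce S).Connected)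
    {r : V → V → Prop} (hr : ∀ a b, G.Adj a b → r a b) {P : Finset V}
    (hP : ∀ v, v ∈ P ↔ v ∈ S) : Conn r P := by
  rintro T hT ⟨x, hx⟩ ⟨y, hy⟩
  by_contra hcon
  push Not at hcon
  rw [Finset.mem_sdiff] at hy
  have hreach := h.preconnected ⟨x, (hP x).1 (hT hx)⟩ ⟨y, (hP y).1 hy.1⟩
  rw [SimpleGraph.reachable_iff_reflTransGen] at hreach
  refine hy.2 ?_
  suffices ∀ z, Relation.ReflTransGen (G.induce S).Adj ⟨x, (hP x).1 (hT hx)⟩ z → (z : V) ∈ T from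
    this _ hreach
  intro z hz
  induction hz with
  | refl => exact hx
  | @tail b c _ hbc ih =>
    by_contra hcT
    exact hcon b ih c (Finset.mem_sdiff.2 ⟨(hP c).2 c.2, hcT⟩) (hr _ _ hbc)

/-- The model of the cone over the link of a vertex, for the signs given by a direction. -/
theorem Triangulation.isModel_link {M : Type*} [TopologicalSpace M] {E : Type*}
    [NormedAddCommGroup E] [NormedSpace ℝ E] (T : Triangulation M E) {D : Direction T.K}
    (hD : D.IsLocalOrientation) {a : E} (ha : a ∈ T.K.vertices) :
    IsModel ((PUnit × ℝ) × ℝ) (link T.K.faces a) (verts T.finite)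
      ((linkVerts T.finite a).filter (D.out a)) := by
  have hmem : ∀ v, v ∈ linkVerts T.finite a ↔ IsEdge T.K a v := fun v => by
    rw [mem_linkVerts]
    simp [link, IsEdge]
  have hout : ∀ v, v ∈ (linkVerts T.finite a).filter (D.out a) ↔ v ∈ {v | D.out a v} := fun v => by
    rw [Finset.mem_filter, hmem]
    exact ⟨fun h => h.2, fun h => ⟨D.isEdge_of_out _ _ h, h⟩⟩
  have hedge : ∀ v, IsEdge T.K v a → IsEdge T.K a v := fun v h =>
    ⟨h.1.symm, by rw [Finset.pair_comm]; exact h.2⟩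
  have hin : ∀ v, v ∈ (linkVerts T.finite a).filter (fun v => D.out v a) ↔
      v ∈ {v | D.out v a} := fun v => by
    rw [Finset.mem_filter, hmem]
    exact ⟨fun h => h.2, fun h => ⟨hedge v (D.isEdge_of_out _ _ h), h⟩⟩
  have hadj : ∀ b c, (linkGraph T.K a).Adj b c → adj (link T.K.faces a) b c := by
    rintro b c ⟨h1, h2, h3, h4⟩
    exact ⟨h1, by simp [h2.symm, h3.symm], h4⟩
  refine (T.isSphere_link ha).isModel (Finset.filter_subset _ _)
    (N := (linkVerts T.finite a).filter fun v => D.out v a) ?_ ?_ ?_ ?_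
    (conn_of_connected (hD.out_connected a ha) hadj hout)
    (conn_of_connected (hD.in_connected a ha) hadj hin)
  · rw [Finset.disjoint_left]
    intro v hv hv'
    rw [Finset.mem_filter] at hv hv'
    rcases D.out_xor a v ((hmem v).1 hv.1) with h | h
    · exact h.2 hv'.2
    · exact h.2 hv.2
  · ext v
    rw [Finset.mem_union, Finset.mem_filter, Finset.mem_filter, ← and_or_left,
      and_iff_left_iff_imp, hmem]
    intro hv
    rcases D.out_xor a v hv with h | h
    · exact Or.inl h.1
    · exact Or.inr h.1
  · obtain ⟨v⟩ := (hD.out_connected a ha).nonempty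
    exact ⟨v, (hout v).2 v.2⟩
  · obtain ⟨v⟩ := (hD.in_connected a ha).nonempty
    exact ⟨v, (hin v).2 v.2⟩

/-! ### Sections of a covering map -/

section Sections

variable {X B : Type*} [TopologicalSpace X] [TopologicalSpace B] {q : X → B} {S S' : Set B}
  {τ τ' : B → X}

/-- `τ` is a continuous section of `q` over the set `S`. -/
structure IsSec (q : X → B) (S : Set B) (τ : B → X) : Prop where
  cont : ContinuousOn τ S
  inv : ∀ y ∈ S, q (τ y) = y

theorem IsSec.eq_of_eq (hq : IsCoveringMap q) (h : IsSec q S τ) (h' : IsSec q S' τ') {A : Set B}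
    (hA : IsPreconnected A) (hS : A ⊆ S) (hS' : A ⊆ S') {b y : B} (hb : b ∈ A) (hy : y ∈ A)
    (he : τ b = τ' b) : τ y = τ' y :=
  hq.eqOn_of_comp_eqOn hA (h.cont.mono hS) (h'.cont.mono hS')
    (fun z hz => by simp [h.inv z (hS hz), h'.inv z (hS' hz)]) hb he hy

theorem IsSec.eventually_eq (hq : IsCoveringMap q) (h : IsSec q S τ) (hS : IsOpen S) {x : X}
    (hx : q x ∈ S) (he : τ (q x) = x) : ∀ᶠ y in 𝓝 x, q y ∈ S ∧ τ (q y) = y := by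
  obtain ⟨U, hU, hxU, hinj⟩ := hq.isLocalHomeomorph.isLocallyInjective x
  have hqx : ContinuousAt q x := hq.continuous.continuousAt
  have h1 : ContinuousAt (fun y => τ (q y)) x :=
    ContinuousAt.comp (f := q) (h.cont.continuousAt (hS.mem_nhds hx)) hqx
  filter_upwards [hU.mem_nhds hxU, h1.preimage_mem_nhds (by rw [he]; exact hU.mem_nhds hxU),
    hqx.preimage_mem_nhds (hS.mem_nhds hx)] with y hy hy' hyS
  exact ⟨hyS, hinj hy' hy (h.inv _ hyS)⟩

/-- Over a set that contracts to a point, a covering map has sections. -/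
theorem exists_isSec (hq : IsCoveringMap q) {b : B} (hb : b ∈ S) (H : C(I × S, B))
    (h0 : ∀ y, H (0, y) = b) (h1 : ∀ y, H (1, y) = y) (hH : ∀ t, H (t, ⟨b, hb⟩) = b) {x : X}
    (hx : q x = b) : ∃ τ, IsSec q S τ ∧ τ b = x := by
  let G := hq.liftHomotopy H (ContinuousMap.const S x) fun y => by simp [h0, hx]
  have hG : ∀ z, q (G z) = H z := fun z => congrFun (hq.liftHomotopy_lifts H _ _) z
  have hG0 : ∀ y, G (0, y) = x := fun y => hq.liftHomotopy_zero H _ _ y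
  have hGb : ∀ t, G (t, ⟨b, hb⟩) = x := fun t => by
    rw [← hG0 ⟨b, hb⟩]
    exact hq.const_of_comp (g := fun t => G (t, ⟨b, hb⟩)) (by fun_prop)
      (fun t t' => by rw [hG, hG, hH, hH]) t 0
  refine ⟨fun y => if hy : y ∈ S then G (1, ⟨y, hy⟩) else x, ⟨?_, fun y hy => ?_⟩, ?_⟩
  · rw [continuousOn_iff_continuous_domRestrict]
    refine Continuous.congr (f := fun y : S => G (1, y)) (by fun_prop) fun y => ?_
    simp
  · rw [dif_pos hy, hG, h1]
  · exact (dif_pos hb).trans (hGb 1)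

end Sections

/-! ### Lifts of simplices and stars -/

section Lifts

variable {E : Type*} [NormedAddCommGroup E] [NormedSpace ℝ E]
  {K : Geometry.SimplicialComplex ℝ E} {hK : K.faces.Finite}
  {X : Type*} [TopologicalSpace X] {q : X → K.space}

/-- The points of a simplex. -/
def cell (K : Geometry.SimplicialComplex ℝ E) (s : Finset E) : Set K.space :=
  {y | (y : E) ∈ convexHull ℝ (s : Set E)}

/-- The open star of a vertex. -/
def star (hK : K.faces.Finite) (a : E) : Set K.space := {y | 0 < bary hK y a}

theorem isOpen_star (a : E) : IsOpen (star hK a) :=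
  isOpen_lt continuous_const ((continuous_apply a).comp continuous_bary)

theorem vertex_mem_space {s : Finset E} (hs : s ∈ K.faces) {v : E} (hv : v ∈ s) : v ∈ K.space :=
  K.convexHull_subset_space hs (subset_convexHull ℝ _ hv)

theorem vertex_mem_cell {s : Finset E} {v : E} (hv : v ∈ s) (hvK : v ∈ K.space) :
    ⟨v, hvK⟩ ∈ cell K s :=
  subset_convexHull ℝ _ hv

theorem exists_carrier_cell (y : K.space) :
    ∃ s ∈ K.faces, y ∈ cell K s ∧ ∀ v, v ∈ s ↔ 0 < bary hK y v := by
  obtain ⟨s, hs, h⟩ := exists_carrier (hK := hK) y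
  exact ⟨s, hs, mem_convexHull_of_bary hs fun v hv =>
    le_antisymm (not_lt.1 fun hc => hv ((h v).2 hc)) (bary_nonneg _ v), h⟩

theorem center_mem_star {a : E} (haK : {a} ∈ K.faces) (haS : a ∈ K.space) :
    ⟨a, haS⟩ ∈ star hK a := by
  simp [star, bary_vertex haS haK]

theorem isPreconnected_of_convex {A : Set K.space} {C : Set E} (hC : Convex ℝ C)
    (hA : Subtype.val '' A = C) : IsPreconnected A := by
  rw [← IsInducing.subtypeVal.isPreconnected_image, hA]
  exact hC.isPreconnected

theorem isPreconnected_cell_inter {s s' : Finset E} (hs : s ∈ K.faces) :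
    IsPreconnected (cell K s ∩ cell K s') := by
  refine isPreconnected_of_convex (C := convexHull ℝ (s : Set E) ∩ convexHull ℝ (s' : Set E))
    ((convex_convexHull ℝ _).inter (convex_convexHull ℝ _)) ?_
  ext y
  refine ⟨?_, fun h => ⟨⟨y, K.convexHull_subset_space hs h.1⟩, h, rfl⟩⟩
  rintro ⟨y, h, rfl⟩
  exact h

theorem exists_isSec_of_lineMap (hq : IsCoveringMap q) {S : Set K.space} {x : X} (hx : q x ∈ S)
    (h : ∀ y ∈ S, ∀ t : I, AffineMap.lineMap (q x : E) (y : E) (t : ℝ) ∈ K.space) :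
    ∃ τ, IsSec q S τ ∧ τ (q x) = x := by
  refine exists_isSec hq hx ⟨fun z => ⟨_, h z.2 z.2.2 z.1⟩, ?_⟩ (fun y => ?_) (fun y => ?_)
    (fun t => ?_) rfl
  · refine Continuous.subtype_mk ?_ _
    simp only [AffineMap.lineMap_apply_module]
    fun_prop
  all_goals exact Subtype.ext (by simp)

theorem exists_isSec_cell (hq : IsCoveringMap q) {s : Finset E} (hs : s ∈ K.faces) {x : X}
    (hx : q x ∈ cell K s) : ∃ τ, IsSec q (cell K s) τ ∧ τ (q x) = x :=
  exists_isSec_of_lineMap hq hx fun _ hy t => lineMap_mem_space hs hx hy t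

theorem exists_isSec_star (hq : IsCoveringMap q) {a : E} (haK : {a} ∈ K.faces) {x : X}
    (hx : (q x : E) = a) : ∃ τ, IsSec q (star hK a) τ ∧ τ (q x) = x := by
  refine exists_isSec_of_lineMap hq ?_ fun y hy t => ?_
  · have h : q x = ⟨a, hx ▸ (q x).2⟩ := Subtype.ext hx
    exact h ▸ center_mem_star haK _
  · obtain ⟨s, hs, hys, h⟩ := exists_carrier_cell (hK := hK) y
    refine lineMap_mem_space hs ?_ hys t
    rw [hx]
    exact subset_convexHull ℝ _ ((h a).2 hy)

/-- The vertex over `v` of a lift through `x` of a simplex that contains `v`. -/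
def vert (q : X → K.space) (x : X) (v : E) : X :=
  if h : ∃ w, ∃ s ∈ K.faces, v ∈ s ∧ q x ∈ cell K s ∧ ∃ τ, IsSec q (cell K s) τ ∧ τ (q x) = x ∧
    ∃ hv : v ∈ K.space, τ ⟨v, hv⟩ = w then h.choose else x

theorem IsSec.vert_eq (hq : IsCoveringMap q) {s : Finset E} (hs : s ∈ K.faces) {τ : K.space → X}
    (h : IsSec q (cell K s) τ) {y : K.space} (hy : y ∈ cell K s) {v : E} (hv : v ∈ s)
    (hvK : v ∈ K.space) : vert q (τ y) v = τ ⟨v, hvK⟩ := by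
  have hex : ∃ w, ∃ s ∈ K.faces, v ∈ s ∧ q (τ y) ∈ cell K s ∧ ∃ τ', IsSec q (cell K s) τ' ∧
      τ' (q (τ y)) = τ y ∧ ∃ hv : v ∈ K.space, τ' ⟨v, hv⟩ = w :=
    ⟨τ ⟨v, hvK⟩, s, hs, hv, by rwa [h.inv y hy], τ, h, by rw [h.inv y hy], hvK, rfl⟩
  rw [vert, dif_pos hex]
  obtain ⟨s', hs', hv', hy', τ', h', he, hvK', hw⟩ := hex.choose_spec
  rw [← hw]
  rw [h.inv y hy] at hy' he
  exact h'.eq_of_eq hq h (isPreconnected_cell_inter hs) inter_subset_right inter_subset_left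
    ⟨hy, hy'⟩ ⟨vertex_mem_cell hv hvK', vertex_mem_cell hv' hvK'⟩ he

theorem IsSec.vert_congr (hq : IsCoveringMap q) {s : Finset E} (hs : s ∈ K.faces)
    {τ : K.space → X} (h : IsSec q (cell K s) τ) {y z : K.space} (hy : y ∈ cell K s)
    (hz : z ∈ cell K s) {v : E} (hv : v ∈ s) : vert q (τ y) v = vert q (τ z) v := by
  rw [h.vert_eq hq hs hy hv (vertex_mem_space hs hv),
    h.vert_eq hq hs hz hv (vertex_mem_space hs hv)]

theorem apply_vert (hq : IsCoveringMap q) {x : X} {a : E} (ha : 0 < bary hK (q x) a) :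
    (q (vert q x a) : E) = a := by
  obtain ⟨s, hs, hx, h⟩ := exists_carrier_cell (hK := hK) (q x)
  obtain ⟨τ, hτ, he⟩ := exists_isSec_cell hq hs hx
  have has := (h a).2 ha
  rw [← he, hτ.vert_eq hq hs hx has (vertex_mem_space hs has),
    hτ.inv _ (vertex_mem_cell has _)]

theorem vert_self (hq : IsCoveringMap q) {x : X} {a : E} (haK : {a} ∈ K.faces)
    (hx : (q x : E) = a) : vert q x a = x := by
  have hxc : q x ∈ cell K {a} := by simp [cell, hx]
  obtain ⟨τ, hτ, he⟩ := exists_isSec_cell hq haK hxc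
  have hK' : a ∈ K.space := hx ▸ (q x).2
  have hqx : q x = ⟨a, hK'⟩ := Subtype.ext hx
  conv_lhs => rw [← he]
  rw [hτ.vert_eq hq haK hxc (by simp) hK', ← hqx, he]

theorem vert_vert (hq : IsCoveringMap q) {x : X} {a b : E} (ha : 0 < bary hK (q x) a)
    (hb : 0 < bary hK (q x) b) : vert q (vert q x a) b = vert q x b := by
  obtain ⟨s, hs, hx, h⟩ := exists_carrier_cell (hK := hK) (q x)
  obtain ⟨τ, hτ, he⟩ := exists_isSec_cell hq hs hx
  have has := (h a).2 ha
  rw [← he, hτ.vert_eq hq hs hx has (vertex_mem_space hs has)]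
  exact hτ.vert_congr hq hs (vertex_mem_cell has _) hx ((h b).2 hb)

/-- Sections over a simplex and over a star of one of its vertices agree if they agree there. -/
theorem IsSec.eq_star (hq : IsCoveringMap q) {s : Finset E} (hs : s ∈ K.faces) {τ : K.space → X}
    (hτ : IsSec q (cell K s) τ) {a : E} {g : K.space → X} (hg : IsSec q (star hK a) g)
    (haS : a ∈ K.space) (has : a ∈ s) {y : K.space} (hyc : y ∈ cell K s)
    (hy : y ∈ star hK a) : τ y = g y ↔ τ ⟨a, haS⟩ = g ⟨a, haS⟩ := by
  have hac : ⟨a, haS⟩ ∈ cell K s := vertex_mem_cell has haS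
  have hseg : segment ℝ a (y : E) ⊆ convexHull ℝ (s : Set E) :=
    (convex_convexHull ℝ _).segment_subset hac hyc
  have hA : IsPreconnected {z : K.space | (z : E) ∈ segment ℝ a (y : E)} := by
    refine isPreconnected_of_convex (convex_segment a (y : E)) ?_
    ext z
    refine ⟨?_, fun hz => ⟨⟨z, K.convexHull_subset_space hs (hseg hz)⟩, hz, rfl⟩⟩
    rintro ⟨z, h, rfl⟩
    exact h
  have hAst : {z : K.space | (z : E) ∈ segment ℝ a (y : E)} ⊆ star hK a := by
    intro z hz
    rw [mem_ofPred_eq, segment_eq_image_lineMap] at hz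
    obtain ⟨t, ht, hz⟩ := hz
    have := bary_lineMap (hK := hK) hs (y := ⟨a, haS⟩) hac hyc ⟨t, ht⟩ hz.symm a
    rw [star, mem_ofPred_eq, this]
    have h1 : 0 < bary hK ⟨a, haS⟩ a := center_mem_star (singleton_mem_faces hs has) haS
    have h2 : 0 < bary hK y a := hy
    rcases ht.1.eq_or_lt with rfl | h0
    · simpa using h1
    · have : 0 ≤ 1 - t := by linarith [ht.2]
      have : 0 < t * bary hK y a := mul_pos h0 h2
      simp only
      positivity
  have ha : (⟨a, haS⟩ : K.space) ∈ {z : K.space | (z : E) ∈ segment ℝ a (y : E)} :=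
    left_mem_segment ℝ a (y : E)
  have hy : y ∈ {z : K.space | (z : E) ∈ segment ℝ a (y : E)} := right_mem_segment ℝ a (y : E)
  exact ⟨hτ.eq_of_eq hq hg hA (fun z hz => hseg hz) hAst hy ha,
    hτ.eq_of_eq hq hg hA (fun z hz => hseg hz) hAst ha hy⟩

theorem IsSec.apply_of_vert (hq : IsCoveringMap q) {a : E} {g : K.space → X}
    (hg : IsSec q (star hK a) g) (haS : a ∈ K.space) {x : X} (hx : q x ∈ star hK a)
    (h : g ⟨a, haS⟩ = vert q x a) : g (q x) = x := by
  obtain ⟨s, hs, hxc, hsx⟩ := exists_carrier_cell (hK := hK) (q x)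
  obtain ⟨τ, hτ, he⟩ := exists_isSec_cell hq hs hxc
  have has := (hsx a).2 hx
  rw [← (hτ.eq_star hq hs hg haS has hxc hx).2 ?_, he]
  rw [h, ← hτ.vert_eq hq hs hxc has haS, he]

/-- On a star, the vertices of a section are those seen from the centre. -/
theorem IsSec.vert_star (hq : IsCoveringMap q) {a : E} {g : K.space → X}
    (hg : IsSec q (star hK a) g) (haS : a ∈ K.space) {y : K.space} (hy : y ∈ star hK a) {v : E}
    (hv : 0 < bary hK y v) : vert q (g y) v = vert q (g ⟨a, haS⟩) v := by
  obtain ⟨s, hs, hyc, h⟩ := exists_carrier_cell (hK := hK) y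
  have has := (h a).2 hy
  obtain ⟨τ, hτ, he⟩ := exists_isSec_cell hq hs (x := g y) (by rwa [hg.inv _ hy])
  rw [hg.inv _ hy] at he
  rw [← he, ← (hτ.eq_star hq hs hg haS has hyc hy).1 he]
  exact hτ.vert_congr hq hs hyc (vertex_mem_cell has haS) ((h v).2 hv)

theorem vert_eventually_eq (hq : IsCoveringMap q) {x : X} {a : E} (hx : q x ∈ star hK a) :
    ∀ᶠ y in 𝓝 x, q y ∈ star hK a ∧ vert q y a = vert q x a := by
  have hw := apply_vert hq hx
  have haS : a ∈ K.space := hw ▸ (q (vert q x a)).2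
  have hqw : q (vert q x a) = ⟨a, haS⟩ := Subtype.ext hw
  obtain ⟨s, hs, -, h⟩ := exists_carrier_cell (hK := hK) (q x)
  obtain ⟨g, hg, he⟩ := exists_isSec_star (hK := hK) hq (singleton_mem_faces hs ((h a).2 hx)) hw
  rw [hqw] at he
  filter_upwards [hg.eventually_eq hq (isOpen_star a) hx (hg.apply_of_vert hq haS hx he)]
    with y ⟨hy, hgy⟩
  refine ⟨hy, ?_⟩
  rw [← hgy, hg.vert_star hq haS hy hy, he, vert_vert hq hx hx]

/-- The fibres over the vertices of a connected covering space are countable. -/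
theorem exists_countable_vert (hq : IsCoveringMap q) [PreconnectedSpace X] [Nonempty X] :
    ∃ W : Set X, W.Countable ∧ ∀ x a, q x ∈ star hK a → vert q x a ∈ W := by
  obtain ⟨x₀⟩ := ‹Nonempty X›
  let F : List (verts hK) → X := fun L => L.foldr (fun v x => vert q x v) x₀
  let A : Set X := {x | ∃ a, q x ∈ star hK a ∧ vert q x a ∈ range F}
  have hmem : ∀ {x a}, q x ∈ star hK a → a ∈ verts hK := fun {x a} hx => by
    obtain ⟨s, hs, -, h⟩ := exists_carrier_cell (hK := hK) (q x)
    exact subset_verts hK hs ((h a).2 hx)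
  have hstep : ∀ {x a b}, q x ∈ star hK a → q x ∈ star hK b → vert q x a ∈ range F →
      vert q x b ∈ range F := by
    rintro x a b ha hb ⟨L, hL⟩
    refine ⟨⟨b, hmem hb⟩ :: L, ?_⟩
    rw [← vert_vert hq ha hb, ← hL]
    rfl
  have hex : ∀ x, ∃ a, q x ∈ star hK a := fun x => by
    obtain ⟨s, hs, -, h⟩ := exists_carrier_cell (hK := hK) (q x)
    obtain ⟨a, ha⟩ := K.nonempty_of_mem_faces hs
    exact ⟨a, (h a).1 ha⟩
  have hA : IsClopen A := by
    refine ⟨⟨isOpen_iff_mem_nhds.2 fun x hx => ?_⟩, isOpen_iff_mem_nhds.2 ?_⟩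
    · obtain ⟨a, ha⟩ := hex x
      filter_upwards [vert_eventually_eq hq ha] with y ⟨hy, hya⟩
      rintro ⟨b, hb, hbF⟩
      exact hx ⟨a, ha, hya ▸ hstep hb hy hbF⟩
    · rintro x ⟨a, ha, haF⟩
      filter_upwards [vert_eventually_eq hq ha] with y ⟨hy, hya⟩
      exact ⟨a, hy, hya ▸ haF⟩
  have huniv : A = univ := hA.eq_univ (by
    obtain ⟨a, ha⟩ := hex x₀
    exact ⟨x₀, a, ha, [⟨a, hmem ha⟩], rfl⟩)
  refine ⟨range F, countable_range F, fun x b hb => ?_⟩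
  obtain ⟨a, ha, haF⟩ : x ∈ A := huniv ▸ mem_univ x
  exact hstep ha hb haF

/-- The affine extension to all simplices of a function on the vertices. -/
def affineExt (hK : K.faces.Finite) (q : X → K.space) (h : X → ℝ) (x : X) : ℝ :=
  ∑ v ∈ verts hK, bary hK (q x) v * h (vert q x v)

theorem IsSec.affineExt_eq (hq : IsCoveringMap q) (h : X → ℝ) {s : Finset E} (hs : s ∈ K.faces)
    {τ : K.space → X} (hτ : IsSec q (cell K s) τ) {y : K.space} (hy : y ∈ cell K s) :
    affineExt hK q h (τ y) =
      ∑ v ∈ s, bary hK y v * if hv : v ∈ K.space then h (τ ⟨v, hv⟩) else 0 := by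
  rw [affineExt, hτ.inv y hy, sum_verts_eq hs fun v hv => by rw [bary_eq_zero hs hy hv, zero_mul]]
  refine Finset.sum_congr rfl fun v hv => ?_
  rw [dif_pos (vertex_mem_space hs hv), hτ.vert_eq hq hs hy hv]

theorem IsSec.affineExt_star (hq : IsCoveringMap q) (h : X → ℝ) {a : E} {g : K.space → X}
    (hg : IsSec q (star hK a) g) (haS : a ∈ K.space) {y : K.space} (hy : y ∈ star hK a) :
    affineExt hK q h (g y) = ∑ v ∈ verts hK, bary hK y v * h (vert q (g ⟨a, haS⟩) v) := by
  rw [affineExt, hg.inv y hy]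
  refine Finset.sum_congr rfl fun v hv => ?_
  rcases (bary_nonneg (hK := hK) y v).eq_or_lt with h0 | h0
  · rw [← h0, zero_mul, zero_mul]
  · rw [hg.vert_star hq haS hy h0]

end Lifts

/-! ### The height function of an acyclic direction -/

theorem exists_strictMono_of_acyclic {α : Type*} [Countable α] {r : α → α → Prop}
    (h : ∀ x, ¬ Relation.TransGen r x x) : ∃ f : α → ℝ, ∀ x y, r x y → f x < f y := by
  let _ : PartialOrder α :=
    { le := Relation.ReflTransGen r
      le_refl := fun _ => .refl
      le_trans := fun _ _ _ => .trans
      le_antisymm := fun x y hxy hyx => by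
        rcases Relation.reflTransGen_iff_eq_or_transGen.1 hxy with he | ht
        · exact he.symm
        · exact absurd (ht.trans_left hyx) (h x) }
  have : Countable (LinearExtension α) := ‹Countable α›
  obtain ⟨e⟩ := Order.embedding_from_countable_to_dense (LinearExtension α) ℚ
  refine ⟨fun x => (e (toLinearExtension x) : ℝ), fun x y hxy => ?_⟩
  have hle : x ≤ y := Relation.ReflTransGen.single hxy
  have h1 := (e.monotone (toLinearExtension.monotone hle))
  refine lt_of_le_of_ne (Rat.cast_le.2 h1) fun he => ?_
  have h2 : x = y := e.injective (Rat.cast_injective he)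
  exact h x (.single (h2 ▸ hxy))

section Directed

variable {M : Type*} [TopologicalSpace M] {E : Type*} [NormedAddCommGroup E] [NormedSpace ℝ E]
  {T : Triangulation M E} {D : Direction T.K} {X : Type*} [TopologicalSpace X] {p : X → M}

/-- `x` and `y` are the endpoints of a lift of a directed edge. -/
def LiftedEdge (D : Direction T.K) (p : X → M) (x y : X) : Prop :=
  ∃ (a b : E) (h : D.out a b) (γ : Path x y),
    ∀ t, p (γ t) = T.edgePath (D.isEdge_of_out a b h) t

theorem isDirectedPath_of_eq {a b : E} (h : D.out a b) {x y : M} (δ : Path x y)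
    (hδ : ∀ t, δ t = T.edgePath (D.isEdge_of_out a b h) t) : IsDirectedPath T D δ := by
  obtain rfl : x = T.pt a (D.isEdge_of_out a b h).left_mem := by simpa using hδ 0
  obtain rfl : y = T.pt b (D.isEdge_of_out a b h).right_mem := by simpa using hδ 1
  obtain rfl : δ = T.edgePath (D.isEdge_of_out a b h) := Path.ext (funext hδ)
  exact .edge h

theorem exists_isDirectedPath (hp : Continuous p) {x y : X}
    (h : Relation.TransGen (LiftedEdge D p) x y) :
    ∃ γ : Path x y, IsDirectedPath T D (γ.map hp) := by
  induction h with
  | single h =>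
    obtain ⟨a, b, h, γ, hγ⟩ := h
    exact ⟨γ, isDirectedPath_of_eq h _ hγ⟩
  | tail _ h ih =>
    obtain ⟨δ, hδ⟩ := ih
    obtain ⟨a, b, h, γ, hγ⟩ := h
    refine ⟨δ.trans γ, ?_⟩
    rw [Path.map_trans]
    exact hδ.trans (isDirectedPath_of_eq h _ hγ)

theorem not_transGen_liftedEdge [SimplyConnectedSpace X] (hess : DirectedLoopsEssential T D)
    (hp : Continuous p) (x : X) : ¬ Relation.TransGen (LiftedEdge D p) x x := by
  intro h
  obtain ⟨γ, hγ⟩ := exists_isDirectedPath hp h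
  refine hess _ _ hγ ?_
  exact (SimplyConnectedSpace.paths_homotopic γ (Path.refl x)).map ⟨p, hp⟩

theorem exists_height [SimplyConnectedSpace X] (hess : DirectedLoopsEssential T D)
    (hp : IsCoveringMap p) : ∃ h : X → ℝ, ∀ x y, LiftedEdge D p x y → h x < h y := by
  have hq : IsCoveringMap (T.homeo.symm ∘ p) := hp.homeomorph_comp _
  obtain ⟨W, hW, hmem⟩ := exists_countable_vert (hK := T.finite) hq
  have := hW.to_subtype
  obtain ⟨f, hf⟩ := exists_strictMono_of_acyclic (α := W)
    (r := fun x y => LiftedEdge D p x y) fun x hx =>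
      not_transGen_liftedEdge hess hp.continuous x.1 (hx.lift Subtype.val fun _ _ => id)
  have hv : ∀ {x a} (ha : a ∈ T.K.space), {a} ∈ T.K.faces → p x = T.pt a ha → x ∈ W := by
    intro x a ha haK hx
    have hqx : (T.homeo.symm ∘ p) x = ⟨a, ha⟩ := by simp [hx, Triangulation.pt]
    rw [← vert_self hq haK (congrArg Subtype.val hqx)]
    exact hmem x a (hqx ▸ center_mem_star haK ha)
  refine ⟨fun x => if hx : x ∈ W then f ⟨x, hx⟩ else 0, fun x y hxy => ?_⟩
  have ⟨a, b, h, γ, hγ⟩ := hxy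
  have he := D.isEdge_of_out a b h
  have hx : x ∈ W := hv he.left_mem (singleton_mem_faces he.2 (by simp)) (by simpa using hγ 0)
  have hy : y ∈ W := hv he.right_mem (singleton_mem_faces he.2 (by simp)) (by simpa using hγ 1)
  simp only [dif_pos hx, dif_pos hy]
  exact hf ⟨x, hx⟩ ⟨y, hy⟩ hxy

end Directed

/-! ### Charts on open stars -/

section StarChart

variable {E : Type*} [NormedAddCommGroup E] [NormedSpace ℝ E]
  {K : Geometry.SimplicialComplex ℝ E} {hK : K.faces.Finite} {a : E}

theorem continuous_scale {V : Type*} {S : Set (V → ℝ)} (c : V → ℝ) :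
    Continuous fun (x : S) v => c v * x.1 v :=
  continuous_pi fun v => continuous_const.mul ((continuous_apply v).comp continuous_subtype_val)

/-- Rescaling the coordinates of a cone. -/
def scaleHomeo {V : Type*} (F : Set (Finset V)) (c : V → ℝ) (hc : ∀ v, 0 < c v) :
    cone F ≃ₜ cone F where
  toFun x := ⟨fun v => c v * x.1 v, fun v => mul_nonneg (hc v).le (x.2.1 v), by
    obtain ⟨s, hs, h⟩ := x.2.2
    exact ⟨s, hs, fun v hv => by simp [h v hv]⟩⟩
  invFun x := ⟨fun v => (c v)⁻¹ * x.1 v, fun v => mul_nonneg (inv_pos.2 (hc v)).le (x.2.1 v), by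
    obtain ⟨s, hs, h⟩ := x.2.2
    exact ⟨s, hs, fun v hv => by simp [h v hv]⟩⟩
  left_inv x := Subtype.ext (funext fun v => inv_mul_cancel_left₀ (hc v).ne' _)
  right_inv x := Subtype.ext (funext fun v => mul_inv_cancel_left₀ (hc v).ne' _)
  continuous_toFun := Continuous.subtype_mk (continuous_scale c) _
  continuous_invFun := Continuous.subtype_mk (continuous_scale fun v => (c v)⁻¹) _

theorem sum_update {V : Type*} {A : Finset V} {a : V}
    (ha : a ∈ A) (x : V → ℝ) (r : ℝ) :
    ∑ v ∈ A, Function.update x a r v = ∑ v ∈ A, x v - x a + r := by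
  rw [Finset.sum_update_of_mem ha, ← Finset.sum_erase_add _ _ ha, Finset.sdiff_singleton_eq_erase]
  ring

/-- An open star is an open cone over the link. -/
def starHomeo (hK : K.faces.Finite) (haK : {a} ∈ K.faces) :
    star hK a ≃ₜ {x : cone (link K.faces a) | ∑ v ∈ verts hK, x.1 v < 1} where
  toFun y := ⟨⟨Function.update (bary hK y) a 0,
      update_mem_cone_link (bary_mem_weights y.1).1 (ne_of_gt y.2)⟩, by
    have := sum_update ((mem_verts hK).2 haK) (bary hK y) 0
    have hy : 0 < bary hK y a := y.2
    rw [sum_bary] at this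
    rw [mem_ofPred_eq, this]
    linarith⟩
  invFun x := ⟨weightsHomeo hK ⟨Function.update x.1.1 a (1 - ∑ v ∈ verts hK, x.1.1 v),
      update_mem_cone x.1.2 (sub_pos.2 x.2).le, by
        rw [sum_update ((mem_verts hK).2 haK), apply_eq_zero_of_mem_cone_link x.1.2]
        ring⟩, by
    have hx : ∑ v ∈ verts hK, x.1.1 v < 1 := x.2
    simpa [star, bary] using hx⟩
  left_inv y := by
    refine Subtype.ext ((weightsHomeo hK).symm.injective ?_)
    rw [Homeomorph.symm_apply_apply]
    refine Subtype.ext ?_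
    simp only [sum_update ((mem_verts hK).2 haK), sum_bary]
    simp [bary]
  right_inv x := by
    refine Subtype.ext (Subtype.ext ?_)
    have h := apply_eq_zero_of_mem_cone_link x.1.2
    simp only [bary, Homeomorph.symm_apply_apply, Function.update_idem]
    rw [← h, Function.update_eq_self]
  continuous_toFun := by
    refine Continuous.subtype_mk (Continuous.subtype_mk ?_ _) _
    exact (continuous_bary.comp continuous_subtype_val).update a continuous_const
  continuous_invFun := by
    refine Continuous.subtype_mk ((weightsHomeo hK).continuous.comp
      (Continuous.subtype_mk (Continuous.update ?_ a ?_) _)) _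
    · fun_prop
    · refine continuous_const.sub (continuous_finsetSum _ fun v _ => ?_)
      exact (continuous_apply v).comp (by fun_prop)

theorem exists_star_chart (haK : {a} ∈ K.faces) {P : Finset E}
    (hm : IsModel ((PUnit.{1} × ℝ) × ℝ) (link K.faces a) (verts hK) P) {H : E → ℝ}
    (hpos : ∀ v ∈ linkVerts hK a, v ∈ P → H a < H v)
    (hneg : ∀ v ∈ linkVerts hK a, v ∉ P → H v < H a) :
    ∃ Φ : OpenPartialHomeomorph K.space (EuclideanSpace ℝ (Fin 2) × ℝ), Φ.source = star hK a ∧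
      ∀ y ∈ star hK a, (Φ y).2 = ∑ v ∈ verts hK, bary hK y v * H v := by
  obtain ⟨κ, hκ⟩ := hm
  let c : E → ℝ := fun v => if v ∈ linkVerts hK a then |H v - H a| else 1
  have hc : ∀ v, 0 < c v := fun v => by
    by_cases hv : v ∈ linkVerts hK a
    · simp only [c, if_pos hv, abs_pos, sub_ne_zero]
      by_cases hP : v ∈ P
      · exact (hpos v hv hP).ne'
      · exact (hneg v hv hP).ne
    · simp [c, hv]
  let e₁ : (PUnit.{1} × ℝ) × ℝ ≃ₜ EuclideanSpace ℝ (Fin 2) :=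
    ((Homeomorph.punitProd ℝ).prodCongr (Homeomorph.refl ℝ)).trans
      (Homeomorph.finTwoArrow.symm.trans (PiLp.homeomorph 2 _).symm)
  let e : cone (link K.faces a) ≃ₜ EuclideanSpace ℝ (Fin 2) × ℝ :=
    (scaleHomeo _ c hc).trans (κ.trans (e₁.prodCongr (Homeomorph.addRight (H a))))
  have hopen : IsOpen {x : cone (link K.faces a) | ∑ v ∈ verts hK, x.1 v < 1} :=
    isOpen_lt (continuous_finsetSum _ fun v _ => (continuous_apply v).comp
      continuous_subtype_val) continuous_const
  have hemb : IsOpenEmbedding fun y => e (starHomeo hK haK y).1 :=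
    e.isOpenEmbedding.comp (hopen.isOpenEmbedding_subtypeVal.comp
      (starHomeo hK haK).isOpenEmbedding)
  have hne : Nonempty (star hK a) := ⟨⟨_, center_mem_star haK (vertex_mem_space haK (by simp))⟩⟩
  let ι := (isOpen_star (hK := hK) a).isOpenEmbedding_subtypeVal.toOpenPartialHomeomorph
  refine ⟨ι.symm.trans hemb.toOpenPartialHomeomorph, ?_, fun y hy => ?_⟩
  · simp [ι]
  · have h1 : ι.symm y = ⟨y, hy⟩ := ι.left_inv (x := ⟨y, hy⟩) (by simp [ι])
    have h2 : ((ι.symm.trans hemb.toOpenPartialHomeomorph) y).2 =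
        height (verts hK) P (fun v => c v * Function.update (bary hK y) a 0 v) + H a := by
      rw [OpenPartialHomeomorph.trans_apply, h1]
      exact congrArg (· + H a) (hκ (scaleHomeo _ c hc (starHomeo hK haK ⟨y, hy⟩).1))
    have h3 : H a = ∑ v ∈ verts hK, bary hK y v * H a := by
      rw [← Finset.sum_mul, sum_bary, one_mul]
    rw [h2, height, h3, ← Finset.sum_add_distrib]
    refine Finset.sum_congr rfl fun v _ => ?_
    by_cases hva : v = a
    · subst hva
      simp
    rw [Function.update_of_ne hva]
    by_cases hv : v ∈ linkVerts hK a
    · simp only [c, if_pos hv, sgn]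
      by_cases hP : v ∈ P
      · rw [if_pos hP, abs_of_pos (sub_pos.2 (hpos v hv hP))]
        ring
      · rw [if_neg hP, abs_of_neg (sub_neg.2 (hneg v hv hP))]
        ring
    · have : bary hK y v = 0 := by
        by_contra h0
        have h0 := (bary_nonneg y v).lt_of_ne' h0
        obtain ⟨s, hs, -, h⟩ := exists_carrier_cell (hK := hK) y
        refine hv (mem_linkVerts.2 ⟨by simpa using Ne.symm hva, K.down_closed hs ?_ (by simp)⟩)
        rw [Finset.insert_subset_iff, Finset.singleton_subset_iff, h, h]
        exact ⟨hy, h0⟩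
      simp [this]

end StarChart

/-! ### Affine functions on lifted simplices -/

section Affine

variable {E : Type*} [NormedAddCommGroup E] [NormedSpace ℝ E]

theorem exists_affineMap_eq {s : Finset E} (hs : AffineIndependent ℝ ((↑) : s → E)) (c : E → ℝ) :
    ∃ l : E →ᵃ[ℝ] ℝ, ∀ v ∈ s, l v = c v := by
  obtain ⟨t, hst, ht, htop⟩ := exists_subset_affineIndependent_affineSpan_eq_top
    (s := (s : Set E)) hs
  let b : AffineBasis t ℝ E := ⟨(↑), ht, by simpa using htop⟩
  refine ⟨∑ v ∈ s.attach, c v • b.coord ⟨v, hst v.2⟩, fun v hv => ?_⟩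
  have hb : ∀ w : s, b.coord ⟨w, hst w.2⟩ v = if w = ⟨v, hv⟩ then 1 else 0 := fun w => by
    have := b.coord_apply ⟨w, hst w.2⟩ ⟨v, hst hv⟩
    simp only [Subtype.ext_iff] at this ⊢
    exact this
  have hsum : ∀ S : Finset s, (∑ v ∈ S, c v • b.coord ⟨v, hst v.2⟩) v =
      ∑ w ∈ S, c w * b.coord ⟨w, hst w.2⟩ v := fun S => by
    induction S using Finset.induction_on with
    | empty => simp
    | insert w S hw ih => rw [Finset.sum_insert hw, Finset.sum_insert hw, ← ih]; rfl
  rw [hsum]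
  simp [hb]

theorem affineMap_sum {s : Finset E} (l : E →ᵃ[ℝ] ℝ) {w : E → ℝ} (hw : ∑ v ∈ s, w v = 1) :
    l (∑ v ∈ s, w v • v) = ∑ v ∈ s, w v * l v := by
  have h : ∀ x, l x = l.linear x + l 0 := fun x => by
    simpa using l.map_vadd 0 x
  have h' : ∑ v ∈ s, w v * l v = ∑ v ∈ s, (w v * l.linear v + w v * l 0) :=
    Finset.sum_congr rfl fun v _ => by rw [h v, mul_add]
  rw [h, h', map_sum, Finset.sum_add_distrib, ← Finset.sum_mul, hw, one_mul]
  simp only [map_smul, smul_eq_mul]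

variable {K : Geometry.SimplicialComplex ℝ E} {hK : K.faces.Finite}
  {X : Type*} [TopologicalSpace X] {q : X → K.space}

theorem IsSec.exists_affineMap (hq : IsCoveringMap q) (h : X → ℝ) {s : Finset E}
    (hs : s ∈ K.faces) {τ : K.space → X} (hτ : IsSec q (cell K s) τ) :
    ∃ l : E →ᵃ[ℝ] ℝ, (∀ v ∈ s, ∀ hv : v ∈ K.space, l v = h (τ ⟨v, hv⟩)) ∧
      ∀ y ∈ cell K s, affineExt hK q h (τ y) = l y := by
  obtain ⟨l, hl⟩ := exists_affineMap_eq (K.indep hs)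
    fun v => if hv : v ∈ K.space then h (τ ⟨v, hv⟩) else 0
  refine ⟨l, fun v hv hvK => (hl v hv).trans (dif_pos hvK), fun y hy => ?_⟩
  rw [hτ.affineExt_eq hq h hs hy]
  have h0 : ∀ v ∉ s, bary hK y v = 0 := fun v hv => bary_eq_zero hs hy hv
  have h1 : ∑ v ∈ s, bary hK y v = 1 := by rw [← sum_verts_eq (hK := hK) hs h0, sum_bary]
  have h2 : ∑ v ∈ s, bary hK y v • v = y := by
    rw [← sum_verts_eq (hK := hK) hs fun v hv => by rw [h0 v hv, zero_smul], sum_bary_smul]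
  rw [← h2, affineMap_sum l h1]
  exact Finset.sum_congr rfl fun v hv => by rw [hl v hv]

end Affine

/-! ### The foliation by level sets -/

section LevelFoliation

variable {X : Type*} [TopologicalSpace X] {f : X → ℝ}

/-- The foliation whose charts have vertical coordinate `f`. -/
def levelFoliation (f : X → ℝ)
    (hf : ∀ x, ∃ φ : OpenPartialHomeomorph X (EuclideanSpace ℝ (Fin 2) × ℝ),
      (∀ y ∈ φ.source, (φ y).2 = f y) ∧ x ∈ φ.source) : MeasuredFoliation X where
  atlas := {φ | ∀ y ∈ φ.source, (φ y).2 = f y}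
  exists_chart := hf
  translation φ hφ ψ hψ x hx := ⟨0, by
    filter_upwards [φ.open_source.mem_nhds hx.1, ψ.open_source.mem_nhds hx.2] with y h1 h2
    rw [hφ y h1, hψ y h2, add_zero]⟩

variable (hf : ∀ x, ∃ φ : OpenPartialHomeomorph X (EuclideanSpace ℝ (Fin 2) × ℝ),
      (∀ y ∈ φ.source, (φ y).2 = f y) ∧ x ∈ φ.source)

theorem isTangent_levelFoliation {γ : C(I, X)} :
    (levelFoliation f hf).IsTangent γ ↔ ∀ t, f (γ t) = f (γ 0) := by
  refine ⟨fun h t => ?_, fun h φ hφ t ht => ?_⟩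
  · have hc : IsLocallyConstant fun t => f (γ t) := by
      rw [IsLocallyConstant.iff_eventually_eq]
      intro t
      obtain ⟨φ, hφ, ht⟩ := hf (γ t)
      filter_upwards [h φ hφ t ht,
        γ.continuous.continuousAt.preimage_mem_nhds (φ.open_source.mem_nhds ht)] with r hr hs
      rwa [hφ _ ht, hφ _ hs] at hr
    exact hc.apply_eq_of_preconnectedSpace t 0
  · filter_upwards [γ.continuous.continuousAt.preimage_mem_nhds (φ.open_source.mem_nhds ht)]
      with r hr
    rw [hφ _ hr, hφ _ ht, h r, h t]

theorem leaf_levelFoliation (x : X) :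
    (levelFoliation f hf).leaf x = pathComponentIn {y | f y = f x} x := by
  ext y
  refine ⟨?_, fun ⟨γ, hγ⟩ => ⟨γ, (isTangent_levelFoliation hf).2 fun t => ?_, γ.source, γ.target⟩⟩
  · rintro ⟨γ, hγ, rfl, rfl⟩
    exact ⟨⟨γ, rfl, rfl⟩, (isTangent_levelFoliation hf).1 hγ⟩
  · exact (hγ t).trans (hγ 0).symm

theorem isPositivelyTransverse_levelFoliation {γ : C(I, X)}
    (h : StrictMono fun t => f (γ t)) : (levelFoliation f hf).IsPositivelyTransverse γ := by
  intro φ hφ t ht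
  refine ⟨_, γ.continuous.continuousAt.preimage_mem_nhds (φ.open_source.mem_nhds ht),
    fun r hr r' hr' hlt => ?_⟩
  simp only [hφ _ hr, hφ _ hr']
  exact h hlt

/-- In a convex set on which the level function is affine, the components of the leaves are the
level sets. -/
theorem pathComponentIn_leaf {E : Type*} [NormedAddCommGroup E] [NormedSpace ℝ E] {C : Set E}
    (hC : Convex ℝ C) (τ : C(C, X)) {l : E →ᵃ[ℝ] ℝ} (hl : ∀ y, f (τ y) = l y) {x : X} {z : C}
    (hz : z ∈ τ ⁻¹' (levelFoliation f hf).leaf x) :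
    pathComponentIn (τ ⁻¹' (levelFoliation f hf).leaf x) z = {y : C | l (y : E) = l z} := by
  rw [leaf_levelFoliation] at hz ⊢
  have hsub : ∀ y : C, y ∈ τ ⁻¹' pathComponentIn {y | f y = f x} x → l (y : E) = f x := fun y hy => by
    rw [← hl]
    exact pathComponentIn_subset (F := {y | f y = f x}) hy
  ext y
  refine ⟨fun h => ?_, fun h => ?_⟩
  · exact (hsub y (pathComponentIn_subset h)).trans (hsub z hz).symm
  · have key : ∀ y : C, l (y : E) = l z → ∃ δ : Path z y, ∀ t, l (δ t : E) = l z := by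
      intro y hy
      refine ⟨⟨⟨fun t => ⟨_, hC.lineMap_mem z.2 y.2 t.2⟩, Continuous.subtype_mk
        (AffineMap.lineMap_continuous.comp continuous_subtype_val) _⟩, Subtype.ext (by simp),
        Subtype.ext (by simp)⟩, fun t => ?_⟩
      change l (AffineMap.lineMap (z : E) (y : E) (t : ℝ)) = l z
      rw [AffineMap.apply_lineMap, hy, AffineMap.lineMap_same]
      rfl
    obtain ⟨δ, hδ⟩ := key y h
    refine ⟨δ, fun t => ?_⟩
    obtain ⟨ε, hε⟩ := key (δ t) (hδ t)
    have hzx : JoinedIn {y | f y = f x} x (τ z) := hz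
    exact hzx.trans ⟨ε.map τ.continuous, fun r => (hl _).trans ((hε r).trans (hsub z hz))⟩

end LevelFoliation

/-! ### The height of the lifted vertices -/

section Height

variable {M : Type*} [TopologicalSpace M] {E : Type*} [NormedAddCommGroup E] [NormedSpace ℝ E]
  {T : Triangulation M E} {D : Direction T.K} {X : Type*} [TopologicalSpace X] {p : X → M}

theorem IsSec.liftedEdge {s : Finset E} (hs : s ∈ T.K.faces) {τ : T.K.space → X}
    (hτ : IsSec (T.homeo.symm ∘ p) (cell T.K s) τ) {a b : E} (ha : a ∈ s) (hb : b ∈ s)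
    (h : D.out a b) (haS : a ∈ T.K.space) (hbS : b ∈ T.K.space) :
    LiftedEdge D p (τ ⟨a, haS⟩) (τ ⟨b, hbS⟩) := by
  have hmem : ∀ t : I, AffineMap.lineMap a b (t : ℝ) ∈ convexHull ℝ (s : Set E) := fun t =>
    (convex_convexHull ℝ _).lineMap_mem (subset_convexHull ℝ _ ha) (subset_convexHull ℝ _ hb) t.2
  refine ⟨a, b, h, ⟨⟨fun t => τ ⟨_, T.K.convexHull_subset_space hs (hmem t)⟩, ?_⟩, ?_, ?_⟩,
    fun t => ?_⟩
  · exact hτ.cont.comp_continuous (Continuous.subtype_mk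
      (AffineMap.lineMap_continuous.comp continuous_subtype_val) _) hmem
  · simp
  · simp
  · have := hτ.inv ⟨_, T.K.convexHull_subset_space hs (hmem t)⟩ (hmem t)
    exact (T.homeo.symm_apply_eq.1 this)

theorem IsEdge.of_mem {K : Geometry.SimplicialComplex ℝ E} {s : Finset E} (hs : s ∈ K.faces)
    {a b : E} (ha : a ∈ s) (hb : b ∈ s) (hab : a ≠ b) : IsEdge K a b :=
  ⟨hab, K.down_closed hs (by simp [Finset.insert_subset_iff, ha, hb]) (by simp)⟩

theorem exists_chart (hD : D.IsLocalOrientation) (hp : IsCoveringMap p) {h : X → ℝ}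
    (hh : ∀ x y, LiftedEdge D p x y → h x < h y) (x : X) :
    ∃ φ : OpenPartialHomeomorph X (EuclideanSpace ℝ (Fin 2) × ℝ),
      (∀ y ∈ φ.source, (φ y).2 = affineExt T.finite (T.homeo.symm ∘ p) h y) ∧ x ∈ φ.source := by
  set q := T.homeo.symm ∘ p
  have hq : IsCoveringMap q := hp.homeomorph_comp _
  obtain ⟨s, hs, -, hsx⟩ := exists_carrier_cell (hK := T.finite) (q x)
  obtain ⟨a, ha⟩ := T.K.nonempty_of_mem_faces hs
  have hxa : q x ∈ star T.finite a := (hsx a).1 ha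
  have haK := singleton_mem_faces hs ha
  have haS := vertex_mem_space hs ha
  have hw : q (vert q x a) = ⟨a, haS⟩ := Subtype.ext (apply_vert hq hxa)
  obtain ⟨g, hg, hga⟩ := exists_isSec_star (hK := T.finite) hq haK (congrArg Subtype.val hw)
  rw [hw] at hga
  have hcomp : ∀ v ∈ linkVerts T.finite a, IsEdge T.K a v ∧
      (D.out a v → h (vert q (vert q x a) a) < h (vert q (vert q x a) v)) ∧
      (D.out v a → h (vert q (vert q x a) v) < h (vert q (vert q x a) a)) := by
    intro v hv
    have hav := mem_linkVerts.1 hv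
    have hac : ∀ hS, (⟨a, hS⟩ : T.K.space) ∈ cell T.K {a, v} := vertex_mem_cell (by simp)
    obtain ⟨τ, hτ, he⟩ := exists_isSec_cell hq hav.2 (x := vert q x a) (by
      rw [hw]
      exact hac haS)
    rw [hw] at he
    have hvS := vertex_mem_space hav.2 (v := v) (by simp)
    have h1 := hτ.vert_eq hq hav.2 (hac haS) (v := a) (by simp) haS
    have h2 := hτ.vert_eq hq hav.2 (hac haS) (v := v) (by simp) hvS
    rw [he] at h1 h2
    rw [h1, h2, ← he]
    exact ⟨.of_mem hav.2 (by simp) (by simp) fun hc => hav.1 (by simp [hc]),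
      fun ho => hh _ _ (hτ.liftedEdge hav.2 (by simp) (by simp) ho haS hvS),
      fun ho => hh _ _ (hτ.liftedEdge hav.2 (by simp) (by simp) ho hvS haS)⟩
  obtain ⟨Φ, hΦs, hΦ⟩ := exists_star_chart haK (T.isModel_link hD haK)
    (H := fun v => h (vert q (vert q x a) v))
    (fun v hv hP => (hcomp v hv).2.1 (Finset.mem_filter.1 hP).2)
    (fun v hv hP => (hcomp v hv).2.2 (by
      rcases D.out_xor a v (hcomp v hv).1 with ho | ho
      · exact absurd (Finset.mem_filter.2 ⟨hv, ho.1⟩) hP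
      · exact ho.1))
  let G : OpenPartialHomeomorph X T.K.space :=
    { toFun := q
      invFun := g
      source := {y | q y ∈ star T.finite a ∧ g (q y) = y}
      target := star T.finite a
      map_source' := fun y hy => hy.1
      map_target' := fun y hy => by
        rw [mem_ofPred_eq, hg.inv y hy]
        exact ⟨hy, rfl⟩
      left_inv' := fun y hy => hy.2
      right_inv' := fun y hy => hg.inv y hy
      open_source := isOpen_iff_mem_nhds.2 fun y hy => hg.eventually_eq hq (isOpen_star a) hy.1 hy.2
      open_target := isOpen_star a
      continuousOn_toFun := hq.continuous.continuousOn
      continuousOn_invFun := hg.cont }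
  have hGs : (G.trans Φ).source = G.source := by
    rw [OpenPartialHomeomorph.trans_source, hΦs, inter_eq_left]
    exact fun y hy => hy.1
  refine ⟨G.trans Φ, fun y hy => ?_, ?_⟩
  · rw [hGs] at hy
    rw [OpenPartialHomeomorph.trans_apply, ← hy.2, hg.affineExt_star hq h haS hy.1, hga]
    change (Φ (q (g (q y)))).2 = _
    rw [hg.inv _ hy.1]
    exact hΦ _ hy.1
  · rw [hGs]
    exact ⟨hxa, hg.apply_of_vert hq haS hxa hga⟩

theorem isTransverseTo_levelFoliation (hp : IsCoveringMap p) {h : X → ℝ}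
    (hh : ∀ x y, LiftedEdge D p x y → h x < h y)
    (hf : ∀ x, ∃ φ : OpenPartialHomeomorph X (EuclideanSpace ℝ (Fin 2) × ℝ),
      (∀ y ∈ φ.source, (φ y).2 = affineExt T.finite (T.homeo.symm ∘ p) h y) ∧ x ∈ φ.source) :
    (levelFoliation _ hf).IsTransverseTo T D p := by
  intro a b hab γ hγ
  have hq : IsCoveringMap (T.homeo.symm ∘ p) := hp.homeomorph_comp _
  have he := D.isEdge_of_out a b hab
  have hqγ : ∀ t, (T.homeo.symm ∘ p) (γ t) = ⟨_, he.lineMap_mem t⟩ := fun t => by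
    simp only [Function.comp_apply, hγ]
    exact T.homeo.symm_apply_apply _
  have hmem : ∀ t : I, AffineMap.lineMap a b (t : ℝ) ∈
      convexHull ℝ ((({a, b} : Finset E)) : Set E) := fun t =>
    (convex_convexHull ℝ _).lineMap_mem (subset_convexHull ℝ _ (by simp))
      (subset_convexHull ℝ _ (by simp)) t.2
  obtain ⟨τ, hτ, h0⟩ := exists_isSec_cell hq he.2 (x := γ 0) (by rw [hqγ]; exact hmem 0)
  have hτγ : (fun t => τ ⟨_, he.lineMap_mem t⟩) = γ := by
    refine hq.eq_of_comp_eq (hτ.cont.comp_continuous (Continuous.subtype_mk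
      (AffineMap.lineMap_continuous.comp continuous_subtype_val) _) hmem) γ.continuous ?_ 0 ?_
    · funext t
      exact (hτ.inv _ (hmem t)).trans (hqγ t).symm
    · rw [hqγ] at h0
      exact h0
  obtain ⟨l, hl, hfl⟩ := hτ.exists_affineMap (hK := T.finite) hq h he.2
  have hlt : l a < l b := by
    rw [hl a (by simp) he.left_mem, hl b (by simp) he.right_mem]
    exact hh _ _ (hτ.liftedEdge he.2 (by simp) (by simp) hab _ _)
  refine isPositivelyTransverse_levelFoliation hf fun t t' htt' => ?_
  have hfγ : ∀ t, affineExt T.finite (T.homeo.symm ∘ p) h (γ t) =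
      AffineMap.lineMap (l a) (l b) (t : ℝ) := fun t => by
    rw [← hτγ, hfl _ (hmem t), AffineMap.apply_lineMap]
  simp only [hfγ]
  exact (lineMap_lt_lineMap_iff_of_lt' hlt).2 htt'

theorem isNormal_levelFoliation (hp : IsCoveringMap p) {h : X → ℝ}
    (hh : ∀ x y, LiftedEdge D p x y → h x < h y)
    (hf : ∀ x, ∃ φ : OpenPartialHomeomorph X (EuclideanSpace ℝ (Fin 2) × ℝ),
      (∀ y ∈ φ.source, (φ y).2 = affineExt T.finite (T.homeo.symm ∘ p) h y) ∧ x ∈ φ.source) :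
    (levelFoliation _ hf).IsNormal T p := by
  intro s hs _ τ hτ x z hz
  have hq : IsCoveringMap (T.homeo.symm ∘ p) := hp.homeomorph_comp _
  let σ' : T.K.space → X := fun y => if hy : (y : E) ∈ convexHull ℝ (s : Set E) then τ ⟨y, hy⟩
    else τ z
  have hval : ∀ y : T.K.space, ∀ hy : (y : E) ∈ convexHull ℝ (s : Set E), σ' y = τ ⟨y, hy⟩ :=
    fun y hy => dif_pos hy
  have hσ : IsSec (T.homeo.symm ∘ p) (cell T.K s) σ' := by
    refine ⟨?_, fun y hy => ?_⟩
    · rw [continuousOn_iff_continuous_domRestrict]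
      refine Continuous.congr (f := fun y : cell T.K s => τ ⟨y.1, y.2⟩) (by fun_prop) fun y => ?_
      exact (hval y.1 y.2).symm
    · rw [hval y hy, Function.comp_apply, hτ]
      exact T.homeo.symm_apply_apply _
  obtain ⟨l, hl, hfl⟩ := hσ.exists_affineMap (hK := T.finite) hq h hs
  have hlτ : ∀ y, affineExt T.finite (T.homeo.symm ∘ p) h (τ y) = l y := fun y => by
    rw [← hfl ⟨y, T.K.convexHull_subset_space hs y.2⟩ y.2, hval _ y.2]
  rw [pathComponentIn_leaf hf (convex_convexHull ℝ _) τ hlτ hz]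
  refine ⟨⟨z, rfl⟩, Homeomorph.refl _, fun _ _ _ => Iff.rfl, l, l z, fun a ha b hb hab => ?_, rfl⟩
  by_contra hne
  have haS := vertex_mem_space hs ha
  have hbS := vertex_mem_space hs hb
  rw [hl a ha haS, hl b hb hbS] at hab
  rcases D.out_xor a b (.of_mem hs ha hb hne) with ho | ho
  · exact (hh _ _ (hσ.liftedEdge hs ha hb ho.1 haS hbS)).ne hab
  · exact (hh _ _ (hσ.liftedEdge hs hb ha ho.1 hbS haS)).ne' hab

end Height

end TriFol

end

theorem theorem5p1
    {M : Type*} [TopologicalSpace M] [T2Space M] [CompactSpace M] [ConnectedSpace M]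
    [ChartedSpace (EuclideanSpace ℝ (Fin 3)) M]
    {E : Type*} [NormedAddCommGroup E] [NormedSpace ℝ E]
    (T : TriFol.Triangulation M E) (D : TriFol.Direction T.K)
    (hD : D.IsLocalOrientation) (hess : TriFol.DirectedLoopsEssential T D)
    {X : Type*} [TopologicalSpace X] [SimplyConnectedSpace X]
    (p : X → M) (hp : IsCoveringMap p) :
    ∃ F : TriFol.MeasuredFoliation X, F.IsTransverseTo T D p ∧ F.IsNormal T p := by
  obtain ⟨h, hh⟩ := TriFol.exists_height hess hp
  exact ⟨TriFol.levelFoliation _ (TriFol.exists_chart hD hp hh),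
    TriFol.isTransverseTo_levelFoliation hp hh _, TriFol.isNormal_levelFoliation hp hh _⟩
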